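/- Let $X$ be an oriented Riemannian manifold (without boundary) of even dimension $2m$ with a spin structure, let $S=S^+\oplus S^-$ be its spinor bundle, and let $(E,\nabla^E)$ be a flat Hermitian vector bundle of positive rank on $X$. Let $D^E=\sum_j c(e_j)\nabla^{E}_{e_j}$ be the Dirac operator on sections of $S\otimes E$, where $c$ is Clifford multiplication, $c(e_k)c(e_l)+c(e_l)c(e_k)=-2\delta_{kl}$ for a local oriented orthonormal frame $(e_k)$, and $\nabla^E$ also denotes the tensor product of the spin (Levi-Civita) connection with the flat connection. Let $\gamma=i^m c(e_1)\cdots c(e_{2m})$ be the grading involution. Let $H=\sum_{j\ge 1}H_j$ be a smooth complex differential form of positive degree ($H_j$ is its component of degree $j$), acting by $c(\alpha)=\sum_{k_1<\dots<k_j}\alpha(e_{k_1},\dots,e_{k_j})\,c(e_{k_1})\cdots c(e_{k_j})$ for $\alpha$ of degree $j$, and let $D^E_H=D^E+c(H)$. Call a differential operator $P$ on the sections of $S\otimes E$ self-adjoint if it equals its formal adjoint, that is, $\langle P\psi,\varphi\rangle_{L^2}=\langle\psi,P\varphi\rangle_{L^2}$ for all smooth compactly supported sections $\psi,\varphi$,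 with respect to the Riemannian volume. Then: 1. $D^E_H\gamma=-\gamma D^E_H$ on smooth sections if and only if $H\in\Omega^{odd}(X,\mathbb C)$, i.e. all components of $H$ of even degree vanish. 2. $D^E_H$ is self-adjoint if and only if $$H=\sum_{k\ge1}(A_{4k}+iB_{4k-2})+(A_{4k-1}+iB_{4k-3})$$ where $A_j$, $B_j$ are real differential forms of degree $j$ on $X$. 3. At each point of $X$, Clifford multiplication by a nonzero real form of degree $j$ is self-adjoint if and only if $j\equiv 0$ or $3$ modulo $4$, and Clifford multiplication by a real form of any other degree is skew-adjoint. -/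

import Mathlib

open Bundle Manifold MeasureTheory Topology
open scoped ContDiff TensorProduct

noncomputable section

namespace TwistedDirac

/-- Euclidean space `ℝ^{2m}`, the model space of manifolds of dimension `2m`. -/
abbrev Model (m : ℕ) : Type := EuclideanSpace ℝ (Fin (2 * m))

/-- Smooth Riemannian metrics on a manifold of dimension `2m`. -/
abbrev Metric (m : ℕ) (X : Type*) [TopologicalSpace X] [ChartedSpace (Model m) X]
    [IsManifold (𝓡 (2 * m)) ∞ X] :=
  ContMDiffRiemannianMetric (𝓡 (2 * m)) ∞ (Model m) (fun x : X => TangentSpace (𝓡 (2 * m)) x)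

/-! ### Riemannian volume -/

section Volume

variable {m : ℕ} {X : Type*} [TopologicalSpace X] [ChartedSpace (Model m) X]
  [IsManifold (𝓡 (2 * m)) ∞ X]

/-- The volume density `√det (g(∂ᵢ, ∂ⱼ))` of the metric `g` in the chart around `x`,
as a function on the range of the chart; `∂ᵢ` are the coordinate vector fields. -/
def volumeDensity (g : Metric m X) (x : X) (u : Model m) : ℝ :=
  Real.sqrt (Matrix.det (Matrix.of fun i j : Fin (2 * m) =>
    g.inner ((extChartAt (𝓡 (2 * m)) x).symm u)
      (mfderiv 𝓘(ℝ, Model m) (𝓡 (2 * m)) (extChartAt (𝓡 (2 * m)) x).symm u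
        (EuclideanSpace.single i (1 : ℝ)))
      (mfderiv 𝓘(ℝ, Model m) (𝓡 (2 * m)) (extChartAt (𝓡 (2 * m)) x).symm u
        (EuclideanSpace.single j (1 : ℝ)))))

/-- The Riemannian volume measure of the domain of the chart around `x`: the measure
`√det g du¹ ⋯ duⁿ` on the range of the chart, transported to `X`. -/
def chartVolume [MeasurableSpace X] (g : Metric m X) (x : X) : Measure X :=
  ((volume.restrict (extChartAt (𝓡 (2 * m)) x).target).withDensity
    (fun u => ENNReal.ofReal (volumeDensity g x u))).map (extChartAt (𝓡 (2 * m)) x).symm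

/-- The Riemannian volume measure of `X`. The chart measures agree on overlaps, so the least
measure which dominates all of them is the measure which restricts to each of them. -/
def riemannianVolume [MeasurableSpace X] (g : Metric m X) : Measure X :=
  ⨆ x : X, chartVolume g x

end Volume

/-! ### Differential forms -/

/-- Smooth differential forms of degree `j` on `X`, with values in `K` (here `K = ℝ` or `ℂ`):
a family of alternating `j`-linear forms on the tangent spaces which is smooth, in the sense that
its values on smooth vector fields defined on open sets are smooth functions. -/
structure DifferentialForm (m : ℕ) (X : Type*) [TopologicalSpace X] [ChartedSpace (Model m) X]
    [IsManifold (𝓡 (2 * m)) ∞ X] (K : Type*) [NormedAddCommGroup K] [NormedSpace ℝ K] (j : ℕ) where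
  /-- The alternating form at a point. -/
  toFun : ∀ x : X, TangentSpace (𝓡 (2 * m)) x [⋀^Fin j]→L[ℝ] K
  smooth : ∀ U : Set X, IsOpen U → ∀ V : Fin j → ∀ x : X, TangentSpace (𝓡 (2 * m)) x,
    (∀ p, ContMDiffOn (𝓡 (2 * m)) (𝓡 (2 * m)).tangent ∞
      (fun x => (⟨x, V p x⟩ : TangentBundle (𝓡 (2 * m)) X)) U) →
    ContMDiffOn (𝓡 (2 * m)) 𝓘(ℝ, K) ∞ (fun x => toFun x (fun p => V p x)) U

/-! ### Clifford algebra and spinor module -/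

/-- The quadratic form `-|v|²` on `ℝ^{2m}`, so that `v · v = -|v|²` in its Clifford algebra. -/
def negSq (m : ℕ) : QuadraticForm ℝ (Fin (2 * m) → ℝ) :=
  QuadraticMap.weightedSumSquares ℝ (fun _ => (-1 : ℝ))

/-- The Clifford algebra of `ℝ^{2m}` with the relations `eₖ eₗ + eₗ eₖ = -2 δₖₗ`. -/
abbrev Cl (m : ℕ) : Type := CliffordAlgebra (negSq m)

/-- The `k`-th standard generator of the Clifford algebra. -/
def gen (m : ℕ) (k : Fin (2 * m)) : Cl m := CliffordAlgebra.ι (negSq m) (Pi.single k 1)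

/-- A spinor module: a complex Hermitian space of dimension `2^m` on which the Clifford algebra of
`ℝ^{2m}` acts, vectors acting by skew-adjoint operators. This is the irreducible complex
representation of the Clifford algebra, and it is unique up to unitary isomorphism. -/
structure SpinorModule (m : ℕ) (S : Type*) [NormedAddCommGroup S] [InnerProductSpace ℂ S] where
  /-- The action of the Clifford algebra. -/
  c : Cl m →ₐ[ℝ] Module.End ℂ S
  finrank_eq : Module.finrank ℂ S = 2 ^ m
  skew : ∀ (v : Fin (2 * m) → ℝ) (s t : S),
    inner ℂ (c (CliffordAlgebra.ι (negSq m) v) s) t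
      = - inner ℂ s (c (CliffordAlgebra.ι (negSq m) v) t)

/-! ### Spin structures -/

/-- A spin structure on a Riemannian manifold of dimension `2m`, in terms of local data: an open
cover `U a`, a smooth orthonormal frame `e^a` on each `U a`, and smooth functions
`g_{ab} : U a ∩ U b → Spin(2m)` which satisfy the cocycle condition and lift the transition
functions of the frames, i.e. `Ad(g_{ab}) = A_{ab}` where `e^b_k = ∑ₗ (A_{ab})_{lk} e^a_l`.
Since the image of `Spin(2m)` in the orthogonal group is `SO(2m)`, the frames have transition
functions in `SO(2m)`; they are the positively oriented ones for the orientation of `X`. -/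
structure SpinStructure {m : ℕ} {X : Type*} [TopologicalSpace X] [ChartedSpace (Model m) X]
    [IsManifold (𝓡 (2 * m)) ∞ X] (g : Metric m X) (ι : Type*) where
  /-- The open cover. -/
  U : ι → Set X
  isOpen_U : ∀ a, IsOpen (U a)
  cover : ∀ x, ∃ a, x ∈ U a
  /-- The local frames. -/
  frame : ι → Fin (2 * m) → ∀ x : X, TangentSpace (𝓡 (2 * m)) x
  frame_smooth : ∀ a k, ContMDiffOn (𝓡 (2 * m)) (𝓡 (2 * m)).tangent ∞
    (fun x => (⟨x, frame a k x⟩ : TangentBundle (𝓡 (2 * m)) X)) (U a)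
  frame_orthonormal : ∀ a, ∀ x ∈ U a, ∀ k l,
    g.inner x (frame a k x) (frame a l x) = if k = l then 1 else 0
  /-- The transition functions. -/
  trans : ι → ι → X → Cl m
  trans_mem : ∀ a b, ∀ x ∈ U a ∩ U b, trans a b x ∈ spinGroup (negSq m)
  trans_smooth : ∀ a b, ∀ f : Cl m →ₗ[ℝ] ℝ,
    ContMDiffOn (𝓡 (2 * m)) 𝓘(ℝ, ℝ) ∞ (fun x => f (trans a b x)) (U a ∩ U b)
  trans_comp : ∀ a b c, ∀ x ∈ U a ∩ U b ∩ U c, trans a b x * trans b c x = trans a c x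
  trans_frame : ∀ a b, ∀ x ∈ U a ∩ U b, ∀ k,
    trans a b x * gen m k
      = (∑ l, g.inner x (frame a l x) (frame b k x) • gen m l) * trans a b x

/-! ### Flat Hermitian bundles -/

/-- A flat Hermitian vector bundle with fibre the Hermitian space `W`, in terms of local
parallel unitary frames: an open cover `V a` and locally constant unitary transition functions
`h_{ab}` on `V a ∩ V b` which satisfy the cocycle condition. The flat Hermitian connection is the
one which in each of the corresponding local trivialisations is the ordinary differential `d`. -/
structure FlatHermitianBundle (X : Type*) [TopologicalSpace X] (W : Type*) [NormedAddCommGroup W]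
    [InnerProductSpace ℂ W] (κ : Type*) where
  /-- The open cover. -/
  V : κ → Set X
  isOpen_V : ∀ a, IsOpen (V a)
  cover : ∀ x, ∃ a, x ∈ V a
  /-- The transition functions. -/
  trans : κ → κ → X → (W ≃ₗᵢ[ℂ] W)
  trans_locConst : ∀ a b, ∀ x ∈ V a ∩ V b, ∀ᶠ y in 𝓝 x, trans a b y = trans a b x
  trans_comp : ∀ a b c, ∀ x ∈ V a ∩ V b ∩ V c, ∀ w,
    trans a b x (trans b c x w) = trans a c x w

/-! ### The bundle `S ⊗ E` -/

/-- The fibre `S ⊗ W` of the bundle `S ⊗ E`. It is a type of its own so that its real structure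
is the one which underlies its structure of a complex Hermitian space. -/
def Fibre (S W : Type*) [NormedAddCommGroup S] [InnerProductSpace ℂ S] [NormedAddCommGroup W]
    [InnerProductSpace ℂ W] : Type _ := S ⊗[ℂ] W

section FibreInstances

variable (S W : Type*) [NormedAddCommGroup S] [InnerProductSpace ℂ S] [NormedAddCommGroup W]
    [InnerProductSpace ℂ W]

instance : NormedAddCommGroup (Fibre S W) := inferInstanceAs (NormedAddCommGroup (S ⊗[ℂ] W))

instance : InnerProductSpace ℂ (Fibre S W) := inferInstanceAs (InnerProductSpace ℂ (S ⊗[ℂ] W))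

instance [FiniteDimensional ℂ S] [FiniteDimensional ℂ W] : FiniteDimensional ℂ (Fibre S W) :=
  inferInstanceAs (FiniteDimensional ℂ (S ⊗[ℂ] W))

end FibreInstances

section Bundle

variable {m : ℕ} {X : Type*} [TopologicalSpace X] [ChartedSpace (Model m) X]
  [IsManifold (𝓡 (2 * m)) ∞ X] {g : Metric m X}
  {S : Type*} [NormedAddCommGroup S] [InnerProductSpace ℂ S] [FiniteDimensional ℂ S]
  {W : Type*} [NormedAddCommGroup W] [InnerProductSpace ℂ W] [FiniteDimensional ℂ W]
  {ι κ : Type*}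

/-- The operator `c(a) ⊗ u` on `S ⊗ W`. -/
def tensorAction (Δ : SpinorModule m S) (a : Cl m) (u : W →ₗ[ℂ] W) : Fibre S W →ₗ[ℂ] Fibre S W :=
  (TensorProduct.map (Δ.c a) u : S ⊗[ℂ] W →ₗ[ℂ] S ⊗[ℂ] W)

/-- Clifford multiplication `c(a) ⊗ 1` on `S ⊗ W`. -/
def cl (Δ : SpinorModule m S) (W : Type*) [NormedAddCommGroup W] [InnerProductSpace ℂ W]
    (a : Cl m) : Fibre S W →ₗ[ℂ] Fibre S W :=
  tensorAction Δ a LinearMap.id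

/-- `c(a) ⊗ u` as a continuous real-linear operator. -/
def tensorActionL (Δ : SpinorModule m S) (a : Cl m) (u : W →ₗ[ℂ] W) :
    Fibre S W →L[ℝ] Fibre S W :=
  (LinearMap.toContinuousLinearMap (tensorAction Δ a u)).restrictScalars ℝ

theorem tensorActionL_apply (Δ : SpinorModule m S) (a : Cl m) (u : W →ₗ[ℂ] W) (v : Fibre S W) :
    tensorActionL Δ a u v = (TensorProduct.map (Δ.c a) u : S ⊗[ℂ] W →ₗ[ℂ] S ⊗[ℂ] W) v := rfl

/-- The operator `c(a) ⊗ u` depends linearly on `a`. -/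
def tensorActionLin (Δ : SpinorModule m S) (u : W →ₗ[ℂ] W) :
    Cl m →ₗ[ℝ] (Fibre S W →L[ℝ] Fibre S W) where
  toFun a := tensorActionL Δ a u
  map_add' a b := by
    ext v
    change (TensorProduct.map (Δ.c (a + b)) u : S ⊗[ℂ] W →ₗ[ℂ] S ⊗[ℂ] W) v
      = (TensorProduct.map (Δ.c a) u : S ⊗[ℂ] W →ₗ[ℂ] S ⊗[ℂ] W) v
        + (TensorProduct.map (Δ.c b) u : S ⊗[ℂ] W →ₗ[ℂ] S ⊗[ℂ] W) v
    rw [map_add, TensorProduct.map_add_left]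
    rfl
  map_smul' r a := by
    ext v
    have h : Δ.c (r • a) = (r : ℂ) • Δ.c a := by
      rw [map_smul]
      rfl
    change (TensorProduct.map (Δ.c (r • a)) u : S ⊗[ℂ] W →ₗ[ℂ] S ⊗[ℂ] W) v
      = (r : ℂ) • (TensorProduct.map (Δ.c a) u : S ⊗[ℂ] W →ₗ[ℂ] S ⊗[ℂ] W) v
    rw [h, TensorProduct.map_smul_left]
    rfl

theorem spin_trans_self (σ : SpinStructure g ι) (a : ι) {x : X} (hx : x ∈ σ.U a) :
    σ.trans a a x = 1 := by
  have h1 := σ.trans_comp a a a x ⟨⟨hx, hx⟩, hx⟩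
  have h2 : star (σ.trans a a x) * σ.trans a a x = 1 :=
    pinGroup.star_mul_self_of_mem (σ.trans_mem a a x ⟨hx, hx⟩).1
  calc σ.trans a a x = (star (σ.trans a a x) * σ.trans a a x) * σ.trans a a x := by
        rw [h2, one_mul]
    _ = star (σ.trans a a x) * σ.trans a a x := by rw [mul_assoc, h1]
    _ = 1 := h2

theorem flat_trans_self (E : FlatHermitianBundle X W κ) (a : κ) {x : X} (hx : x ∈ E.V a) (w : W) :
    E.trans a a x w = w :=
  (E.trans a a x).injective (E.trans_comp a a a x ⟨⟨hx, hx⟩, hx⟩ w)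

theorem contMDiffOn_tensorActionL (Δ : SpinorModule m S) (σ : SpinStructure g ι)
    (E : FlatHermitianBundle X W κ) (a b : ι) (a' b' : κ) :
    ContMDiffOn (𝓡 (2 * m)) 𝓘(ℝ, Fibre S W →L[ℝ] Fibre S W) ∞
      (fun x => tensorActionL Δ (σ.trans a b x)
        ((E.trans a' b' x).toLinearEquiv : W →ₗ[ℂ] W))
      ((σ.U a ∩ σ.U b) ∩ (E.V a' ∩ E.V b')) := by
  -- with `u` fixed, `a ↦ c(a) ⊗ u` is linear, so its coordinates in a basis are linear in `a`
  have key : ∀ u : W →ₗ[ℂ] W, ContMDiffOn (𝓡 (2 * m)) 𝓘(ℝ, Fibre S W →L[ℝ] Fibre S W) ∞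
      (fun x => tensorActionL Δ (σ.trans a b x) u) (σ.U a ∩ σ.U b) := by
    intro u
    have : FiniteDimensional ℝ (Fibre S W) := FiniteDimensional.complexToReal _
    let B := Module.finBasis ℝ (Fibre S W →L[ℝ] Fibre S W)
    let L := tensorActionLin Δ u
    have h : (fun x => tensorActionL Δ (σ.trans a b x) u)
        = fun x => ∑ i, (B.coord i ∘ₗ L) (σ.trans a b x) • B i := by
      funext x
      exact (B.sum_repr (L (σ.trans a b x))).symm
    rw [h]
    refine contMDiffOn_finsetSum fun i _ => ?_
    exact (σ.trans_smooth a b (B.coord i ∘ₗ L)).smul contMDiffOn_const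
  intro x hx
  refine ((key ((E.trans a' b' x).toLinearEquiv : W →ₗ[ℂ] W) x hx.1).mono
    Set.inter_subset_left).congr_of_eventuallyEq ?_ rfl
  filter_upwards [mem_nhdsWithin_of_mem_nhds (E.trans_locConst a' b' x hx.2)] with y hy
  rw [hy]

/-- The complex vector bundle `S ⊗ E` over `X`, with fibre `S ⊗ W`, for the spinor bundle `S` of a
spin structure. Its local trivialisations are indexed by pairs consisting of a local spin frame
and a local parallel unitary frame of `E`; a change of frames acts through
`ρ(g_{ab}) ⊗ h_{a'b'}`. -/
def twistedSpinorBundle (Δ : SpinorModule m S) (σ : SpinStructure g ι)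
    (E : FlatHermitianBundle X W κ) : VectorBundleCore ℝ X (Fibre S W) (ι × κ) where
  baseSet i := σ.U i.1 ∩ E.V i.2
  isOpen_baseSet i := (σ.isOpen_U i.1).inter (E.isOpen_V i.2)
  indexAt x := ((σ.cover x).choose, (E.cover x).choose)
  mem_baseSet_at x := ⟨(σ.cover x).choose_spec, (E.cover x).choose_spec⟩
  coordChange i j x := tensorActionL Δ (σ.trans j.1 i.1 x)
    ((E.trans j.2 i.2 x).toLinearEquiv : W →ₗ[ℂ] W)
  coordChange_self i x hx v := by
    have h : ((E.trans i.2 i.2 x).toLinearEquiv : W →ₗ[ℂ] W) = LinearMap.id := by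
      ext w
      exact flat_trans_self E i.2 hx.2 w
    rw [tensorActionL_apply, h, spin_trans_self σ i.1 hx.1, map_one, Module.End.one_eq_id,
      TensorProduct.map_id]
    rfl
  continuousOn_coordChange i j :=
    (contMDiffOn_tensorActionL Δ σ E j.1 i.1 j.2 i.2).continuousOn.mono
      fun _ hx => ⟨⟨hx.2.1, hx.1.1⟩, ⟨hx.2.2, hx.1.2⟩⟩
  coordChange_comp i j k x hx v := by
    have h : ((E.trans k.2 i.2 x).toLinearEquiv : W →ₗ[ℂ] W)
        = ((E.trans k.2 j.2 x).toLinearEquiv : W →ₗ[ℂ] W)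
          ∘ₗ ((E.trans j.2 i.2 x).toLinearEquiv : W →ₗ[ℂ] W) := by
      ext w
      exact (E.trans_comp k.2 j.2 i.2 x ⟨⟨hx.2.2, hx.1.2.2⟩, hx.1.1.2⟩ w).symm
    rw [tensorActionL_apply, tensorActionL_apply, tensorActionL_apply, h,
      ← σ.trans_comp k.1 j.1 i.1 x ⟨⟨hx.2.1, hx.1.2.1⟩, hx.1.1.1⟩, map_mul,
      Module.End.mul_eq_comp, TensorProduct.map_comp]
    rfl

instance (Δ : SpinorModule m S) (σ : SpinStructure g ι) (E : FlatHermitianBundle X W κ) :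
    (twistedSpinorBundle Δ σ E).IsContMDiff (𝓡 (2 * m)) ∞ where
  contMDiffOn_coordChange i j :=
    (contMDiffOn_tensorActionL Δ σ E j.1 i.1 j.2 i.2).mono
      fun _ hx => ⟨⟨hx.2.1, hx.1.1⟩, ⟨hx.2.2, hx.1.2⟩⟩

/-- Sections of `S ⊗ E` which need not be smooth. The value at `x` is expressed in the
frames which the bundle chooses at `x`. -/
abbrev SpinorField (Δ : SpinorModule m S) (σ : SpinStructure g ι)
    (E : FlatHermitianBundle X W κ) : Type _ :=
  ∀ x : X, (twistedSpinorBundle Δ σ E).Fiber x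

variable {Δ : SpinorModule m S} {σ : SpinStructure g ι} {E : FlatHermitianBundle X W κ}

/-- Smooth sections of `S ⊗ E`. -/
def SpinorField.IsSmooth (ψ : SpinorField Δ σ E) : Prop :=
  ContMDiff (𝓡 (2 * m)) ((𝓡 (2 * m)).prod 𝓘(ℝ, Fibre S W)) ∞
    (fun x => (⟨x, ψ x⟩ : TotalSpace (Fibre S W) (twistedSpinorBundle Δ σ E).Fiber))

/-- Sections of `S ⊗ E` with compact support. -/
def SpinorField.IsCompactlySupported (ψ : SpinorField Δ σ E) : Prop :=
  IsCompact (closure {x | ψ x ≠ 0})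

/-- The value of `ψ` at `x` in the frames which the bundle chooses at `x`. -/
def SpinorField.val (ψ : SpinorField Δ σ E) (x : X) : Fibre S W := ψ x

/-- The section `ψ` expressed in the local frames with index `i`, as a function with values in
`S ⊗ W`. -/
def SpinorField.loc (ψ : SpinorField Δ σ E) (i : ι × κ) (x : X) : Fibre S W :=
  (twistedSpinorBundle Δ σ E).coordChange ((twistedSpinorBundle Δ σ E).indexAt x) i x (ψ.val x)

/-! ### The Dirac operator -/

/-- The coefficients `ω_{kl}(e_j) = g(∇_{e_j} e_k, e_l)` at `x` of the Levi-Civita connection in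
the orthonormal frame with index `a`, by the Koszul formula. -/
def leviCivitaCoeff (σ : SpinStructure g ι) (a : ι) (x : X) (j k l : Fin (2 * m)) : ℝ :=
  (g.inner x (VectorField.mlieBracket (𝓡 (2 * m)) (σ.frame a j) (σ.frame a k) x) (σ.frame a l x)
    - g.inner x (VectorField.mlieBracket (𝓡 (2 * m)) (σ.frame a k) (σ.frame a l) x) (σ.frame a j x)
    + g.inner x (VectorField.mlieBracket (𝓡 (2 * m)) (σ.frame a l) (σ.frame a j) x)
        (σ.frame a k x)) / 2

/-- The covariant derivative `∇^E_{e_j} ψ` at `x`, for the tensor product of the spin connection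
and the flat connection of `E`: in the local frames with index `i`, it is
`∂_{e_j} ψ + (1/4) ∑_{k,l} g(∇_{e_j} e_k, e_l) e_k e_l ψ`. -/
def SpinorField.covDeriv (ψ : SpinorField Δ σ E) (i : ι × κ) (x : X) (j : Fin (2 * m)) :
    Fibre S W :=
  mvfderiv (𝓡 (2 * m)) (ψ.loc i) x (σ.frame i.1 j x)
    + cl Δ W ((1 / 4 : ℝ) • ∑ k, ∑ l, leviCivitaCoeff σ i.1 x j k l • (gen m k * gen m l))
        (ψ.loc i x)

/-- The Dirac operator `D^E ψ = ∑ⱼ c(e_j) ∇^E_{e_j} ψ`. -/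
def dirac (ψ : SpinorField Δ σ E) : SpinorField Δ σ E := fun x =>
  (∑ j, cl Δ W (gen m j) (ψ.covDeriv ((twistedSpinorBundle Δ σ E).indexAt x) x j) : Fibre S W)

/-- Clifford multiplication by a complex alternating form `α` of degree `j` on the tangent space
at `x`, as an operator on the fibre of `S ⊗ E` at `x`:
`c(α) = ∑_{k₁ < ⋯ < k_j} α(e_{k₁}, …, e_{k_j}) c(e_{k₁}) ⋯ c(e_{k_j})`
for the orthonormal frame at `x`. -/
def cliffordMul (Δ : SpinorModule m S) (σ : SpinStructure g ι) (E : FlatHermitianBundle X W κ)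
    {j : ℕ} (x : X) (α : TangentSpace (𝓡 (2 * m)) x [⋀^Fin j]→L[ℝ] ℂ) :
    Fibre S W →ₗ[ℂ] Fibre S W :=
  open Classical in
  ∑ f : Fin j → Fin (2 * m) with StrictMono f,
    α (fun p => σ.frame ((twistedSpinorBundle Δ σ E).indexAt x).1 (f p) x) •
      cl Δ W (List.ofFn (fun p => gen m (f p))).prod

/-- The twisted Dirac operator `D^E_H = D^E + c(H)`, where `H = ∑ⱼ H j` is a complex differential
form with homogeneous components `H j` (which vanish for `j > 2m`). -/
def twistedDirac (H : ∀ j, DifferentialForm m X ℂ j) (ψ : SpinorField Δ σ E) :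
    SpinorField Δ σ E := fun x =>
  ((dirac ψ).val x + ∑ j ∈ Finset.range (2 * m + 1), cliffordMul Δ σ E x ((H j).toFun x) (ψ.val x) :
    Fibre S W)

/-- The grading involution `γ`, which is Clifford multiplication by `i^m e_1 ⋯ e_{2m}`. -/
def grading (ψ : SpinorField Δ σ E) : SpinorField Δ σ E := fun x =>
  (Complex.I ^ m • cl Δ W (List.ofFn (gen m)).prod (ψ.val x) : Fibre S W)

/-- The `L²` inner product `∫_X ⟨ψ, φ⟩ dvol`. The Hermitian metric of `S ⊗ E` is that of `S ⊗ W` in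
each of the local frames. -/
def l2Inner [MeasurableSpace X] (ψ φ : SpinorField Δ σ E) : ℂ :=
  ∫ x, inner ℂ (ψ.val x) (φ.val x) ∂(riemannianVolume g)

/-- A differential operator on the sections of `S ⊗ E` is (formally) self-adjoint if
`⟨D ψ, φ⟩ = ⟨ψ, D φ⟩` for all smooth sections `ψ`, `φ` with compact support. -/
def IsFormallySelfAdjoint [MeasurableSpace X] (D : SpinorField Δ σ E → SpinorField Δ σ E) : Prop :=
  ∀ ψ φ : SpinorField Δ σ E, ψ.IsSmooth → φ.IsSmooth →
    ψ.IsCompactlySupported → φ.IsCompactlySupported → l2Inner (D ψ) φ = l2Inner ψ (D φ)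

end Bundle

end TwistedDirac

end

/-! The proof combines linear algebra of the Clifford relations in even dimension, frame
independence of the Dirac operator, and one integration by parts.

Algebra. A product of generators that anticommutes with some generator has trace zero. Because `2m`
is even, every nonempty increasing product has this property (`exists_odd_of_sorted`), so increasing
products are orthogonal for the pairing tr(reverse · product) and linearly independent in any
nonzero representation (`linearIndependent_prod`). Hence Clifford multiplication is injective on
forms, all degrees taken together (`coeff_eq_zero_of_sum_cliffordSum_eq_zero`). Taking adjoints
multiplies an increasing product of length j by (-1)^(j(j+1)/2) (`star_gen_prod`), and moving it
past γ gives (-1)^j (`gradingOp_cliffordSum`). The first sign and injectivity prove the third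
assertion.

Grading. D^E anticommutes with γ, so D^E_H γ + γ D^E_H is twice γ times Clifford multiplication by
the even part of H. This has order zero, smooth sections take arbitrary values at a point, and γ is
invertible. Injectivity then gives the first assertion.

Self-adjointness. The difference ⟨Dψ, φ⟩ - ⟨ψ, Dφ⟩ is minus the divergence of the complex vector
field with components ⟨ψ, c(e_l) φ⟩ (`inner_diracLoc_sub`, `sum_fderiv_density_smul`). It integrates
to zero in a chart, and a partition of unity gives the global statement (`integral_inner_dirac_eq`).
So D^E_H is self-adjoint exactly when c(H) is symmetric under the integral. Sections cut off by bump
functions make this a pointwise condition, and comparing coefficients turns it into H_j =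
(-1)^(j(j+1)/2) times the conjugate of H_j.

Frames. Sections, `dirac` and `cliffordMul` are expressed in a frame chosen separately at each
point, so nothing can be differentiated or integrated before frame independence is known
(`dirac_loc`, `changeOp_formLoc`). For the spin connection, the Koszul coefficients obey the usual
inhomogeneous law, and the discrepancy between the two lifted connections commutes with all
generators. It also has trace zero, since the real part of the trace on unitary elements is maximal
at 1 and so has vanishing derivative there. By irreducibility the discrepancy acts as zero
(`spin_connection_change`). -/

noncomputable section

namespace TwistedDirac

/-! ### Products of Clifford generators -/

/-- A family of elements of a ring which satisfies the relations
`γ k * γ l + γ l * γ k = -2 δ k l` of an orthonormal frame in a Clifford algebra. -/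
structure IsCliffordFamily {n : ℕ} {A : Type*} [Ring A] (γ : Fin n → A) : Prop where
  sq : ∀ k, γ k * γ k = -1
  anticomm : ∀ k l, k ≠ l → γ k * γ l = -(γ l * γ k)

namespace IsCliffordFamily

variable {n : ℕ} {A : Type*} [Ring A] {γ : Fin n → A}

/-- Every factor different from `γ k` contributes a sign, and every factor equal to it contributes
none. The exponent is length minus count, written with a plus because only its parity matters. -/
theorem mul_prod (h : IsCliffordFamily γ) (k : Fin n) (l : List (Fin n)) :
    γ k * (l.map γ).prod = (-1) ^ (l.length + l.count k) * ((l.map γ).prod * γ k) := by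
  induction l with
  | nil => simp
  | cons a l ih =>
    have hc : ∀ (r : ℕ) (x y : A), x * ((-1) ^ r * y) = (-1) ^ r * (x * y) := by
      intro r x y
      rw [← mul_assoc, ← mul_assoc, ((Commute.neg_one_right x).pow_right r).eq]
    simp only [List.map_cons, List.prod_cons, List.length_cons, List.count_cons]
    by_cases hk : a = k
    · subst hk
      rw [if_pos (beq_self_eq_true a), mul_assoc (γ a) (l.map γ).prod,
        show l.length + 1 + (l.count a + 1) = l.length + l.count a + 2 by ring, pow_add, neg_one_sq,
        mul_one, ← hc, ← ih]
    · rw [← mul_assoc, h.anticomm k a (Ne.symm hk), neg_mul, mul_assoc, ih, hc]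
      simp only [beq_iff_eq, hk, if_false, add_zero]
      rw [show l.length + 1 + l.count k = l.length + l.count k + 1 by ring, pow_succ]
      simp [mul_assoc]

/-- The product telescopes from the middle, each pair of equal neighbours giving `-1`. -/
theorem reverse_prod_mul_prod (h : IsCliffordFamily γ) (l : List (Fin n)) :
    (l.reverse.map γ).prod * (l.map γ).prod = (-1) ^ l.length := by
  induction l with
  | nil => simp
  | cons a l ih =>
    simp only [List.reverse_cons, List.map_append, List.map_cons, List.map_nil, List.prod_append,
      List.prod_cons, List.prod_nil, mul_one, List.length_cons, pow_succ]
    rw [mul_assoc, ← mul_assoc (γ a) (γ a), h.sq, ← mul_assoc, mul_neg_one, neg_mul, ih]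
    simp

variable {R : Type*} [Field R] [CharZero R] [Algebra R A]

/-- A trace vanishes on products which anticommute with some generator. -/
theorem trace_mul_prod_eq_zero (h : IsCliffordFamily γ) (τ : A →ₗ[R] R)
    (hτ : ∀ a b, τ (a * b) = τ (b * a)) (Z : A) (l : List (Fin n)) (k : Fin n)
    (hZ : Commute Z (γ k)) (hk : Odd (l.length + l.count k)) : τ (Z * (l.map γ).prod) = 0 := by
  have h1 : γ k * (l.map γ).prod = -((l.map γ).prod * γ k) := by
    rw [h.mul_prod, hk.neg_one_pow, neg_one_mul]
  -- The trace of `γ k * (Z * P) * γ k`, with `P` the product, is computed twice. Anticommuting `γ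
  -- k` through `P` costs one sign more than cyclicity does.
  have h2 : τ (γ k * (Z * (l.map γ).prod * γ k)) = τ (Z * (l.map γ).prod) := by
    rw [← mul_assoc, ← mul_assoc, ← hZ.eq, mul_assoc Z, h1, mul_neg, neg_mul, mul_assoc Z,
      mul_assoc, h.sq]
    simp
  have h3 : τ (γ k * (Z * (l.map γ).prod * γ k)) = - τ (Z * (l.map γ).prod) := by
    rw [hτ, mul_assoc, h.sq, mul_neg_one, map_neg]
  have h4 : (2 : R) * τ (Z * (l.map γ).prod) = 0 := by
    rw [two_mul]
    nth_rewrite 1 [← h2]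
    rw [h3]
    simp
  simpa using h4

/-- Modulo two only the symmetric difference D of the two supports matters, and the parity in
question is |D| + [k ∈ D]. If |D| is even, any k in D works, and D is nonempty. If |D| is odd, D
cannot be the whole index set, which has even size `2 * m`, so any k outside D works. This is where
even dimension is essential. -/
theorem exists_odd_of_sorted {m : ℕ} {l₁ l₂ : List (Fin (2 * m))} (h₁ : l₁.SortedLT)
    (h₂ : l₂.SortedLT) (hne : l₁ ≠ l₂) :
    ∃ k, Odd ((l₁.reverse ++ l₂).length + (l₁.reverse ++ l₂).count k) := by
  have hcount : ∀ {l : List (Fin (2 * m))}, l.SortedLT → ∀ k,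
      l.count k = if k ∈ l.toFinset then 1 else 0 := by
    intro l hl k
    by_cases hk : k ∈ l
    · simp [hk, List.count_eq_one_of_mem hl.nodup hk]
    · simp [hk, List.count_eq_zero_of_not_mem hk]
  have hcard : ∀ {l : List (Fin (2 * m))}, l.SortedLT → l.length = l.toFinset.card := by
    intro l hl
    rw [List.toFinset_card_of_nodup hl.nodup]
  have hF : l₁.toFinset ≠ l₂.toFinset := by
    intro h
    exact hne (h₁.eq_of_mem_iff h₂ fun a => by
      rw [← List.mem_toFinset, h, List.mem_toFinset])
  simp only [List.length_append, List.length_reverse, List.count_append, List.count_reverse]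
  simp only [hcount h₁, hcount h₂, hcard h₁, hcard h₂]
  set I := l₁.toFinset
  set J := l₂.toFinset
  by_contra! hcon
  have hI : (symmDiff I J).card + 2 * (I ∩ J).card = I.card + J.card := by
    have e1 := Finset.card_sdiff_add_card_inter I J
    have e2 := Finset.card_sdiff_add_card_inter J I
    rw [Finset.inter_comm J I] at e2
    have e3 : (symmDiff I J).card = (I \ J).card + (J \ I).card := by
      rw [symmDiff, Finset.sup_eq_union]
      exact Finset.card_union_of_disjoint disjoint_sdiff_sdiff
    omega
  have hmem : ∀ k, k ∈ symmDiff I J ↔ Odd ((if k ∈ I then 1 else 0) + (if k ∈ J then 1 else 0)) := by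
    intro k
    rw [Finset.mem_symmDiff]
    by_cases hI : k ∈ I <;> by_cases hJ : k ∈ J <;> simp [hI, hJ]
  have key : ∀ k, k ∈ symmDiff I J ↔ Odd (symmDiff I J).card := by
    intro k
    have := hcon k
    rw [Nat.not_odd_iff_even, ← hI, Nat.even_add] at this
    rw [hmem, ← Nat.not_even_iff_odd, ← Nat.not_even_iff_odd, ← this]
    simp [Nat.even_add]
  by_cases hodd : Odd (symmDiff I J).card
  · have : symmDiff I J = Finset.univ := Finset.eq_univ_iff_forall.2 fun k => (key k).2 hodd
    rw [this, Finset.card_univ, Fintype.card_fin] at hodd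
    exact (Nat.not_odd_iff_even.2 (even_two_mul m)) hodd
  · have : symmDiff I J = ∅ := Finset.eq_empty_iff_forall_notMem.2 fun k hk => hodd ((key k).1 hk)
    exact hF (symmDiff_eq_bot.1 this)

/-! ### Complex representations of the Clifford relations. -/

section End

variable {m : ℕ} {V : Type*} [AddCommGroup V] [Module ℂ V] [FiniteDimensional ℂ V]
  {γ : Fin (2 * m) → Module.End ℂ V}

-- Orthogonality of distinct increasing products for the trace pairing; the reversal makes the
-- diagonal entries nonzero.
omit [FiniteDimensional ℂ V] in
theorem trace_reverse_mul_eq_zero (h : IsCliffordFamily γ) {l₁ l₂ : List (Fin (2 * m))}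
    (h₁ : l₁.SortedLT) (h₂ : l₂.SortedLT) (hne : l₁ ≠ l₂) :
    LinearMap.trace ℂ V ((l₁.reverse.map γ).prod * (l₂.map γ).prod) = 0 := by
  obtain ⟨k, hk⟩ := exists_odd_of_sorted h₁ h₂ hne
  have := h.trace_mul_prod_eq_zero (LinearMap.trace ℂ V) (LinearMap.trace_mul_comm ℂ) 1 _ k
    (Commute.one_left _) hk
  rwa [one_mul, List.map_append, List.prod_append] at this

/-- Products of distinct generators in increasing order are linearly independent over `ℂ`. -/
theorem linearIndependent_prod [Nontrivial V] (h : IsCliffordFamily γ) {T : Type*}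
    (L : T → List (Fin (2 * m))) (hL : ∀ t, (L t).SortedLT) (hinj : Function.Injective L) :
    LinearIndependent ℂ (fun t => ((L t).map γ).prod) := by
  rw [linearIndependent_iff']
  intro s a hs t ht
  -- Pairing with the reversed product of `t` kills every other term, and the diagonal value is plus
  -- or minus the dimension of `V`.
  have h1 := congrArg (fun z => LinearMap.trace ℂ V ((((L t).reverse.map γ).prod) * z)) hs
  simp only [Finset.mul_sum, map_sum, mul_smul_comm, map_smul, mul_zero, map_zero] at h1
  rw [Finset.sum_eq_single_of_mem t ht] at h1
  · rw [h.reverse_prod_mul_prod, smul_eq_mul, mul_eq_zero] at h1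
    refine h1.resolve_right ?_
    rcases neg_one_pow_eq_or (Module.End ℂ V) (L t).length with h2 | h2 <;> rw [h2] <;>
      simp [Module.finrank_pos.ne']
  · intro b _ hb
    rw [h.trace_reverse_mul_eq_zero (hL t) (hL b) (fun e => hb (hinj e).symm), smul_zero]

/-- An operator on the irreducible Clifford module which commutes with the generators and has
trace zero vanishes. -/
theorem eq_zero_of_commute_of_trace_eq_zero (h : IsCliffordFamily γ)
    (hV : Module.finrank ℂ V = 2 ^ m) {Z : Module.End ℂ V} (hZ : ∀ k, Commute Z (γ k))
    (htr : LinearMap.trace ℂ V Z = 0) : Z = 0 := by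
  have : Nontrivial V := Module.nontrivial_of_finrank_pos (R := ℂ) (by rw [hV]; positivity)
  let L : Finset (Fin (2 * m)) → List (Fin (2 * m)) := fun I => I.sort
  have hL : ∀ I, (L I).SortedLT := fun I => Finset.sortedLT_sort I
  have hinj : Function.Injective L := fun I J e => by
    have := congrArg List.toFinset e
    simpa [L] using this
  have hli := h.linearIndependent_prod L hL hinj
  -- There are `2 ^ (2 * m)` increasing products, and `(2 ^ m) ^ 2` is the dimension of the
  -- endomorphism algebra. Independence therefore gives spanning, which is irreducibility in the
  -- form used here.
  have hcard : Fintype.card (Finset (Fin (2 * m))) = Module.finrank ℂ (Module.End ℂ V) := by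
    rw [Module.finrank_linearMap, hV, Fintype.card_finset, Fintype.card_fin]
    ring
  have hspan := hli.span_eq_top_of_card_eq_finrank' hcard
  have key : ∀ A : Module.End ℂ V, LinearMap.trace ℂ V (Z * A) = 0 := by
    intro A
    have hA : A ∈ Submodule.span ℂ (Set.range fun I => ((L I).map γ).prod) := by
      rw [hspan]; trivial
    induction hA using Submodule.span_induction with
    | mem x hx =>
      obtain ⟨I, rfl⟩ := hx
      by_cases hI : L I = []
      · simp [hI, htr]
      · obtain ⟨k, hk⟩ := exists_odd_of_sorted (l₁ := []) (l₂ := L I) List.Pairwise.nil.sortedLT (hL I)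
          (Ne.symm hI)
        exact h.trace_mul_prod_eq_zero (LinearMap.trace ℂ V) (LinearMap.trace_mul_comm ℂ) Z _ k
          (hZ k) (by simpa using hk)
    | zero => simp
    | add x y _ _ hx hy => rw [mul_add, map_add, hx, hy, add_zero]
    | smul a x _ hx => rw [mul_smul_comm, map_smul, hx, smul_zero]
  ext v
  by_contra hv
  obtain ⟨φ, hφ⟩ : ∃ φ : V →ₗ[ℂ] ℂ, φ (Z v) ≠ 0 := by
    by_contra! hcon
    exact hv ((Module.forall_dual_apply_eq_zero_iff ℂ (Z v)).1 hcon)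
  refine hφ ?_
  -- Against a rank-one operator the trace pairing evaluates `φ (Z v)`.
  rw [← key (φ.smulRight v)]
  have : Z * φ.smulRight v = φ.smulRight (Z v) := by
    ext w
    simp
  rw [this, LinearMap.trace_smulRight]

end End

end IsCliffordFamily

/-! ### The real Clifford algebra -/

theorem gen_isCliffordFamily (m : ℕ) : IsCliffordFamily (gen m) where
  sq k := by
    rw [gen, CliffordAlgebra.ι_sq_scalar]
    have : negSq m (Pi.single k 1) = -1 := by simp [negSq, Pi.single_apply]
    rw [this, map_neg, map_one]
  anticomm k l hkl := by
    rw [gen, gen, eq_neg_iff_add_eq_zero]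
    rw [CliffordAlgebra.ι_mul_ι_add_swap]
    have : QuadraticMap.polar (negSq m) (Pi.single k 1) (Pi.single l 1) = 0 := by
      simp only [QuadraticMap.polar, negSq, QuadraticMap.weightedSumSquares_apply,
        Pi.add_apply, ← Finset.sum_sub_distrib]
      refine Finset.sum_eq_zero fun i _ => ?_
      by_cases h1 : i = k <;> by_cases h2 : i = l <;> 
        simp [h1, h2, hkl, Ne.symm hkl]
    rw [this, map_zero]

theorem ι_eq_sum_gen {m : ℕ} (v : Fin (2 * m) → ℝ) :
    CliffordAlgebra.ι (negSq m) v = ∑ k, v k • gen m k := by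
  conv_lhs => rw [pi_eq_sum_univ' v]
  simp [gen, map_sum]

/-- The Clifford algebra is spanned by the products of distinct generators in increasing order. -/
theorem span_gen_prod (m : ℕ) :
    Submodule.span ℝ {a : Cl m | ∃ l : List (Fin (2 * m)), l.SortedLT ∧ (l.map (gen m)).prod = a}
      = ⊤ := by
  have h := gen_isCliffordFamily m
  set N := Submodule.span ℝ
    {a : Cl m | ∃ l : List (Fin (2 * m)), l.SortedLT ∧ (l.map (gen m)).prod = a} with hN
  -- Insertion of `k` into a sorted list: anticommute past smaller entries, cancel against an equal
  -- one. The clause on lower bounds keeps the list sorted when a smaller head is put back.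
  have step : ∀ (l : List (Fin (2 * m))) (k : Fin (2 * m)), l.SortedLT →
      ∃ l' : List (Fin (2 * m)), l'.SortedLT ∧ (∀ a, a < k → (∀ b ∈ l, a < b) → ∀ b ∈ l', a < b) ∧
        (gen m k * (l.map (gen m)).prod = (l'.map (gen m)).prod ∨
          gen m k * (l.map (gen m)).prod = -(l'.map (gen m)).prod) := by
    intro l
    induction l with
    | nil => exact fun k _ => ⟨[k], (List.pairwise_singleton _ _).sortedLT, by simp +contextual, by simp⟩
    | cons b l ih =>
      intro k hl
      rw [List.sortedLT_iff_pairwise, List.pairwise_cons] at hl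
      rcases lt_trichotomy k b with hk | hk | hk
      · refine ⟨k :: b :: l, ?_, ?_, Or.inl (by simp)⟩
        · rw [List.sortedLT_iff_pairwise, List.pairwise_cons, List.pairwise_cons]
          refine ⟨fun c hc => ?_, hl⟩
          rcases List.mem_cons.1 hc with rfl | hc
          · exact hk
          · exact hk.trans (hl.1 c hc)
        · intro a ha hb c hc
          rcases List.mem_cons.1 hc with rfl | hc
          · exact ha
          · exact hb c hc
      · subst hk
        refine ⟨l, hl.2.sortedLT, fun a _ hb c hc => hb c (List.mem_cons_of_mem _ hc), Or.inr ?_⟩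
        rw [List.map_cons, List.prod_cons, ← mul_assoc, h.sq, neg_one_mul]
      · obtain ⟨l', h1, h2, h3⟩ := ih k hl.2.sortedLT
        refine ⟨b :: l', ?_, ?_, ?_⟩
        · rw [List.sortedLT_iff_pairwise, List.pairwise_cons]
          exact ⟨h2 b hk hl.1, h1.pairwise⟩
        · intro a ha hb c hc
          rcases List.mem_cons.1 hc with rfl | hc
          · exact hb c List.mem_cons_self
          · exact h2 a ha (fun d hd => hb d (List.mem_cons_of_mem _ hd)) c hc
        · rw [List.map_cons, List.prod_cons, ← mul_assoc, h.anticomm k b hk.ne', neg_mul, mul_assoc]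
          rcases h3 with h3 | h3 <;> rw [h3] <;> simp
  have hgen : ∀ k, ∀ x ∈ N, gen m k * x ∈ N := by
    intro k x hx
    induction hx using Submodule.span_induction with
    | mem x hx =>
      obtain ⟨l, hl, rfl⟩ := hx
      obtain ⟨l', h1, -, h3⟩ := step l k hl
      rcases h3 with h3 | h3 <;> rw [h3]
      · exact Submodule.subset_span ⟨l', h1, rfl⟩
      · exact N.neg_mem (Submodule.subset_span ⟨l', h1, rfl⟩)
    | zero => rw [mul_zero]; exact N.zero_mem
    | add x y _ _ hx hy => rw [mul_add]; exact N.add_mem hx hy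
    | smul a x _ hx => rw [mul_smul_comm]; exact N.smul_mem a hx
  -- `N` is a left ideal; it contains the empty product 1, hence everything.
  have hleft : ∀ a : Cl m, ∀ x ∈ N, a * x ∈ N := by
    intro a
    induction a using CliffordAlgebra.induction with
    | algebraMap r =>
      intro x hx
      rw [← Algebra.smul_def]
      exact N.smul_mem r hx
    | ι v =>
      intro x hx
      rw [ι_eq_sum_gen, Finset.sum_mul]
      refine N.sum_mem fun k _ => ?_
      rw [smul_mul_assoc]
      exact N.smul_mem _ (hgen k x hx)
    | mul a b ha hb =>
      intro x hx
      rw [mul_assoc]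
      exact ha _ (hb x hx)
    | add a b ha hb =>
      intro x hx
      rw [add_mul]
      exact N.add_mem (ha x hx) (hb x hx)
  refine (Submodule.eq_top_iff').2 fun a => ?_
  rw [← mul_one a]
  exact hleft a 1 (Submodule.subset_span ⟨[], List.Pairwise.nil.sortedLT, by simp⟩)

/-! ### Adjoints and traces in the spinor module. -/

section Spinor

variable {m : ℕ} {S : Type*} [NormedAddCommGroup S] [InnerProductSpace ℂ S] [FiniteDimensional ℂ S]

omit [FiniteDimensional ℂ S] in
theorem SpinorModule.isCliffordFamily (Δ : SpinorModule m S) :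
    IsCliffordFamily (fun k => Δ.c (gen m k)) where
  sq k := by rw [← map_mul, (gen_isCliffordFamily m).sq, map_neg, map_one]
  anticomm k l hkl := by
    rw [← map_mul, (gen_isCliffordFamily m).anticomm k l hkl, map_neg, map_mul]

omit [FiniteDimensional ℂ S] in
/-- The adjoint of Clifford multiplication by `a` is Clifford multiplication by `star a`. -/
theorem SpinorModule.inner_c (Δ : SpinorModule m S) (a : Cl m) (s t : S) :
    inner ℂ (Δ.c a s) t = inner ℂ s (Δ.c (star a) t) := by
  induction a using CliffordAlgebra.induction generalizing s t with
  | algebraMap r =>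
    have h : ∀ s : S, Δ.c (algebraMap ℝ (Cl m) r) s = (r : ℂ) • s := by
      intro s
      rw [AlgHom.commutes]
      rfl
    rw [CliffordAlgebra.star_algebraMap, h, h, inner_smul_left, inner_smul_right, Complex.conj_ofReal]
  | ι v =>
    rw [CliffordAlgebra.star_ι, map_neg, Δ.skew]
    simp
  | mul a b ha hb =>
    rw [star_mul, map_mul, map_mul, Module.End.mul_apply, Module.End.mul_apply, ha, hb]
  | add a b ha hb =>
    rw [star_add, map_add, map_add, LinearMap.add_apply, LinearMap.add_apply, inner_add_left,
      inner_add_right, ha, hb]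

/-- Among the increasing products, which span over `ℝ`, only the empty one has nonzero trace, and
that trace is the dimension of `S`. -/
theorem SpinorModule.trace_c_im (Δ : SpinorModule m S) (a : Cl m) :
    (LinearMap.trace ℂ S (Δ.c a)).im = 0 := by
  have ha : a ∈ Submodule.span ℝ
      {a : Cl m | ∃ l : List (Fin (2 * m)), l.SortedLT ∧ (l.map (gen m)).prod = a} := by
    rw [span_gen_prod]; trivial
  induction ha using Submodule.span_induction with
  | mem x hx =>
    obtain ⟨l, hl, rfl⟩ := hx
    by_cases h0 : l = []
    · simp [h0]
    · have := Δ.isCliffordFamily.trace_reverse_mul_eq_zero List.Pairwise.nil.sortedLT hl (Ne.symm h0)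
      rw [map_list_prod, List.map_map]
      simp only [List.reverse_nil, List.map_nil, List.prod_nil, one_mul] at this
      change (LinearMap.trace ℂ S (l.map fun k => Δ.c (gen m k)).prod).im = 0
      rw [this, Complex.zero_im]
  | zero => simp
  | add x y _ _ hx hy => simp [hx, hy]
  | smul r x _ hx =>
    have h : Δ.c (r • x) = (r : ℂ) • Δ.c x := by
      rw [map_smul]
      rfl
    rw [h, map_smul]
    simp [hx]

end Spinor

/-! ### Clifford multiplication on the fibre -/

section FibreAlgebra

variable {m : ℕ} {S : Type*} [NormedAddCommGroup S] [InnerProductSpace ℂ S]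
  {W : Type*} [NormedAddCommGroup W] [InnerProductSpace ℂ W]

/-- The tensor `s ⊗ w` as an element of the fibre. -/
def Fibre.tmul (s : S) (w : W) : Fibre S W := (s ⊗ₜ[ℂ] w : S ⊗[ℂ] W)

theorem Fibre.inner_tmul (s s' : S) (w w' : W) :
    inner ℂ (Fibre.tmul s w) (Fibre.tmul s' w') = inner ℂ s s' * inner ℂ w w' :=
  TensorProduct.inner_tmul ℂ s s' w w'

theorem tensorAction_tmul (Δ : SpinorModule m S) (a : Cl m) (u : W →ₗ[ℂ] W) (s : S) (w : W) :
    tensorAction Δ a u (Fibre.tmul s w) = Fibre.tmul (Δ.c a s) (u w) :=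
  TensorProduct.map_tmul _ _ _ _

@[elab_as_elim]
theorem Fibre.induction {p : Fibre S W → Prop} (x : Fibre S W) (zero : p 0)
    (tmul : ∀ (s : S) (w : W), p (Fibre.tmul s w)) (add : ∀ x y, p x → p y → p (x + y)) :
    p x :=
  TensorProduct.induction_on (motive := p) x zero tmul add

theorem tensorAction_mul (Δ : SpinorModule m S) (a b : Cl m) (u v : W →ₗ[ℂ] W) (x : Fibre S W) :
    tensorAction Δ (a * b) (u ∘ₗ v) x = tensorAction Δ a u (tensorAction Δ b v x) := by
  induction x using Fibre.induction with
  | zero => simp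
  | tmul s w =>
    rw [tensorAction_tmul, tensorAction_tmul, tensorAction_tmul, map_mul]
    rfl
  | add x y hx hy => simp only [map_add, hx, hy]

theorem tensorAction_add_left (Δ : SpinorModule m S) (a b : Cl m) (u : W →ₗ[ℂ] W) :
    tensorAction Δ (a + b) u = tensorAction Δ a u + tensorAction Δ b u := by
  unfold tensorAction
  rw [map_add]
  exact TensorProduct.map_add_left _ _ _

theorem tensorAction_smul_left (Δ : SpinorModule m S) (r : ℝ) (a : Cl m) (u : W →ₗ[ℂ] W) :
    tensorAction Δ (r • a) u = (r : ℂ) • tensorAction Δ a u := by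
  unfold tensorAction
  rw [show Δ.c (r • a) = (r : ℂ) • Δ.c a by rw [map_smul]; rfl]
  exact TensorProduct.map_smul_left _ _ _

theorem cl_mul (Δ : SpinorModule m S) (a b : Cl m) : cl Δ W (a * b) = cl Δ W a * cl Δ W b := by
  ext x
  exact tensorAction_mul Δ a b LinearMap.id LinearMap.id x

theorem cl_one (Δ : SpinorModule m S) : cl Δ W (1 : Cl m) = 1 := by
  unfold cl tensorAction
  rw [map_one, Module.End.one_eq_id]
  exact TensorProduct.map_id

theorem cl_add (Δ : SpinorModule m S) (a b : Cl m) : cl Δ W (a + b) = cl Δ W a + cl Δ W b :=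
  tensorAction_add_left _ _ _ _

theorem cl_smul (Δ : SpinorModule m S) (r : ℝ) (a : Cl m) :
    cl Δ W (r • a) = (r : ℂ) • cl Δ W a :=
  tensorAction_smul_left _ _ _ _

/-- Clifford multiplication as a homomorphism of additive groups. -/
def clAddHom (Δ : SpinorModule m S) (W : Type*) [NormedAddCommGroup W] [InnerProductSpace ℂ W] :
    Cl m →+ Module.End ℂ (Fibre S W) :=
  AddMonoidHom.mk' (cl Δ W) (cl_add Δ)

theorem cl_sum (Δ : SpinorModule m S) {α : Type*} (s : Finset α) (f : α → Cl m) :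
    cl Δ W (∑ i ∈ s, f i) = ∑ i ∈ s, cl Δ W (f i) :=
  map_sum (clAddHom Δ W) f s

theorem cl_neg (Δ : SpinorModule m S) (a : Cl m) : cl Δ W (-a) = - cl Δ W a :=
  map_neg (clAddHom Δ W) a

/-- Clifford multiplication as a homomorphism of monoids. -/
def clMonoidHom (Δ : SpinorModule m S) (W : Type*) [NormedAddCommGroup W] [InnerProductSpace ℂ W] :
    Cl m →* Module.End ℂ (Fibre S W) where
  toFun := cl Δ W
  map_one' := cl_one Δ
  map_mul' := cl_mul Δ

theorem cl_list_prod (Δ : SpinorModule m S) (l : List (Fin (2 * m))) :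
    cl Δ W (l.map (gen m)).prod = (l.map fun k => cl Δ W (gen m k)).prod := by
  have := map_list_prod (clMonoidHom Δ W) (l.map (gen m))
  rw [List.map_map] at this
  exact this

theorem cl_isCliffordFamily (Δ : SpinorModule m S) :
    IsCliffordFamily (fun k => cl Δ W (gen m k)) where
  sq k := by rw [← cl_mul, (gen_isCliffordFamily m).sq, cl_neg, cl_one]
  anticomm k l hkl := by
    rw [← cl_mul, (gen_isCliffordFamily m).anticomm k l hkl, cl_neg, cl_mul]

/-- By sesquilinearity it suffices to test pure tensors, where the inner product factors. -/
theorem inner_tensorAction [FiniteDimensional ℂ W] (Δ : SpinorModule m S) (a : Cl m)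
    (u : W →ₗ[ℂ] W) (x y : Fibre S W) :
    inner ℂ (tensorAction Δ a u x) y
      = inner ℂ x (tensorAction Δ (star a) (LinearMap.adjoint u) y) := by
  induction x using Fibre.induction with
  | zero => simp
  | tmul s w =>
    induction y using Fibre.induction with
    | zero => simp
    | tmul s' w' =>
      rw [tensorAction_tmul, tensorAction_tmul, Fibre.inner_tmul, Fibre.inner_tmul, Δ.inner_c, LinearMap.adjoint_inner_right]
    | add x y hx hy => simp only [map_add, inner_add_right, hx, hy]
  | add x y hx hy => simp only [map_add, inner_add_left, hx, hy]

theorem inner_cl [FiniteDimensional ℂ W] (Δ : SpinorModule m S) (a : Cl m) (x y : Fibre S W) :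
    inner ℂ (cl Δ W a x) y = inner ℂ x (cl Δ W (star a) y) := by
  unfold cl
  rw [inner_tensorAction]
  congr 4
  rw [LinearMap.adjoint_id]

theorem star_gen (m : ℕ) (k : Fin (2 * m)) : star (gen m k) = -gen m k :=
  CliffordAlgebra.star_ι _

/-- Negating each of l generators gives l signs, and reversing l anticommuting factors gives
l(l-1)/2 more. The total l(l+1)/2 is the binomial coefficient, which Pascal's rule makes convenient
for induction. -/
theorem star_gen_prod {l : List (Fin (2 * m))} (hl : l.Nodup) :
    star (l.map (gen m)).prod = (-1 : ℝ) ^ ((l.length + 1).choose 2) • (l.map (gen m)).prod := by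
  induction l with
  | nil => simp
  | cons a l ih =>
    rw [List.nodup_cons] at hl
    have h := (gen_isCliffordFamily m).mul_prod a l
    rw [List.count_eq_zero_of_not_mem hl.1, add_zero] at h
    rw [List.map_cons, List.prod_cons, star_mul, ih hl.2, star_gen, h, List.length_cons,
      Nat.choose_succ_succ' (l.length + 1) 1, Nat.choose_one_right, pow_add, pow_succ]
    rcases neg_one_pow_eq_or ℝ ((l.length + 1).choose 2) with h1 | h1 <;>
    rcases Nat.even_or_odd l.length with h2 | h2 <;>
    simp [h1, h2.neg_one_pow]

/-- The parity of j(j+1)/2 has period four in j. All conditions modulo 4 in the theorem come from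
here. -/
theorem even_choose_two_iff (j : ℕ) : Even ((j + 1).choose 2) ↔ j % 4 = 0 ∨ j % 4 = 3 := by
  have h : (j + 1).choose 2 * 2 = (j + 1) * j := by
    have := Nat.triangle_succ j
    rw [Nat.choose_two_right, Nat.div_mul_cancel]
    · rfl
    · simpa [mul_comm] using (Nat.even_mul_succ_self j).two_dvd
  obtain ⟨q, r, hr, rfl⟩ : ∃ q r, r < 4 ∧ j = 4 * q + r :=
    ⟨j / 4, j % 4, Nat.mod_lt _ (by norm_num), (Nat.div_add_mod j 4).symm⟩
  rw [Nat.even_iff]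
  interval_cases r
  · have : (4 * q + 0 + 1).choose 2 = 2 * ((4 * q + 1) * q) := by linarith
    omega
  · have : (4 * q + 1 + 1).choose 2 = 2 * (4 * q * q + 3 * q) + 1 := by linarith
    omega
  · have : (4 * q + 2 + 1).choose 2 = 2 * (4 * q * q + 5 * q + 1) + 1 := by linarith
    omega
  · have : (4 * q + 3 + 1).choose 2 = 2 * (4 * q * q + 7 * q + 3) := by linarith
    omega

/-- Clifford multiplication by the alternating form with coefficients `β` in an orthonormal
frame. -/
def cliffordSum (Δ : SpinorModule m S) (W : Type*) [NormedAddCommGroup W] [InnerProductSpace ℂ W]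
    {j : ℕ} (β : (Fin j → Fin (2 * m)) → ℂ) : Module.End ℂ (Fibre S W) :=
  open Classical in
  ∑ f : Fin j → Fin (2 * m) with StrictMono f,
    β f • cl Δ W (List.ofFn (fun p => gen m (f p))).prod

theorem ofFn_gen {j : ℕ} (f : Fin j → Fin (2 * m)) :
    List.ofFn (fun p => gen m (f p)) = (List.ofFn f).map (gen m) := by
  rw [List.map_ofFn]
  rfl

/-- Passing to the adjoint conjugates the coefficients, and the sign of `star_gen_prod` depends only
on the degree, so it comes out uniformly. -/
theorem inner_cliffordSum [FiniteDimensional ℂ W] (Δ : SpinorModule m S) {j : ℕ}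
    (β : (Fin j → Fin (2 * m)) → ℂ) (x y : Fibre S W) :
    inner ℂ (cliffordSum Δ W β x) y
      = inner ℂ x (cliffordSum Δ W (fun f => (-1) ^ ((j + 1).choose 2) * starRingEnd ℂ (β f)) y) := by
  classical
  unfold cliffordSum
  simp only [LinearMap.sum_apply, LinearMap.smul_apply, sum_inner, inner_sum, inner_smul_left,
    inner_smul_right]
  refine Finset.sum_congr (by congr) fun f hf => ?_
  have hf' : StrictMono f := by simpa using hf
  rw [inner_cl, ofFn_gen, star_gen_prod (List.nodup_ofFn.2 hf'.injective), List.length_ofFn, cl_smul]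
  simp only [LinearMap.smul_apply, inner_smul_right]
  push_cast
  ring

theorem cliffordSum_smul (Δ : SpinorModule m S) {j : ℕ} (a : ℂ) (β : (Fin j → Fin (2 * m)) → ℂ) :
    cliffordSum Δ W (a • β) = a • cliffordSum Δ W β := by
  simp only [cliffordSum, Pi.smul_apply, smul_assoc, Finset.smul_sum]

theorem cliffordSum_sub (Δ : SpinorModule m S) {j : ℕ} (β β' : (Fin j → Fin (2 * m)) → ℂ) :
    cliffordSum Δ W (β - β') = cliffordSum Δ W β - cliffordSum Δ W β' := by
  simp only [cliffordSum, Pi.sub_apply, sub_smul, Finset.sum_sub_distrib]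

theorem cliffordSum_zero (Δ : SpinorModule m S) {j : ℕ} :
    cliffordSum Δ W (0 : (Fin j → Fin (2 * m)) → ℂ) = 0 := by
  simp [cliffordSum]

theorem SpinorModule.nontrivial (Δ : SpinorModule m S) : Nontrivial S :=
  Module.nontrivial_of_finrank_pos (R := ℂ) (by rw [Δ.finrank_eq]; positivity)

/-- Positive rank of the flat bundle enters here: on a zero fibre every form would act as zero. -/
theorem SpinorModule.nontrivial_fibre (Δ : SpinorModule m S) [FiniteDimensional ℂ S]
    [FiniteDimensional ℂ W] [Nontrivial W] : Nontrivial (Fibre S W) := by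
  have := Δ.nontrivial
  refine Module.nontrivial_of_finrank_pos (R := ℂ) ?_
  have : Module.finrank ℂ (Fibre S W) = Module.finrank ℂ S * Module.finrank ℂ W :=
    Module.finrank_tensorProduct (R := ℂ) (S := ℂ) (M := S) (M' := W)
  rw [this]
  exact Nat.mul_pos Module.finrank_pos Module.finrank_pos

/-- Clifford multiplication by forms is injective. -/
theorem coeff_eq_zero_of_sum_cliffordSum_eq_zero [FiniteDimensional ℂ S] [FiniteDimensional ℂ W]
    [Nontrivial W] (Δ : SpinorModule m S) (s : Finset ℕ) (β : ∀ j, (Fin j → Fin (2 * m)) → ℂ)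
    (h : ∑ j ∈ s, cliffordSum Δ W (β j) = 0) {j : ℕ} (hj : j ∈ s) {f : Fin j → Fin (2 * m)}
    (hf : StrictMono f) : β j f = 0 := by
  classical
  have := Δ.nontrivial_fibre (W := W)
  -- Increasing index maps of all degrees form one independent family, so components of different
  -- degrees cannot cancel each other.
  let T := Σ j : ℕ, {f : Fin j → Fin (2 * m) // StrictMono f}
  let L : T → List (Fin (2 * m)) := fun t => List.ofFn t.2.1
  have hinj : Function.Injective L := by
    rintro ⟨j, f, hf⟩ ⟨k, g, hg⟩ e
    have := List.ofFn_inj'.1 e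
    obtain ⟨rfl, h2⟩ := Sigma.mk.inj_iff.1 this
    cases eq_of_heq h2
    rfl
  have hli := (cl_isCliffordFamily (W := W) Δ).linearIndependent_prod L
    (fun t => List.sortedLT_ofFn_iff.2 t.2.2) hinj
  rw [linearIndependent_iff'] at hli
  refine hli (s.sigma fun j => Finset.univ) (fun t => β t.1 t.2.1) ?_ ⟨j, f, hf⟩
    (Finset.mem_sigma.2 ⟨hj, Finset.mem_univ _⟩)
  rw [Finset.sum_sigma, ← h]
  refine Finset.sum_congr rfl fun k _ => ?_
  unfold cliffordSum
  rw [Finset.sum_subtype (p := StrictMono) _ (by simp)]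
  refine Finset.sum_congr (by congr) fun g _ => ?_
  rw [ofFn_gen, cl_list_prod]

end FibreAlgebra

/-- An alternating form vanishes if it vanishes on increasing families of basis vectors. -/
theorem alternating_eq_zero_of_strictMono {n j : ℕ} {F K : Type*} [AddCommGroup F] [Module ℝ F]
    [TopologicalSpace F] [AddCommGroup K] [Module ℝ K] [TopologicalSpace K]
    (b : Module.Basis (Fin n) ℝ F) (α : F [⋀^Fin j]→L[ℝ] K)
    (h : ∀ f : Fin j → Fin n, StrictMono f → α (fun p => b (f p)) = 0) : α = 0 := by
  have key : α.toAlternatingMap = 0 := by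
    refine Module.Basis.ext_alternating b fun f hf => ?_
    -- An injective index map becomes increasing after sorting, which changes the value of the form
    -- only by a sign.
    have hmono : StrictMono (f ∘ Tuple.sort f) :=
      (Tuple.monotone_sort f).strictMono_of_injective (hf.comp (Equiv.injective _))
    have h1 := α.toAlternatingMap.map_perm (fun p => b (f p)) (Tuple.sort f)
    have h2 : α.toAlternatingMap ((fun p => b (f p)) ∘ Tuple.sort f) = 0 := h _ hmono
    rw [h2] at h1
    rcases Int.units_eq_one_or (Equiv.Perm.sign (Tuple.sort f)) with e | e
    · rw [e, one_smul] at h1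
      rw [← h1]
      rfl
    · rw [e] at h1
      simpa using h1.symm
  ext v
  exact congrArg (fun a => a v) key

/-! ### Frame independence of Clifford multiplication by forms -/

/-- Leading factors that the adjacent transposition does not touch are peeled off until the swapped
pair stands in front, where the anticommutation relation applies. -/
theorem IsCliffordFamily.prod_swap {n : ℕ} {A : Type*} [Ring A] {γ : Fin n → A}
    (h : IsCliffordFamily γ) : ∀ {k : ℕ} (i : Fin k) (f : Fin (k + 1) → Fin n),
    Function.Injective f →
    (List.ofFn (fun p => γ (f (Equiv.swap i.castSucc i.succ p)))).prod
      = -(List.ofFn (fun p => γ (f p))).prod := by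
  intro k
  induction k with
  | zero => exact fun i => i.elim0
  | succ k ih =>
    intro i f hf
    refine Fin.cases ?_ (fun i => ?_) i
    · have h1 : ∀ p : Fin k, Equiv.swap (0 : Fin (k + 2)) 1 p.succ.succ = p.succ.succ := by
        intro p
        refine Equiv.swap_apply_of_ne_of_ne (Fin.succ_ne_zero _) ?_
        rw [← Fin.succ_zero_eq_one, Ne, Fin.succ_inj]
        exact Fin.succ_ne_zero _
      simp only [List.ofFn_succ, List.prod_cons, Fin.castSucc_zero, Fin.succ_zero_eq_one,
        Equiv.swap_apply_left, Equiv.swap_apply_right, h1]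
      rw [← mul_assoc, h.anticomm _ _ (fun e => by simpa using hf e), neg_mul, mul_assoc]
    · have h0 : Equiv.swap i.succ.castSucc i.succ.succ 0 = 0 := by
        refine Equiv.swap_apply_of_ne_of_ne ?_ (Fin.succ_ne_zero _).symm
        rw [← Fin.succ_castSucc]
        exact (Fin.succ_ne_zero _).symm
      have h1 : ∀ p : Fin (k + 1), Equiv.swap i.succ.castSucc i.succ.succ p.succ
          = (Equiv.swap i.castSucc i.succ p).succ := by
        intro p
        rw [← Fin.succ_castSucc]
        exact ((Fin.succ_injective (k + 1)).map_swap _ _ _).symm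
      have := ih i (fun p => f p.succ) (fun a b e => by simpa using hf e)
      rw [List.ofFn_succ, List.prod_cons, h0]
      simp only [h1]
      rw [this, List.ofFn_succ (n := k + 1), List.prod_cons, mul_neg]

/-- Adjacent transpositions generate the symmetric group, and the sign is multiplicative. -/
theorem IsCliffordFamily.prod_perm {n : ℕ} {A : Type*} [Ring A] {γ : Fin n → A}
    (h : IsCliffordFamily γ) {k : ℕ} (τ : Equiv.Perm (Fin k)) (f : Fin k → Fin n)
    (hf : Function.Injective f) :
    (List.ofFn (fun p => γ (f (τ p)))).prod
      = Equiv.Perm.sign τ • (List.ofFn (fun p => γ (f p))).prod := by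
  cases k with
  | zero =>
    have : τ = 1 := Subsingleton.elim _ _
    simp [this]
  | succ k =>
    have hτ : τ ∈ Submonoid.closure (Set.range fun i : Fin k => Equiv.swap i.castSucc i.succ) := by
      rw [Equiv.Perm.mclosure_swap_castSucc_succ]; trivial
    induction hτ using Submonoid.closure_induction generalizing f with
    | mem x hx =>
      obtain ⟨i, rfl⟩ := hx
      rw [h.prod_swap i f hf, Equiv.Perm.sign_swap (Fin.castSucc_lt_succ (i := i)).ne]
      simp
    | one => simp
    | mul x y _ _ hx hy =>
      have := hy (fun p => f (x p)) (hf.comp x.injective)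
      simp only [Equiv.Perm.mul_apply, map_mul]
      rw [this, hx f hf, smul_smul, mul_comm]

/-- Every injective index map is uniquely an increasing map followed by a reordering of the slots,
so each increasing map accounts for `j!` equal terms. -/
theorem sum_eq_factorial_smul_sum_strictMono {n j : ℕ} {M : Type*} [AddCommMonoid M]
    (G : (Fin j → Fin n) → M) [DecidablePred fun f : Fin j → Fin n => StrictMono f]
    (h0 : ∀ f, ¬ Function.Injective f → G f = 0)
    (hG : ∀ f (τ : Equiv.Perm (Fin j)), Function.Injective f → G (f ∘ τ) = G f) :
    ∑ f, G f = j.factorial • ∑ f with StrictMono f, G f := by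
  classical
  rw [← Finset.sum_filter_of_ne (p := Function.Injective)
    (fun f _ hf => by by_contra hcon; exact hf (h0 f hcon))]
  have h1 : j.factorial • ∑ f : Fin j → Fin n with StrictMono f, G f
      = ∑ x ∈ (Finset.univ.filter fun f : Fin j → Fin n => StrictMono f) ×ˢ
          (Finset.univ : Finset (Equiv.Perm (Fin j))), G (x.1 ∘ x.2) := by
    rw [Finset.sum_product, Finset.smul_sum]
    refine Finset.sum_congr rfl fun f hf => ?_
    have hf' : StrictMono f := by simpa using hf
    rw [Finset.sum_congr rfl fun τ _ => hG f τ hf'.injective, Finset.sum_const, Finset.card_univ,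
      Fintype.card_perm, Fintype.card_fin]
  rw [h1]
  symm
  refine Finset.sum_bij (fun x _ => x.1 ∘ x.2) ?_ ?_ ?_ fun _ _ => rfl
  · rintro ⟨f, τ⟩ hx
    have hf : StrictMono f := by simpa using hx
    simpa using hf.injective.comp τ.injective
  · rintro ⟨f, τ⟩ hx ⟨f', τ'⟩ hx' e
    have hf : StrictMono f := by simpa using hx
    have hf' : StrictMono f' := by simpa using hx'
    simp only at e
    have hrange : Set.range f = Set.range f' := by
      rw [← τ.surjective.range_comp f, e, τ'.surjective.range_comp f']
    have hff : f = f' := (StrictMono.range_inj hf hf').1 hrange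
    subst hff
    have : τ = τ' := by
      ext p
      exact congrArg Fin.val (hf.injective (congrFun e p))
    rw [this]
  · intro f hf
    have hf' : Function.Injective f := by simpa using hf
    refine ⟨(f ∘ Tuple.sort f, (Tuple.sort f)⁻¹), ?_, ?_⟩
    · simp only [Finset.mem_product, Finset.mem_filter, Finset.mem_univ, true_and, and_true]
      exact (Tuple.monotone_sort f).strictMono_of_injective (hf'.comp (Equiv.injective _))
    · ext p
      simp

section

variable {m : ℕ} {S : Type*} [NormedAddCommGroup S] [InnerProductSpace ℂ S]
  {W : Type*} [NormedAddCommGroup W] [InnerProductSpace ℂ W]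

/-- Under a permutation of the slots the form and the Clifford product change by the same sign,
which cancels; repeated indices kill the form. Unrestricted sums suit multilinear expansion, whereas
increasing index maps are not preserved by a change of frame. -/
theorem factorial_smul_cliffordSum (Δ : SpinorModule m S) {j : ℕ} {F : Type*} [AddCommGroup F]
    [Module ℝ F] [TopologicalSpace F] (α : F [⋀^Fin j]→L[ℝ] ℂ) (e : Fin (2 * m) → F) :
    j.factorial • cliffordSum Δ W (fun f => α (fun p => e (f p)))
      = ∑ f : Fin j → Fin (2 * m), α (fun p => e (f p)) •
          cl Δ W (List.ofFn (fun p => gen m (f p))).prod := by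
  classical
  rw [sum_eq_factorial_smul_sum_strictMono]
  · unfold cliffordSum
    congr!
  · intro f hf
    have : ¬ Function.Injective (fun p => e (f p)) := by
      intro h
      exact hf (Function.Injective.of_comp (f := e) h)
    rw [α.toAlternatingMap.map_eq_zero_of_not_injective _ this |> fun h =>
      (show α (fun p => e (f p)) = 0 from h), zero_smul]
  · intro f τ hf
    have h1 : α (fun p => e ((f ∘ τ) p)) = Equiv.Perm.sign τ • α (fun p => e (f p)) :=
      α.toAlternatingMap.map_perm (fun p => e (f p)) τ
    have h2 := (gen_isCliffordFamily m).prod_perm τ f hf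
    simp only [Function.comp_apply] at h1 ⊢
    rw [h1, h2]
    rcases Int.units_eq_one_or (Equiv.Perm.sign τ) with h | h <;> simp [h, cl_neg]

/-- Clifford multiplication by an alternating form does not depend on the orthonormal frame. -/
theorem cliffordSum_conj (Δ : SpinorModule m S) {j : ℕ} {F : Type*} [AddCommGroup F]
    [Module ℝ F] [TopologicalSpace F] (α : F [⋀^Fin j]→L[ℝ] ℂ) (e e' : Fin (2 * m) → F)
    (A : Fin (2 * m) → Fin (2 * m) → ℝ) (he : ∀ l, e l = ∑ k, A l k • e' k) (s : Cl m)
    (hs : ∀ k, s * gen m k = (∑ l, A l k • gen m l) * s) (u : W →ₗ[ℂ] W) (x : Fibre S W) :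
    tensorAction Δ s u (cliffordSum Δ W (fun f => α (fun p => e' (f p))) x)
      = cliffordSum Δ W (fun f => α (fun p => e (f p))) (tensorAction Δ s u x) := by
  -- Moving `s` to the right rotates every factor; the resulting product of sums is expanded over
  -- all index maps.
  have hprod : ∀ f : Fin j → Fin (2 * m), s * (List.ofFn (fun p => gen m (f p))).prod
      = (∑ g : Fin j → Fin (2 * m), (∏ p, A (g p) (f p)) •
          (List.ofFn (fun p => gen m (g p))).prod) * s := by
    intro f
    have h1 : ∀ (k : ℕ) (f : Fin k → Fin (2 * m)), s * (List.ofFn (fun p => gen m (f p))).prod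
        = (List.ofFn (fun p => ∑ l, A l (f p) • gen m l)).prod * s := by
      intro k
      induction k with
      | zero => simp
      | succ k ih =>
        intro f
        simp only [List.ofFn_succ, List.prod_cons]
        rw [← mul_assoc, hs, mul_assoc, ih (fun p => f p.succ), mul_assoc]
    have h2 := (MultilinearMap.mkPiAlgebraFin ℝ j (Cl m)).map_sum
      (fun p l => A l (f p) • gen m l)
    simp only [MultilinearMap.map_smul_univ, MultilinearMap.mkPiAlgebraFin_apply] at h2
    rw [h1, h2]
  have hα : ∀ g : Fin j → Fin (2 * m), α (fun p => e (g p))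
      = ∑ f : Fin j → Fin (2 * m), (∏ p, A (g p) (f p)) • α (fun p => e' (f p)) := by
    intro g
    have h2 := α.toAlternatingMap.toMultilinearMap.map_sum (fun p k => A (g p) k • e' k)
    simp only [MultilinearMap.map_smul_univ] at h2
    simp only [he]
    exact h2
  have hcl : ∀ a x, tensorAction Δ s u (cl Δ W a x) = tensorAction Δ (s * a) u x := by
    intro a x
    rw [cl, ← tensorAction_mul, LinearMap.comp_id]
  have hcl' : ∀ a x, cl Δ W a (tensorAction Δ s u x) = tensorAction Δ (a * s) u x := by
    intro a x
    rw [cl, ← tensorAction_mul, LinearMap.id_comp]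
  -- After multiplication by `j!` both sides are unrestricted sums, where the expansions of the
  -- product and of the form agree term by term.
  have key : j.factorial • tensorAction Δ s u
        (cliffordSum Δ W (fun f => α (fun p => e' (f p))) x)
      = j.factorial • cliffordSum Δ W (fun f => α (fun p => e (f p))) (tensorAction Δ s u x) := by
    rw [← map_nsmul, ← LinearMap.smul_apply, factorial_smul_cliffordSum,
      ← LinearMap.smul_apply, factorial_smul_cliffordSum]
    simp only [LinearMap.sum_apply, LinearMap.smul_apply, map_sum, map_smul, hcl', hcl, hprod, hα,
      Finset.sum_smul]
    rw [Finset.sum_comm]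
    refine Finset.sum_congr rfl fun f _ => ?_
    rw [← hcl', cl_sum, LinearMap.sum_apply, Finset.smul_sum]
    refine Finset.sum_congr rfl fun g _ => ?_
    rw [cl_smul, LinearMap.smul_apply, hcl', smul_smul, smul_assoc, mul_comm, mul_smul,
      Complex.coe_smul]
  rw [← Nat.cast_smul_eq_nsmul ℂ, ← Nat.cast_smul_eq_nsmul ℂ] at key
  exact smul_right_injective _ (Nat.cast_ne_zero.2 (Nat.factorial_ne_zero j)) key

end

/-! ### Change of the Levi-Civita coefficients under a change of frame -/

section LeviCivita

variable {n : ℕ} {F : Type*} [NormedAddCommGroup F] [NormedSpace ℝ F]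

/-- The coefficients of the Levi-Civita connection in an orthonormal frame of vector fields on a
vector space, by the Koszul formula. -/
def koszul (G : F →ₗ[ℝ] F →ₗ[ℝ] ℝ) (e : Fin n → F → F) (u : F) (j k l : Fin n) : ℝ :=
  (G (VectorField.lieBracket ℝ (e j) (e k) u) (e l u)
    - G (VectorField.lieBracket ℝ (e k) (e l) u) (e j u)
    + G (VectorField.lieBracket ℝ (e l) (e j) u) (e k u)) / 2

variable {G : F →ₗ[ℝ] F →ₗ[ℝ] ℝ} {e e' : Fin n → F → F} {A : Fin n → Fin n → F → ℝ} {u : F}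

theorem fderiv_frame_change (he : ∀ k, e' k =ᶠ[𝓝 u] fun y => ∑ l, A l k y • e l y)
    (hd : ∀ l, DifferentiableAt ℝ (e l) u) (hA : ∀ l k, DifferentiableAt ℝ (A l k) u)
    (k : Fin n) (v : F) :
    fderiv ℝ (e' k) u v = ∑ l, (fderiv ℝ (A l k) u v • e l u + A l k u • fderiv ℝ (e l) u v) := by
  rw [(he k).fderiv_eq, fderiv_fun_sum fun l _ => (hA l k).fun_smul (hd l)]
  simp only [sum_apply]
  refine Finset.sum_congr rfl fun l _ => ?_
  rw [fderiv_fun_smul (hA l k) (hd l)]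
  simp [add_comm]

/-- The bracket is tensorial except for derivatives of the matrix entries. Pairing with `e' r` reads
these terms off by orthonormality. -/
theorem bracket_frame_change (hG : ∀ k l, G (e k u) (e l u) = if k = l then 1 else 0)
    (he : ∀ k, e' k =ᶠ[𝓝 u] fun y => ∑ l, A l k y • e l y)
    (hd : ∀ l, DifferentiableAt ℝ (e l) u) (hA : ∀ l k, DifferentiableAt ℝ (A l k) u)
    (j k r : Fin n) :
    G (VectorField.lieBracket ℝ (e' j) (e' k) u) (e' r u)
      = (∑ q, ∑ l, ∑ p, A q j u * A l k u * A p r u *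
          G (VectorField.lieBracket ℝ (e q) (e l) u) (e p u))
        + ((∑ l, fderiv ℝ (A l k) u (e' j u) * A l r u)
          - ∑ l, fderiv ℝ (A l j) u (e' k u) * A l r u) := by
  have hu : ∀ k, e' k u = ∑ l, A l k u • e l u := fun k => (he k).eq_of_nhds
  have hE : ∀ q, G (e q u) (e' r u) = A q r u := by
    intro q
    simp [hu r, hG]
  have h1 : ∀ j k, fderiv ℝ (e' k) u (e' j u)
      = (∑ l, fderiv ℝ (A l k) u (e' j u) • e l u)
        + ∑ q, ∑ l, (A q j u * A l k u) • fderiv ℝ (e l) u (e q u) := by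
    intro j k
    rw [fderiv_frame_change he hd hA, Finset.sum_add_distrib, Finset.sum_comm (γ := Fin n)]
    congr 1
    refine Finset.sum_congr rfl fun l _ => ?_
    rw [hu j, map_sum, Finset.smul_sum]
    refine Finset.sum_congr rfl fun q _ => ?_
    rw [map_smul, smul_smul, mul_comm]
  have h2 : VectorField.lieBracket ℝ (e' j) (e' k) u
      = ((∑ l, fderiv ℝ (A l k) u (e' j u) • e l u) - ∑ l, fderiv ℝ (A l j) u (e' k u) • e l u)
        + ∑ q, ∑ l, (A q j u * A l k u) • VectorField.lieBracket ℝ (e q) (e l) u := by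
    rw [VectorField.lieBracket, h1 j k, h1 k j]
    have : ∑ q, ∑ l, (A q k u * A l j u) • fderiv ℝ (e l) u (e q u)
        = ∑ q, ∑ l, (A q j u * A l k u) • fderiv ℝ (e q) u (e l u) := by
      rw [Finset.sum_comm]
      refine Finset.sum_congr rfl fun q _ => Finset.sum_congr rfl fun l _ => ?_
      rw [mul_comm]
    rw [this]
    simp only [VectorField.lieBracket, smul_sub, Finset.sum_sub_distrib]
    abel
  rw [h2, add_comm]
  simp only [map_add, map_sub, map_sum, map_smul, LinearMap.add_apply, LinearMap.sub_apply,
    LinearMap.sum_apply, LinearMap.smul_apply, hE, smul_eq_mul]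
  congr 1
  refine Finset.sum_congr rfl fun q _ => Finset.sum_congr rfl fun l _ => ?_
  rw [hu r, map_sum, Finset.mul_sum]
  refine Finset.sum_congr rfl fun p _ => ?_
  rw [map_smul, smul_eq_mul]
  ring

/-- Three brackets contribute six derivative terms. Antisymmetry of the logarithmic derivative of
`A` cancels four of them and makes the remaining two equal, so dividing by two leaves a single
inhomogeneous term. -/
theorem koszul_frame_change (hG : ∀ k l, G (e k u) (e l u) = if k = l then 1 else 0)
    (he : ∀ k, e' k =ᶠ[𝓝 u] fun y => ∑ l, A l k y • e l y)
    (hd : ∀ l, DifferentiableAt ℝ (e l) u) (hA : ∀ l k, DifferentiableAt ℝ (A l k) u)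
    (horth : ∀ k r, (fun y => ∑ l, A l k y * A l r y) =ᶠ[𝓝 u] fun _ => if k = r then 1 else 0)
    (j p r : Fin n) :
    koszul G e' u j p r
      = (∑ q, ∑ l, ∑ s, A q j u * A l p u * A s r u * koszul G e u q l s)
        + ∑ l, fderiv ℝ (A l p) u (e' j u) * A l r u := by
  -- Derivative of the orthogonality relation between columns of `A`.
  have hδ : ∀ (v : F) k r, ∑ l, fderiv ℝ (A l k) u v * A l r u
      = - ∑ l, fderiv ℝ (A l r) u v * A l k u := by
    intro v k r
    have h1 := congrArg (fun L : F →L[ℝ] ℝ => L v) (horth k r).fderiv_eq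
    simp only [fderiv_fun_const] at h1
    rw [fderiv_fun_sum fun l _ => (hA l k).fun_mul (hA l r)] at h1
    simp only [sum_apply, fderiv_fun_mul (hA _ k) (hA _ r)] at h1
    rw [eq_neg_iff_add_eq_zero, ← Finset.sum_add_distrib]
    simp only [Pi.zero_apply, zero_apply] at h1
    rw [← h1]
    refine Finset.sum_congr rfl fun l _ => ?_
    simp
    ring
  -- Cyclic relabelling of the summation indices, to bring the tensorial parts of the second and
  -- third brackets to the index order of the first.
  have hrot : ∀ C : Fin n → Fin n → Fin n → ℝ,
      ∑ q, ∑ l, ∑ s, A q p u * A l r u * A s j u * C q l s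
        = ∑ q, ∑ l, ∑ s, A q j u * A l p u * A s r u * C l s q := by
    intro C
    calc _ = ∑ q, ∑ s, ∑ l, A q p u * A l r u * A s j u * C q l s :=
          Finset.sum_congr rfl fun q _ => Finset.sum_comm
      _ = ∑ s, ∑ q, ∑ l, A q p u * A l r u * A s j u * C q l s := Finset.sum_comm
      _ = _ := by
          refine Finset.sum_congr rfl fun q _ => Finset.sum_congr rfl fun l _ =>
            Finset.sum_congr rfl fun s _ => ?_
          ring
  have hrot' : ∀ C : Fin n → Fin n → Fin n → ℝ,
      ∑ q, ∑ l, ∑ s, A q r u * A l j u * A s p u * C q l s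
        = ∑ q, ∑ l, ∑ s, A q j u * A l p u * A s r u * C s q l := by
    intro C
    calc _ = ∑ l, ∑ q, ∑ s, A q r u * A l j u * A s p u * C q l s := Finset.sum_comm
      _ = ∑ l, ∑ s, ∑ q, A q r u * A l j u * A s p u * C q l s :=
          Finset.sum_congr rfl fun q _ => Finset.sum_comm
      _ = _ := by
          refine Finset.sum_congr rfl fun q _ => Finset.sum_congr rfl fun l _ =>
            Finset.sum_congr rfl fun s _ => ?_
          ring
  have hsum : ∑ q, ∑ l, ∑ s, A q j u * A l p u * A s r u * koszul G e u q l s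
      = ((∑ q, ∑ l, ∑ s, A q j u * A l p u * A s r u *
            G (VectorField.lieBracket ℝ (e q) (e l) u) (e s u))
          - (∑ q, ∑ l, ∑ s, A q j u * A l p u * A s r u *
            G (VectorField.lieBracket ℝ (e l) (e s) u) (e q u))
          + ∑ q, ∑ l, ∑ s, A q j u * A l p u * A s r u *
            G (VectorField.lieBracket ℝ (e s) (e q) u) (e l u)) / 2 := by
    simp only [koszul, ← Finset.sum_sub_distrib, ← Finset.sum_add_distrib, Finset.sum_div]
    refine Finset.sum_congr rfl fun q _ => Finset.sum_congr rfl fun l _ =>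
      Finset.sum_congr rfl fun s _ => ?_
    ring
  rw [hsum, koszul, bracket_frame_change hG he hd hA j p r, bracket_frame_change hG he hd hA p r j,
    bracket_frame_change hG he hd hA r j p, hrot, hrot', hδ (e' j u) r p, hδ (e' p u) r j,
    hδ (e' r u) p j]
  ring

/-- The change of the Levi-Civita coefficients under a change of orthonormal frames. -/
theorem sum_koszul_frame_change (hG : ∀ k l, G (e k u) (e l u) = if k = l then 1 else 0)
    (he : ∀ k, e' k =ᶠ[𝓝 u] fun y => ∑ l, A l k y • e l y)
    (hd : ∀ l, DifferentiableAt ℝ (e l) u) (hA : ∀ l k, DifferentiableAt ℝ (A l k) u)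
    (horth : ∀ k r, (fun y => ∑ l, A l k y * A l r y) =ᶠ[𝓝 u] fun _ => if k = r then 1 else 0)
    (horth' : ∀ l q, ∑ k, A l k u * A q k u = if l = q then 1 else 0) (j p q : Fin n) :
    ∑ r, koszul G e' u j p r * A q r u
      = (∑ k, A k j u * ∑ l, A l p u * koszul G e u k l q) + fderiv ℝ (A q p) u (e' j u) := by
  -- Contracting with `A` undoes the expansion because its rows are orthonormal too.
  have h1 : ∀ c : Fin n → ℝ, ∑ r, (∑ l, c l * A l r u) * A q r u = c q := by
    intro c
    simp only [Finset.sum_mul, mul_assoc]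
    rw [Finset.sum_comm]
    simp only [← Finset.mul_sum, horth']
    simp
  simp only [koszul_frame_change hG he hd hA horth, add_mul, Finset.sum_add_distrib, h1]
  congr 1
  rw [← h1 (fun q => ∑ k, A k j u * ∑ l, A l p u * koszul G e u k l q)]
  refine Finset.sum_congr rfl fun r _ => ?_
  congr 1
  simp only [Finset.mul_sum, Finset.sum_mul]
  rw [Finset.sum_comm (γ := Fin n)]
  calc _ = ∑ q, ∑ l, ∑ s, A q j u * A l p u * A s r u * koszul G e u q l s := Finset.sum_comm
    _ = ∑ q, ∑ s, ∑ l, A q j u * A l p u * A s r u * koszul G e u q l s :=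
        Finset.sum_congr rfl fun q _ => Finset.sum_comm
    _ = ∑ s, ∑ q, ∑ l, A q j u * A l p u * A s r u * koszul G e u q l s := Finset.sum_comm
    _ = _ := by
        refine Finset.sum_congr rfl fun q _ => Finset.sum_congr rfl fun l _ =>
            Finset.sum_congr rfl fun s _ => ?_
        ring

end LeviCivita

/-! ### Change of the spin connection under a change of spin frame -/

/-- There are only finitely many increasing products. A finite basis is what allows maps into the
Clifford algebra to be differentiated coordinatewise. -/
instance finiteDimensional_cl (m : ℕ) : FiniteDimensional ℝ (Cl m) := by
  have hfin : Set.Finite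
      {a : Cl m | ∃ l : List (Fin (2 * m)), l.SortedLT ∧ (l.map (gen m)).prod = a} := by
    refine Set.Finite.subset (Set.finite_range
      fun I : Finset (Fin (2 * m)) => (I.sort.map (gen m)).prod) ?_
    rintro a ⟨l, hl, rfl⟩
    refine ⟨l.toFinset, ?_⟩
    have : l.toFinset.sort = l :=
      (Finset.sortedLT_sort l.toFinset).eq_of_mem_iff hl fun a => by simp
    simp only [this]
  have := FiniteDimensional.span_of_finite ℝ hfin
  rw [span_gen_prod] at this
  exact Module.finite_def.2 (Module.Finite.iff_fg.1 this)

/-- The element `(1/4) ∑ θ_{kl} e_k e_l` of the Clifford algebra which corresponds to the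
antisymmetric matrix `θ`. -/
def spinElement (m : ℕ) (θ : Fin (2 * m) → Fin (2 * m) → ℝ) : Cl m :=
  (1 / 4 : ℝ) • ∑ k, ∑ l, θ k l • (gen m k * gen m l)

theorem gen_mul_gen_add (m : ℕ) (k l : Fin (2 * m)) :
    gen m k * gen m l + gen m l * gen m k = if k = l then -2 else 0 := by
  have h := gen_isCliffordFamily m
  split_ifs with hkl
  · rw [hkl, h.sq]
    norm_num
  · rw [h.anticomm k l hkl, neg_add_cancel]

/-- Moving `gen m p` through two generators leaves two Kronecker terms with coefficient 2, equal by
antisymmetry of `θ`; hence the factor 1/4. Thus `spinElement` lifts an infinitesimal rotation to the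
Clifford algebra. -/
theorem spinElement_commutator {m : ℕ} {θ : Fin (2 * m) → Fin (2 * m) → ℝ}
    (hθ : ∀ k l, θ k l = - θ l k) (p : Fin (2 * m)) :
    spinElement m θ * gen m p - gen m p * spinElement m θ = ∑ l, θ p l • gen m l := by
  have h1 : ∀ k l, gen m k * gen m l * gen m p - gen m p * (gen m k * gen m l)
      = (if l = p then (-2 : ℝ) else 0) • gen m k - (if k = p then (-2 : ℝ) else 0) • gen m l := by
    intro k l
    have e1 := congrArg (fun z => gen m k * z) (gen_mul_gen_add m l p)
    have e2 := congrArg (fun z => z * gen m l) (gen_mul_gen_add m k p)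
    have c1 : gen m k * (if l = p then (-2 : Cl m) else 0)
        = (if l = p then (-2 : ℝ) else 0) • gen m k := by
      split_ifs
      · rw [neg_smul, two_smul, mul_neg, mul_two]
      · simp
    have c2 : (if k = p then (-2 : Cl m) else 0) * gen m l
        = (if k = p then (-2 : ℝ) else 0) • gen m l := by
      split_ifs
      · rw [neg_smul, two_smul, neg_mul]
        exact congrArg _ (two_mul _)
      · simp
    rw [← c1, ← c2, ← e1, ← e2]
    noncomm_ring
  have h2 : spinElement m θ * gen m p - gen m p * spinElement m θ
      = (1 / 4 : ℝ) • ∑ k, ∑ l, θ k l •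
          (gen m k * gen m l * gen m p - gen m p * (gen m k * gen m l)) := by
    simp only [spinElement, smul_mul_assoc, mul_smul_comm, ← smul_sub, Finset.sum_mul,
      Finset.mul_sum, ← Finset.sum_sub_distrib]
  have h3 : ∑ k, ∑ l, θ k l • (if l = p then (-2 : ℝ) else 0) • gen m k
      = ∑ l, (θ l p * -2) • gen m l := by
    simp [smul_smul]
  have h4 : ∑ k, ∑ l, θ k l • (if k = p then (-2 : ℝ) else 0) • gen m l
      = ∑ l, (θ p l * -2) • gen m l := by
    rw [Finset.sum_comm]
    simp [smul_smul]
  rw [h2]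
  simp only [h1, smul_sub, Finset.sum_sub_distrib]
  rw [← smul_sub, h3, h4, ← Finset.sum_sub_distrib, Finset.smul_sum]
  refine Finset.sum_congr rfl fun l _ => ?_
  rw [hθ l p, ← sub_smul, smul_smul]
  congr 1
  ring

/-! ### Traces and the transformation law of spin connections. -/

section Spinor

variable {m : ℕ} {S : Type*} [NormedAddCommGroup S] [InnerProductSpace ℂ S] [FiniteDimensional ℂ S]

/-- The real part of the trace in the spinor representation. -/
def spinTrace (Δ : SpinorModule m S) : Cl m →ₗ[ℝ] ℝ :=
  Complex.reLm ∘ₗ ((LinearMap.trace ℂ S).restrictScalars ℝ ∘ₗ Δ.c.toLinearMap)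

theorem spinTrace_apply (Δ : SpinorModule m S) (a : Cl m) :
    spinTrace Δ a = (LinearMap.trace ℂ S (Δ.c a)).re := rfl

theorem spinTrace_mul_comm (Δ : SpinorModule m S) (a b : Cl m) :
    spinTrace Δ (a * b) = spinTrace Δ (b * a) := by
  rw [spinTrace_apply, spinTrace_apply, map_mul Δ.c, map_mul Δ.c, LinearMap.trace_mul_comm]

theorem trace_c_eq_zero (Δ : SpinorModule m S) {a : Cl m} (ha : spinTrace Δ a = 0) :
    LinearMap.trace ℂ S (Δ.c a) = 0 :=
  Complex.ext ha (Δ.trace_c_im a)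

/-- An antisymmetric matrix is summed against a symmetric bilinear form, namely the trace of a
product. -/
theorem spinTrace_spinElement (Δ : SpinorModule m S) {θ : Fin (2 * m) → Fin (2 * m) → ℝ}
    (hθ : ∀ k l, θ k l = - θ l k) : spinTrace Δ (spinElement m θ) = 0 := by
  have h : ∑ k, ∑ l, θ k l * spinTrace Δ (gen m k * gen m l)
      = - ∑ k, ∑ l, θ k l * spinTrace Δ (gen m k * gen m l) := by
    nth_rewrite 1 [Finset.sum_comm]
    simp only [← Finset.sum_neg_distrib]
    refine Finset.sum_congr rfl fun k _ => Finset.sum_congr rfl fun l _ => ?_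
    rw [hθ l k, spinTrace_mul_comm]
    ring
  simp only [spinElement, map_smul, map_sum, smul_eq_mul]
  rw [show ∑ k, ∑ l, θ k l * spinTrace Δ (gen m k * gen m l) = 0 by linarith, mul_zero]

/-- The element acts isometrically, so Cauchy–Schwarz bounds each diagonal entry in an orthonormal
basis by 1. This maximality of the identity is used to kill the derivative of the trace. -/
theorem spinTrace_le (Δ : SpinorModule m S) {a : Cl m} (ha : star a * a = 1) :
    spinTrace Δ a ≤ spinTrace Δ 1 := by
  rw [spinTrace_apply, spinTrace_apply,
    LinearMap.trace_eq_sum_inner _ (stdOrthonormalBasis ℂ S),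
    LinearMap.trace_eq_sum_inner _ (stdOrthonormalBasis ℂ S), Complex.re_sum, Complex.re_sum]
  refine Finset.sum_le_sum fun i _ => ?_
  set b := stdOrthonormalBasis ℂ S i
  have hb : ‖b‖ = 1 := (stdOrthonormalBasis ℂ S).orthonormal.1 i
  have h1 : ‖Δ.c a b‖ = 1 := by
    have : inner ℂ (Δ.c a b) (Δ.c a b) = inner ℂ b b := by
      rw [Δ.inner_c, ← Module.End.mul_apply, ← map_mul, ha, map_one, Module.End.one_apply]
    rw [inner_self_eq_norm_sq_to_K, inner_self_eq_norm_sq_to_K, hb] at this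
    have h2 : ‖Δ.c a b‖ ^ 2 = 1 := by
      have := congrArg Complex.re this
      norm_num at this
      exact_mod_cast this
    exact (pow_eq_one_iff_of_nonneg (norm_nonneg _) two_ne_zero).1 h2
  rw [map_one, Module.End.one_apply]
  calc (inner ℂ b (Δ.c a b)).re ≤ ‖b‖ * ‖Δ.c a b‖ := re_inner_le_norm (𝕜 := ℂ) _ _
    _ = 1 := by rw [hb, h1, one_mul]
    _ = (inner ℂ b b).re := by
        rw [inner_self_eq_norm_sq_to_K, hb]
        norm_num

/-- The transformation law of spin connections: if `s` is a change of spin frame with derivative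
`δ`, over the change of frame `A` with derivative `dA`, and if the connection matrices `θ` and `θ'`
are related by `A` and `dA`, then so are the spin connections by `s` and `δ`. -/
theorem spin_connection_change (Δ : SpinorModule m S) {s δ : Cl m} (h1 : star s * s = 1)
    (h2 : s * star s = 1) {A dA θ θ' : Fin (2 * m) → Fin (2 * m) → ℝ}
    (hθ : ∀ k l, θ k l = - θ l k) (hθ' : ∀ k l, θ' k l = - θ' l k)
    (hs : ∀ p, s * gen m p = (∑ l, A l p • gen m l) * s)
    (hδ : ∀ p, δ * gen m p = (∑ l, dA l p • gen m l) * s + (∑ l, A l p • gen m l) * δ)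
    (hθθ' : ∀ p q, ∑ r, θ' p r * A q r = (∑ l, A l p * θ l q) + dA q p)
    (htr : spinTrace Δ (star s * δ) = 0) :
    Δ.c (s * spinElement m θ') = Δ.c (spinElement m θ * s + δ) := by
  set v : Fin (2 * m) → Cl m := fun p => ∑ l, A l p • gen m l with hv
  have hs' : ∀ p, star s * v p = gen m p * star s := by
    intro p
    calc star s * v p = star s * (v p * s) * star s := by
          rw [mul_assoc, mul_assoc, h2, mul_one]
      _ = star s * (s * gen m p) * star s := by rw [hs p]
      _ = gen m p * star s := by rw [← mul_assoc, h1, one_mul]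
  have hgen : ∀ p, gen m p = star s * v p * s := by
    intro p
    rw [hs', mul_assoc, h1, mul_one]
  -- `Z` is the discrepancy between the transported connection and the new one.
  set Z := star s * (spinElement m θ * s + δ) - spinElement m θ' with hZ
  -- Both connections induce the same derivation on vectors: the rotation law `hθθ'` contains the
  -- term `dA` that `hδ` produces.
  have hcomm : ∀ p, Z * gen m p - gen m p * Z = 0 := by
    intro p
    have e1 : spinElement m θ * v p - v p * spinElement m θ = ∑ l, A l p • ∑ q, θ l q • gen m q := by
      rw [hv]
      simp only [Finset.mul_sum, Finset.sum_mul, mul_smul_comm, smul_mul_assoc,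
        ← Finset.sum_sub_distrib, ← smul_sub, spinElement_commutator hθ]
    have e2 := spinElement_commutator hθ' p
    have e3 : star s * (spinElement m θ * s + δ) * gen m p
          - gen m p * (star s * (spinElement m θ * s + δ))
        = star s * ((∑ l, A l p • ∑ q, θ l q • gen m q) + ∑ l, dA l p • gen m l) * s := by
      have f1 : star s * (spinElement m θ * s + δ) * gen m p
          = star s * spinElement m θ * v p * s + star s * (∑ l, dA l p • gen m l) * s
            + star s * v p * δ := by
        rw [mul_assoc, add_mul, mul_assoc, hs, hδ]
        noncomm_ring
      have f2 : gen m p * (star s * (spinElement m θ * s + δ))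
          = star s * v p * spinElement m θ * s + star s * v p * δ := by
        rw [hs']
        noncomm_ring
      rw [f1, f2, ← e1]
      noncomm_ring
    have e4 : (∑ l, A l p • ∑ q, θ l q • gen m q) + ∑ l, dA l p • gen m l
        = ∑ r, θ' p r • v r := by
      have g1 : ∑ r, θ' p r • v r = ∑ q, (∑ r, θ' p r * A q r) • gen m q := by
        simp only [hv, Finset.smul_sum, smul_smul, Finset.sum_smul]
        rw [Finset.sum_comm]
      have g2 : ∑ l, A l p • ∑ q, θ l q • gen m q = ∑ q, (∑ l, A l p * θ l q) • gen m q := by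
        simp only [Finset.smul_sum, smul_smul, Finset.sum_smul]
        rw [Finset.sum_comm]
      rw [g1, g2, ← Finset.sum_add_distrib]
      simp only [hθθ', add_smul]
    have e5 : star s * (∑ r, θ' p r • v r) * s = ∑ r, θ' p r • gen m r := by
      rw [Finset.mul_sum, Finset.sum_mul]
      refine Finset.sum_congr rfl fun r _ => ?_
      rw [mul_smul_comm, smul_mul_assoc, ← hgen]
    have : Z * gen m p - gen m p * Z
        = (star s * (spinElement m θ * s + δ) * gen m p
            - gen m p * (star s * (spinElement m θ * s + δ)))
          - (spinElement m θ' * gen m p - gen m p * spinElement m θ') := by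
      rw [hZ]
      noncomm_ring
    rw [this, e3, e4, e5, e2, sub_self]
  have htrZ : spinTrace Δ Z = 0 := by
    rw [hZ, map_sub, spinTrace_spinElement Δ hθ', mul_add, map_add, htr, spinTrace_mul_comm,
      mul_assoc, h2, mul_one, spinTrace_spinElement Δ hθ]
    simp
  -- Irreducibility gives vanishing of the action of `Z`, which is why the conclusion is stated
  -- under `Δ.c`.
  have hcZ : Δ.c Z = 0 := by
    refine Δ.isCliffordFamily.eq_zero_of_commute_of_trace_eq_zero Δ.finrank_eq (fun k => ?_)
      (trace_c_eq_zero Δ htrZ)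
    change Δ.c Z * Δ.c (gen m k) = Δ.c (gen m k) * Δ.c Z
    rw [← map_mul, ← map_mul, sub_eq_zero.1 (hcomm k)]
  have : spinElement m θ * s + δ = s * spinElement m θ' + s * Z := by
    rw [hZ, mul_sub, ← mul_assoc, h2, one_mul]
    abel
  rw [this, map_add, map_mul Δ.c s Z, hcZ, mul_zero, add_zero]

variable {F : Type*} [NormedAddCommGroup F] [NormedSpace ℝ F]

/-- The derivative of a family of elements of the Clifford algebra, computed in coordinates. -/
def clDeriv (s : F → Cl m) (u v : F) : Cl m :=
  ∑ i, fderiv ℝ (fun y => (Module.finBasis ℝ (Cl m)).coord i (s y)) u v •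
    Module.finBasis ℝ (Cl m) i

/-- In a finite basis the composite is a finite sum of scalar functions times fixed vectors, so
`clDeriv` is the derivative seen through every linear map. -/
theorem hasFDerivAt_linear {V : Type*} [NormedAddCommGroup V] [NormedSpace ℝ V] {s : F → Cl m}
    {u : F} (hs : ∀ f : Cl m →ₗ[ℝ] ℝ, DifferentiableAt ℝ (fun y => f (s y)) u)
    (L : Cl m →ₗ[ℝ] V) :
    DifferentiableAt ℝ (fun y => L (s y)) u ∧
      ∀ v, fderiv ℝ (fun y => L (s y)) u v = L (clDeriv s u v) := by
  set B := Module.finBasis ℝ (Cl m)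
  have h : (fun y => L (s y)) = fun y => ∑ i, B.coord i (s y) • L (B i) := by
    funext y
    conv_lhs => rw [← B.sum_repr (s y)]
    simp only [map_sum, map_smul, Module.Basis.coord_apply]
  have hd : ∀ i, DifferentiableAt ℝ (fun y => B.coord i (s y) • L (B i)) u :=
    fun i => (hs (B.coord i)).smul_const _
  rw [h]
  refine ⟨DifferentiableAt.fun_sum fun i _ => hd i, fun v => ?_⟩
  rw [fderiv_fun_sum fun i _ => hd i, sum_apply, clDeriv, map_sum]
  refine Finset.sum_congr rfl fun i _ => ?_
  rw [fderiv_smul_const (hs (B.coord i)), map_smul]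
  rfl

theorem cl_ext {a b : Cl m} (h : ∀ f : Cl m →ₗ[ℝ] ℝ, f a = f b) : a = b := by
  rw [← sub_eq_zero]
  refine (Module.forall_dual_apply_eq_zero_iff ℝ (a - b)).1 fun f => ?_
  rw [map_sub, h f, sub_self]

/-- The real trace of `star (s u) * s y` has a local maximum at `y = u` by `spinTrace_le`, so its
derivative vanishes. This fixes the scalar part that the commutators with vectors cannot see. -/
theorem spinTrace_star_mul_clDeriv (Δ : SpinorModule m S) {s : F → Cl m} {u : F}
    (hs : ∀ f : Cl m →ₗ[ℝ] ℝ, DifferentiableAt ℝ (fun y => f (s y)) u)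
    (h1 : ∀ᶠ y in 𝓝 u, star (s y) * s y = 1) (h2 : s u * star (s u) = 1) (v : F) :
    spinTrace Δ (star (s u) * clDeriv s u v) = 0 := by
  have hmax : IsLocalMax (fun y => (spinTrace Δ ∘ₗ LinearMap.mulLeft ℝ (star (s u))) (s y)) u := by
    filter_upwards [h1] with y hy
    simp only [LinearMap.comp_apply, LinearMap.mulLeft_apply]
    rw [h1.self_of_nhds]
    refine spinTrace_le Δ ?_
    rw [star_mul, star_star, mul_assoc, ← mul_assoc (s u), h2, one_mul, hy]
  have h3 := (hasFDerivAt_linear hs (spinTrace Δ ∘ₗ LinearMap.mulLeft ℝ (star (s u)))).2 v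
  rw [hmax.fderiv_eq_zero] at h3
  exact h3.symm

/-- This is the product rule for the lifting relation `h`, tested against linear functionals. -/
theorem clDeriv_mul_gen {s : F → Cl m} {u : F}
    (hs : ∀ f : Cl m →ₗ[ℝ] ℝ, DifferentiableAt ℝ (fun y => f (s y)) u)
    {A : Fin (2 * m) → Fin (2 * m) → F → ℝ} (hA : ∀ l k, DifferentiableAt ℝ (A l k) u)
    (h : ∀ p, ∀ᶠ y in 𝓝 u, s y * gen m p = (∑ l, A l p y • gen m l) * s y) (p : Fin (2 * m))
    (v : F) :
    clDeriv s u v * gen m p = (∑ l, fderiv ℝ (A l p) u v • gen m l) * s u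
      + (∑ l, A l p u • gen m l) * clDeriv s u v := by
  refine cl_ext fun f => ?_
  have h1 := (hasFDerivAt_linear hs (f ∘ₗ LinearMap.mulRight ℝ (gen m p))).2 v
  have h2 : (fun y => (f ∘ₗ LinearMap.mulRight ℝ (gen m p)) (s y))
      =ᶠ[𝓝 u] fun y => ∑ l, A l p y * (f ∘ₗ LinearMap.mulLeft ℝ (gen m l)) (s y) := by
    filter_upwards [h p] with y hy
    simp only [LinearMap.comp_apply, LinearMap.mulRight_apply, hy, Finset.sum_mul, map_sum,
      smul_mul_assoc, map_smul, LinearMap.mulLeft_apply, smul_eq_mul]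
  have h3 := fun l => hasFDerivAt_linear hs (f ∘ₗ LinearMap.mulLeft ℝ (gen m l))
  rw [h2.fderiv_eq, fderiv_fun_sum fun l _ => (hA l p).fun_mul (h3 l).1, sum_apply] at h1
  simp only [fderiv_fun_mul (hA _ p) (h3 _).1, add_apply, smul_apply, (h3 _).2] at h1
  simp only [LinearMap.comp_apply, LinearMap.mulRight_apply, LinearMap.mulLeft_apply] at h1
  rw [← h1, map_add, Finset.sum_mul, Finset.sum_mul, map_sum, map_sum, ← Finset.sum_add_distrib]
  refine Finset.sum_congr rfl fun l _ => ?_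
  rw [smul_mul_assoc, smul_mul_assoc, map_smul, map_smul, add_comm]
  simp only [smul_eq_mul]
  ring

end Spinor

/-! ### Vector fields and metrics in a chart -/

section Chart

variable {m : ℕ} {X : Type*} [TopologicalSpace X] [ChartedSpace (Model m) X]
  [IsManifold (𝓡 (2 * m)) ∞ X]

/-- A vector field in the chart around `x₀`. -/
def chartField (x₀ : X) (V : ∀ x : X, TangentSpace (𝓡 (2 * m)) x) : Model m → Model m :=
  VectorField.mpullback 𝓘(ℝ, Model m) (𝓡 (2 * m)) (extChartAt (𝓡 (2 * m)) x₀).symm V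

/-- The derivative of the inverse of the chart around `x₀`. -/
def chartDeriv (x₀ : X) (u : Model m) :
    Model m →L[ℝ] TangentSpace (𝓡 (2 * m)) ((extChartAt (𝓡 (2 * m)) x₀).symm u) :=
  mfderiv 𝓘(ℝ, Model m) (𝓡 (2 * m)) (extChartAt (𝓡 (2 * m)) x₀).symm u

/-- The metric in the chart around `x₀`. -/
def chartMetric (g : Metric m X) (x₀ : X) (u : Model m) : Model m →ₗ[ℝ] Model m →ₗ[ℝ] ℝ :=
  LinearMap.mk₂ ℝ (fun v w => g.inner ((extChartAt (𝓡 (2 * m)) x₀).symm u)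
    (chartDeriv x₀ u v) (chartDeriv x₀ u w)) (fun a b c => by rw [map_add, map_add]; rfl)
    (fun r a b => by rw [map_smul, map_smul]; rfl) (fun a b c => by rw [map_add, map_add])
    (fun r a b => by rw [map_smul, map_smul])

theorem chartMetric_apply (g : Metric m X) (x₀ : X) (u v w : Model m) :
    chartMetric g x₀ u v w = g.inner ((extChartAt (𝓡 (2 * m)) x₀).symm u)
      (chartDeriv x₀ u v) (chartDeriv x₀ u w) := rfl

variable {x₀ : X} {u : Model m}

theorem isOpen_target (x₀ : X) : IsOpen (extChartAt (𝓡 (2 * m)) x₀).target :=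
  isOpen_extChartAt_target x₀

theorem contMDiffAt_symm (hu : u ∈ (extChartAt (𝓡 (2 * m)) x₀).target) :
    ContMDiffAt 𝓘(ℝ, Model m) (𝓡 (2 * m)) ∞ (extChartAt (𝓡 (2 * m)) x₀).symm u :=
  (contMDiffOn_extChartAt_symm x₀).contMDiffAt ((isOpen_target x₀).mem_nhds hu)

theorem chartDeriv_isInvertible (hu : u ∈ (extChartAt (𝓡 (2 * m)) x₀).target) :
    (chartDeriv x₀ u).IsInvertible := by
  have := isInvertible_mfderivWithin_extChartAt_symm (I := 𝓡 (2 * m)) hu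
  rw [ModelWithCorners.range_eq_univ, mfderivWithin_univ] at this
  exact this

theorem chartDeriv_chartField (hu : u ∈ (extChartAt (𝓡 (2 * m)) x₀).target)
    (V : ∀ x : X, TangentSpace (𝓡 (2 * m)) x) :
    chartDeriv x₀ u (chartField x₀ V u) = V ((extChartAt (𝓡 (2 * m)) x₀).symm u) :=
  (chartDeriv_isInvertible hu).self_apply_inverse _

theorem chartDeriv_injective (hu : u ∈ (extChartAt (𝓡 (2 * m)) x₀).target) :
    Function.Injective (chartDeriv x₀ u) :=
  (chartDeriv_isInvertible hu).injective

theorem chartMetric_chartField (g : Metric m X) (hu : u ∈ (extChartAt (𝓡 (2 * m)) x₀).target)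
    (V V' : ∀ x : X, TangentSpace (𝓡 (2 * m)) x) :
    chartMetric g x₀ u (chartField x₀ V u) (chartField x₀ V' u)
      = g.inner ((extChartAt (𝓡 (2 * m)) x₀).symm u) (V _) (V' _) := by
  rw [chartMetric_apply, chartDeriv_chartField hu, chartDeriv_chartField hu]

theorem mlieBracket_model (V V' : Model m → Model m) (u : Model m) :
    VectorField.mlieBracket 𝓘(ℝ, Model m) V V' u = VectorField.lieBracket ℝ V V' u :=
  (congrFun (VectorField.mlieBracketWithin_eq_lieBracketWithin (V := V) (W := V')
    (s := Set.univ)) u).trans (congrFun VectorField.lieBracketWithin_univ u)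

/-- Lie brackets are natural under pullback by the inverse chart, which reduces the Koszul formula
to calculus in Euclidean space. -/
theorem chartDeriv_lieBracket (hu : u ∈ (extChartAt (𝓡 (2 * m)) x₀).target)
    {V V' : ∀ x : X, TangentSpace (𝓡 (2 * m)) x}
    (hV : MDifferentiableAt (𝓡 (2 * m)) (𝓡 (2 * m)).tangent
      (fun x => (⟨x, V x⟩ : TangentBundle (𝓡 (2 * m)) X)) ((extChartAt (𝓡 (2 * m)) x₀).symm u))
    (hV' : MDifferentiableAt (𝓡 (2 * m)) (𝓡 (2 * m)).tangent
      (fun x => (⟨x, V' x⟩ : TangentBundle (𝓡 (2 * m)) X)) ((extChartAt (𝓡 (2 * m)) x₀).symm u)) :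
    chartDeriv x₀ u (VectorField.lieBracket ℝ (chartField x₀ V) (chartField x₀ V') u)
      = VectorField.mlieBracket (𝓡 (2 * m)) V V' ((extChartAt (𝓡 (2 * m)) x₀).symm u) := by
  have : IsManifold (𝓡 (2 * m)) (minSmoothness ℝ 3) X := by
    rw [minSmoothness_of_isRCLikeNormedField]
    exact IsManifold.of_le (n := ∞) ENat.LEInfty.out
  have h := VectorField.mpullback_mlieBracket (I := 𝓘(ℝ, Model m)) (I' := 𝓡 (2 * m)) hV hV'
    (contMDiffAt_symm hu) (by rw [minSmoothness_of_isRCLikeNormedField]; exact ENat.LEInfty.out)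
  have h2 := congrArg (chartDeriv x₀ u) (h.trans (mlieBracket_model _ _ u))
  exact h2.symm.trans (chartDeriv_chartField hu _)

theorem contDiffAt_chartField (hu : u ∈ (extChartAt (𝓡 (2 * m)) x₀).target)
    {V : ∀ x : X, TangentSpace (𝓡 (2 * m)) x}
    (hV : ContMDiffAt (𝓡 (2 * m)) (𝓡 (2 * m)).tangent ∞
      (fun x => (⟨x, V x⟩ : TangentBundle (𝓡 (2 * m)) X)) ((extChartAt (𝓡 (2 * m)) x₀).symm u)) :
    ContDiffAt ℝ ∞ (chartField x₀ V) u := by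
  have : IsManifold (𝓡 (2 * m)) (∞ + 1) X := by simpa
  have := ContMDiffAt.mpullback_vectorField_preimage (I := 𝓘(ℝ, Model m)) (I' := 𝓡 (2 * m))
    (n := ∞) (m := ∞) hV (contMDiffAt_symm hu) (chartDeriv_isInvertible hu) (by simp)
  exact contMDiffAt_vectorSpace_iff_contDiffAt.1 this

theorem mvfderiv_vectorField {F : Type*} [NormedAddCommGroup F] [NormedSpace ℝ F]
    (hu : u ∈ (extChartAt (𝓡 (2 * m)) x₀).target) {f : X → F}
    (hf : MDifferentiableAt (𝓡 (2 * m)) 𝓘(ℝ, F) f ((extChartAt (𝓡 (2 * m)) x₀).symm u))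
    (V : ∀ x : X, TangentSpace (𝓡 (2 * m)) x) :
    mvfderiv (𝓡 (2 * m)) f ((extChartAt (𝓡 (2 * m)) x₀).symm u)
        (V ((extChartAt (𝓡 (2 * m)) x₀).symm u))
      = fderiv ℝ (fun y => f ((extChartAt (𝓡 (2 * m)) x₀).symm y)) u (chartField x₀ V u) := by
  have h := mfderiv_comp_apply (I := 𝓘(ℝ, Model m)) (I' := 𝓡 (2 * m)) (I'' := 𝓘(ℝ, F)) u hf
    ((contMDiffAt_symm hu).mdifferentiableAt (by simp)) (chartField x₀ V u)
  rw [mfderiv_eq_fderiv] at h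
  rw [← chartDeriv_chartField hu V]
  refine Eq.trans h.symm ?_
  rfl

theorem differentiableAt_comp_symm {F : Type*} [NormedAddCommGroup F] [NormedSpace ℝ F]
    (hu : u ∈ (extChartAt (𝓡 (2 * m)) x₀).target) {f : X → F}
    (hf : MDifferentiableAt (𝓡 (2 * m)) 𝓘(ℝ, F) f ((extChartAt (𝓡 (2 * m)) x₀).symm u)) :
    DifferentiableAt ℝ (fun y => f ((extChartAt (𝓡 (2 * m)) x₀).symm y)) u := by
  rw [← mdifferentiableAt_iff_differentiableAt]
  exact hf.comp u ((contMDiffAt_symm hu).mdifferentiableAt (by simp))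

theorem contDiffAt_comp_symm {F : Type*} [NormedAddCommGroup F] [NormedSpace ℝ F]
    (hu : u ∈ (extChartAt (𝓡 (2 * m)) x₀).target) {f : X → F}
    (hf : ContMDiffAt (𝓡 (2 * m)) 𝓘(ℝ, F) ∞ f ((extChartAt (𝓡 (2 * m)) x₀).symm u)) :
    ContDiffAt ℝ ∞ (fun y => f ((extChartAt (𝓡 (2 * m)) x₀).symm y)) u := by
  rw [← contMDiffAt_iff_contDiffAt]
  exact hf.comp u (contMDiffAt_symm hu)

/-- The order `k` is kept free because brackets of frame fields are later needed only as continuous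
fields. -/
theorem contMDiffAt_inner (g : Metric m X) {x : X} {V V' : ∀ x : X, TangentSpace (𝓡 (2 * m)) x}
    {k : ℕ∞ω} (hk : k ≤ ∞)
    (hV : ContMDiffAt (𝓡 (2 * m)) (𝓡 (2 * m)).tangent k
      (fun x => (⟨x, V x⟩ : TangentBundle (𝓡 (2 * m)) X)) x)
    (hV' : ContMDiffAt (𝓡 (2 * m)) (𝓡 (2 * m)).tangent k
      (fun x => (⟨x, V' x⟩ : TangentBundle (𝓡 (2 * m)) X)) x) :
    ContMDiffAt (𝓡 (2 * m)) 𝓘(ℝ, ℝ) k (fun x => g.inner x (V x) (V' x)) x := by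
  have : ContMDiffAt (𝓡 (2 * m)) ((𝓡 (2 * m)).prod 𝓘(ℝ, ℝ)) k
      (fun x => TotalSpace.mk' ℝ (E := Bundle.Trivial X ℝ) x (g.inner x (V x) (V' x))) x := by
    apply ContMDiffAt.clm_bundle_apply₂ (F₁ := Model m) (F₂ := Model m)
    · exact g.contMDiff.contMDiffAt.of_le hk
    · exact hV
    · exact hV'
  simp only [contMDiffAt_totalSpace] at this
  exact this.2

end Chart

/-! ### Local frames -/

section Frames

variable {m : ℕ} {X : Type*} [TopologicalSpace X] [ChartedSpace (Model m) X]
  [IsManifold (𝓡 (2 * m)) ∞ X] {g : Metric m X} {ι : Type*} (σ : SpinStructure g ι)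

theorem frame_linearIndependent (a : ι) {x : X} (hx : x ∈ σ.U a) :
    LinearIndependent ℝ (fun k => σ.frame a k x) := by
  rw [Fintype.linearIndependent_iff]
  intro c hc k
  have h := congrArg (fun v => g.inner x v (σ.frame a k x)) hc
  simpa [map_sum, sum_apply, σ.frame_orthonormal a x hx] using h

theorem finrank_tangentSpace (x : X) :
    Module.finrank ℝ (TangentSpace (𝓡 (2 * m)) x) = 2 * m :=
  finrank_euclideanSpace_fin (𝕜 := ℝ) (n := 2 * m)

instance finiteDimensional_tangentSpace (x : X) :
    FiniteDimensional ℝ (TangentSpace (𝓡 (2 * m)) x) :=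
  inferInstanceAs (FiniteDimensional ℝ (Model m))

/-- The orthonormal basis of the tangent space which is given by a local frame. -/
def frameBasis (a : ι) {x : X} (hx : x ∈ σ.U a) :
    Module.Basis (Fin (2 * m)) ℝ (TangentSpace (𝓡 (2 * m)) x) :=
  basisOfLinearIndependentOfCardEqFinrank' (fun k => σ.frame a k x)
    (frame_linearIndependent σ a hx) (by rw [finrank_tangentSpace, Fintype.card_fin])

theorem frameBasis_apply (a : ι) {x : X} (hx : x ∈ σ.U a) (k : Fin (2 * m)) :
    frameBasis σ a hx k = σ.frame a k x := by
  simp [frameBasis]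

theorem eq_sum_frame (a : ι) {x : X} (hx : x ∈ σ.U a) (v : TangentSpace (𝓡 (2 * m)) x) :
    v = ∑ l, g.inner x (σ.frame a l x) v • σ.frame a l x := by
  have h : ∀ l, (frameBasis σ a hx).repr v l = g.inner x (σ.frame a l x) v := by
    intro l
    conv_rhs => rw [← (frameBasis σ a hx).sum_repr v]
    simp [frameBasis_apply, σ.frame_orthonormal a x hx]
  conv_lhs => rw [← (frameBasis σ a hx).sum_repr v]
  simp only [h, frameBasis_apply]

/-- The transition matrix between two local frames, `e^b_k = ∑ₗ A_{lk} e^a_l`. -/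
def frameMatrix (a b : ι) (l k : Fin (2 * m)) (x : X) : ℝ :=
  g.inner x (σ.frame a l x) (σ.frame b k x)

theorem frame_eq_sum (a b : ι) {x : X} (hx : x ∈ σ.U a) (k : Fin (2 * m)) :
    σ.frame b k x = ∑ l, frameMatrix σ a b l k x • σ.frame a l x :=
  eq_sum_frame σ a hx _

theorem frameMatrix_symm (a b : ι) (l k : Fin (2 * m)) (x : X) :
    frameMatrix σ a b l k x = frameMatrix σ b a k l x :=
  g.symm _ _ _

theorem frameMatrix_orthogonal (a b : ι) {x : X} (ha : x ∈ σ.U a) (hb : x ∈ σ.U b)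
    (k r : Fin (2 * m)) :
    ∑ l, frameMatrix σ a b l k x * frameMatrix σ a b l r x = if k = r then 1 else 0 := by
  rw [← σ.frame_orthonormal b x hb k r]
  conv_rhs => rw [frame_eq_sum σ a b ha k]
  simp only [map_sum, map_smul, sum_apply, smul_apply, smul_eq_mul]
  rfl

theorem frameMatrix_orthogonal' (a b : ι) {x : X} (ha : x ∈ σ.U a) (hb : x ∈ σ.U b)
    (l q : Fin (2 * m)) :
    ∑ k, frameMatrix σ a b l k x * frameMatrix σ a b q k x = if l = q then 1 else 0 := by
  simp only [frameMatrix_symm σ a b]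
  exact frameMatrix_orthogonal σ b a hb ha l q

theorem frame_contMDiffAt (a : ι) {x : X} (hx : x ∈ σ.U a) (k : Fin (2 * m)) :
    ContMDiffAt (𝓡 (2 * m)) (𝓡 (2 * m)).tangent ∞
      (fun x => (⟨x, σ.frame a k x⟩ : TangentBundle (𝓡 (2 * m)) X)) x :=
  (σ.frame_smooth a k).contMDiffAt ((σ.isOpen_U a).mem_nhds hx)

theorem frame_mdifferentiableAt (a : ι) {x : X} (hx : x ∈ σ.U a) (k : Fin (2 * m)) :
    MDifferentiableAt (𝓡 (2 * m)) (𝓡 (2 * m)).tangent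
      (fun x => (⟨x, σ.frame a k x⟩ : TangentBundle (𝓡 (2 * m)) X)) x :=
  (frame_contMDiffAt σ a hx k).mdifferentiableAt (by simp)

theorem frameMatrix_contMDiffAt (a b : ι) {x : X} (ha : x ∈ σ.U a) (hb : x ∈ σ.U b)
    (l k : Fin (2 * m)) :
    ContMDiffAt (𝓡 (2 * m)) 𝓘(ℝ, ℝ) ∞ (frameMatrix σ a b l k) x :=
  contMDiffAt_inner g le_rfl (frame_contMDiffAt σ a ha l) (frame_contMDiffAt σ b hb k)

variable {σ} {x₀ : X} {u : Model m}

theorem leviCivitaCoeff_eq_koszul (a : ι) (hu : u ∈ (extChartAt (𝓡 (2 * m)) x₀).target)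
    (ha : (extChartAt (𝓡 (2 * m)) x₀).symm u ∈ σ.U a) (j k l : Fin (2 * m)) :
    leviCivitaCoeff σ a ((extChartAt (𝓡 (2 * m)) x₀).symm u) j k l
      = koszul (chartMetric g x₀ u) (fun k => chartField x₀ (σ.frame a k)) u j k l := by
  have h : ∀ j k l, chartMetric g x₀ u (VectorField.lieBracket ℝ
        (chartField x₀ (σ.frame a j)) (chartField x₀ (σ.frame a k)) u)
        (chartField x₀ (σ.frame a l) u)
      = g.inner _ (VectorField.mlieBracket (𝓡 (2 * m)) (σ.frame a j) (σ.frame a k)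
          ((extChartAt (𝓡 (2 * m)) x₀).symm u)) (σ.frame a l _) := by
    intro j k l
    rw [chartMetric_apply, chartDeriv_lieBracket hu (frame_mdifferentiableAt σ a ha j)
      (frame_mdifferentiableAt σ a ha k), chartDeriv_chartField hu]
  simp only [koszul, h]
  rfl

/-- Metric compatibility of the connection, visible in the Koszul formula once brackets are swapped.
-/
theorem leviCivitaCoeff_antisymm (a : ι) (x : X) (j k l : Fin (2 * m)) :
    leviCivitaCoeff σ a x j k l = - leviCivitaCoeff σ a x j l k := by
  unfold leviCivitaCoeff
  rw [VectorField.mlieBracket_swap_apply (V := σ.frame a j) (W := σ.frame a k),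
    VectorField.mlieBracket_swap_apply (V := σ.frame a k) (W := σ.frame a l),
    VectorField.mlieBracket_swap_apply (V := σ.frame a l) (W := σ.frame a j)]
  simp only [map_neg, neg_apply]
  ring

theorem chartField_frame_orthonormal (a : ι) (hu : u ∈ (extChartAt (𝓡 (2 * m)) x₀).target)
    (ha : (extChartAt (𝓡 (2 * m)) x₀).symm u ∈ σ.U a) (k l : Fin (2 * m)) :
    chartMetric g x₀ u (chartField x₀ (σ.frame a k) u) (chartField x₀ (σ.frame a l) u)
      = if k = l then 1 else 0 := by
  rw [chartMetric_chartField g hu, σ.frame_orthonormal a _ ha]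

theorem eventually_symm_mem {U : Set X} (hU : IsOpen U)
    (hu : u ∈ (extChartAt (𝓡 (2 * m)) x₀).target)
    (hx : (extChartAt (𝓡 (2 * m)) x₀).symm u ∈ U) :
    ∀ᶠ y in 𝓝 u, y ∈ (extChartAt (𝓡 (2 * m)) x₀).target ∧
      (extChartAt (𝓡 (2 * m)) x₀).symm y ∈ U :=
  ((isOpen_target x₀).eventually_mem hu).and
    ((contMDiffAt_symm hu).continuousAt.eventually_mem (hU.mem_nhds hx))

/-- The inhomogeneous law of Levi-Civita coefficients, brought from Euclidean space to the manifold
and put in the form that `spin_connection_change` takes as hypothesis. -/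
theorem sum_leviCivitaCoeff_change (a b : ι) (hu : u ∈ (extChartAt (𝓡 (2 * m)) x₀).target)
    (ha : (extChartAt (𝓡 (2 * m)) x₀).symm u ∈ σ.U a)
    (hb : (extChartAt (𝓡 (2 * m)) x₀).symm u ∈ σ.U b) (j p q : Fin (2 * m)) :
    ∑ r, leviCivitaCoeff σ b ((extChartAt (𝓡 (2 * m)) x₀).symm u) j p r *
        frameMatrix σ a b q r ((extChartAt (𝓡 (2 * m)) x₀).symm u)
      = (∑ l, frameMatrix σ a b l p ((extChartAt (𝓡 (2 * m)) x₀).symm u) *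
          ∑ k, frameMatrix σ a b k j ((extChartAt (𝓡 (2 * m)) x₀).symm u) *
            leviCivitaCoeff σ a ((extChartAt (𝓡 (2 * m)) x₀).symm u) k l q)
        + fderiv ℝ (fun y => frameMatrix σ a b q p ((extChartAt (𝓡 (2 * m)) x₀).symm y)) u
            (chartField x₀ (σ.frame b j) u) := by
  have hev := eventually_symm_mem ((σ.isOpen_U a).inter (σ.isOpen_U b)) hu ⟨ha, hb⟩
  have h := sum_koszul_frame_change (G := chartMetric g x₀ u)
    (e := fun k => chartField x₀ (σ.frame a k)) (e' := fun k => chartField x₀ (σ.frame b k))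
    (A := fun l k y => frameMatrix σ a b l k ((extChartAt (𝓡 (2 * m)) x₀).symm y))
    (chartField_frame_orthonormal a hu ha) ?_
    (fun l => (contDiffAt_chartField hu (frame_contMDiffAt σ a ha l)).differentiableAt (by simp))
    (fun l k => differentiableAt_comp_symm hu
      ((frameMatrix_contMDiffAt σ a b ha hb l k).mdifferentiableAt (by simp))) ?_
    (frameMatrix_orthogonal' σ a b ha hb) j p q
  · simp only [leviCivitaCoeff_eq_koszul b hu hb, leviCivitaCoeff_eq_koszul a hu ha]
    rw [h]
    congr 1
    simp only [Finset.mul_sum]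
    rw [Finset.sum_comm]
    refine Finset.sum_congr rfl fun l _ => Finset.sum_congr rfl fun k _ => ?_
    ring
  · intro k
    filter_upwards [hev] with y hy
    refine chartDeriv_injective hy.1 ?_
    rw [chartDeriv_chartField hy.1, map_sum, frame_eq_sum σ a b hy.2.1 k]
    refine Finset.sum_congr rfl fun l _ => ?_
    rw [map_smul, chartDeriv_chartField hy.1]
  · intro k r
    filter_upwards [hev] with y hy
    exact frameMatrix_orthogonal σ a b hy.2.1 hy.2.2 k r

end Frames

/-! ### Frame independence of the Dirac operator -/

section Bundle

variable {m : ℕ} {X : Type*} [TopologicalSpace X] [ChartedSpace (Model m) X]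
  [IsManifold (𝓡 (2 * m)) ∞ X] {g : Metric m X}
  {S : Type*} [NormedAddCommGroup S] [InnerProductSpace ℂ S] [FiniteDimensional ℂ S]
  {W : Type*} [NormedAddCommGroup W] [InnerProductSpace ℂ W] [FiniteDimensional ℂ W]
  {ι κ : Type*} {Δ : SpinorModule m S} {σ : SpinStructure g ι} {E : FlatHermitianBundle X W κ}

/-- The domain of the local frames with index `i`. -/
abbrev domain (σ : SpinStructure g ι) (E : FlatHermitianBundle X W κ) (i : ι × κ) : Set X :=
  σ.U i.1 ∩ E.V i.2

theorem isOpen_domain (σ : SpinStructure g ι) (E : FlatHermitianBundle X W κ) (i : ι × κ) :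
    IsOpen (domain σ E i) :=
  (σ.isOpen_U i.1).inter (E.isOpen_V i.2)

/-- The change of frames `ρ(g_{ji}) ⊗ h_{ji}` from the frames with index `i` to those with
index `j`. -/
def changeOp (Δ : SpinorModule m S) (σ : SpinStructure g ι) (E : FlatHermitianBundle X W κ)
    (j i : ι × κ) (x : X) : Fibre S W →ₗ[ℂ] Fibre S W :=
  tensorAction Δ (σ.trans j.1 i.1 x) ((E.trans j.2 i.2 x).toLinearEquiv : W →ₗ[ℂ] W)

theorem loc_change (ψ : SpinorField Δ σ E) {i j : ι × κ} {x : X} (hi : x ∈ domain σ E i)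
    (hj : x ∈ domain σ E j) : ψ.loc j x = changeOp Δ σ E j i x (ψ.loc i x) :=
  ((twistedSpinorBundle Δ σ E).coordChange_comp _ i j x
    ⟨⟨(twistedSpinorBundle Δ σ E).mem_baseSet_at x, hi⟩, hj⟩ _).symm

theorem loc_indexAt (ψ : SpinorField Δ σ E) (x : X) :
    ψ.loc ((twistedSpinorBundle Δ σ E).indexAt x) x = ψ.val x :=
  (twistedSpinorBundle Δ σ E).coordChange_self _ x
    ((twistedSpinorBundle Δ σ E).mem_baseSet_at x) _

theorem changeOp_changeOp {i j : ι × κ} {x : X} (hi : x ∈ domain σ E i)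
    (hj : x ∈ domain σ E j) (v : Fibre S W) :
    changeOp Δ σ E i j x (changeOp Δ σ E j i x v) = v :=
  ((twistedSpinorBundle Δ σ E).coordChange_comp i j i x ⟨⟨hi, hj⟩, hi⟩ v).trans
    ((twistedSpinorBundle Δ σ E).coordChange_self i x hi v)

theorem trans_star_mul_self (σ : SpinStructure g ι) {a b : ι} {x : X} (ha : x ∈ σ.U a)
    (hb : x ∈ σ.U b) : star (σ.trans a b x) * σ.trans a b x = 1 :=
  pinGroup.star_mul_self_of_mem (σ.trans_mem a b x ⟨ha, hb⟩).1

theorem trans_mul_star_self (σ : SpinStructure g ι) {a b : ι} {x : X} (ha : x ∈ σ.U a)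
    (hb : x ∈ σ.U b) : σ.trans a b x * star (σ.trans a b x) = 1 :=
  pinGroup.mul_star_self_of_mem (σ.trans_mem a b x ⟨ha, hb⟩).1

/-- Both tensor factors of the change of frames are unitary. Hence the fibre metric can be computed
in any local frame. -/
theorem inner_changeOp {i j : ι × κ} {x : X} (hi : x ∈ domain σ E i)
    (hj : x ∈ domain σ E j) (v w : Fibre S W) :
    inner ℂ (changeOp Δ σ E j i x v) (changeOp Δ σ E j i x w) = inner ℂ v w := by
  have hu : LinearMap.adjoint ((E.trans j.2 i.2 x).toLinearEquiv : W →ₗ[ℂ] W)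
      ∘ₗ ((E.trans j.2 i.2 x).toLinearEquiv : W →ₗ[ℂ] W) = LinearMap.id := by
    ext w
    refine ext_inner_left ℂ fun z => ?_
    rw [LinearMap.comp_apply, LinearMap.adjoint_inner_right]
    exact (E.trans j.2 i.2 x).inner_map_map z w
  unfold changeOp
  rw [inner_tensorAction, ← tensorAction_mul, hu, trans_star_mul_self σ hj.1 hi.1]
  have : cl Δ W (1 : Cl m) w = w := by rw [cl_one]; rfl
  exact congrArg _ this

instance memTrivializationAtlas_localTriv (i : ι × κ) :
    MemTrivializationAtlas ((twistedSpinorBundle Δ σ E).localTriv i) :=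
  ⟨Set.mem_range_self i⟩

theorem isSmooth_iff (ψ : SpinorField Δ σ E) :
    ψ.IsSmooth ↔ ∀ i, ContMDiffOn (𝓡 (2 * m)) 𝓘(ℝ, Fibre S W) ∞ (ψ.loc i) (domain σ E i) := by
  constructor
  · intro h i
    exact (((twistedSpinorBundle Δ σ E).localTriv i).contMDiffOn_section_baseSet_iff).1
      h.contMDiffOn
  · intro h x
    have h1 := (((twistedSpinorBundle Δ σ E).localTriv
      ((twistedSpinorBundle Δ σ E).indexAt x)).contMDiffOn_section_baseSet_iff (IB := 𝓡 (2 * m))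
        (n := ∞) (s := ψ)).2 (h _)
    exact h1.contMDiffAt ((isOpen_domain σ E _).mem_nhds
      ((twistedSpinorBundle Δ σ E).mem_baseSet_at x))

theorem loc_contMDiffAt {ψ : SpinorField Δ σ E} (hψ : ψ.IsSmooth) {i : ι × κ} {x : X}
    (hi : x ∈ domain σ E i) : ContMDiffAt (𝓡 (2 * m)) 𝓘(ℝ, Fibre S W) ∞ (ψ.loc i) x :=
  ((isSmooth_iff ψ).1 hψ i).contMDiffAt ((isOpen_domain σ E i).mem_nhds hi)

theorem loc_mdifferentiableAt {ψ : SpinorField Δ σ E} (hψ : ψ.IsSmooth) {i : ι × κ} {x : X}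
    (hi : x ∈ domain σ E i) : MDifferentiableAt (𝓡 (2 * m)) 𝓘(ℝ, Fibre S W) (ψ.loc i) x :=
  (loc_contMDiffAt hψ hi).mdifferentiableAt (by simp)

theorem changeOp_cl_gen {i j : ι × κ} {x : X} (hi : x ∈ domain σ E i)
    (hj : x ∈ domain σ E j) (k : Fin (2 * m)) (v : Fibre S W) :
    changeOp Δ σ E j i x (cl Δ W (gen m k) v)
      = ∑ l, (frameMatrix σ j.1 i.1 l k x : ℂ) • cl Δ W (gen m l) (changeOp Δ σ E j i x v) := by
  have h1 : changeOp Δ σ E j i x (cl Δ W (gen m k) v)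
      = cl Δ W (∑ l, frameMatrix σ j.1 i.1 l k x • gen m l) (changeOp Δ σ E j i x v) := by
    unfold changeOp cl
    rw [← tensorAction_mul, ← tensorAction_mul, LinearMap.comp_id, LinearMap.id_comp]
    exact congrArg (fun a => tensorAction Δ a _ v) (σ.trans_frame j.1 i.1 x ⟨hj.1, hi.1⟩ k)
  rw [h1, cl_sum, LinearMap.sum_apply]
  refine Finset.sum_congr rfl fun l _ => ?_
  rw [cl_smul, LinearMap.smul_apply]

/-- Differentiating the change of frames produces a derivative of the spin lift, which the
inhomogeneous term of the connection absorbs. The remaining matrix only expresses the direction in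
the new frame. -/
theorem covDeriv_change {ψ : SpinorField Δ σ E} (hψ : ψ.IsSmooth) {i j : ι × κ} {x : X}
    (hi : x ∈ domain σ E i) (hj : x ∈ domain σ E j) (k : Fin (2 * m)) :
    changeOp Δ σ E j i x (ψ.covDeriv i x k)
      = ∑ q, (frameMatrix σ j.1 i.1 q k x : ℂ) • ψ.covDeriv j x q := by
  obtain ⟨x₀, u, hu, rfl⟩ : ∃ x₀ : X, ∃ u, u ∈ (extChartAt (𝓡 (2 * m)) x₀).target ∧
      (extChartAt (𝓡 (2 * m)) x₀).symm u = x :=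
    ⟨x, extChartAt (𝓡 (2 * m)) x x, mem_extChartAt_target x, extChartAt_to_inv x⟩
  set x := (extChartAt (𝓡 (2 * m)) x₀).symm u with hx
  set T : W →ₗ[ℂ] W := ((E.trans j.2 i.2 x).toLinearEquiv : W →ₗ[ℂ] W) with hT
  set s : Model m → Cl m := fun y => σ.trans j.1 i.1 ((extChartAt (𝓡 (2 * m)) x₀).symm y) with hs
  set v : Model m := chartField x₀ (σ.frame i.1 k) u with hv
  have hev := eventually_symm_mem ((isOpen_domain σ E i).inter (isOpen_domain σ E j)) hu ⟨hi, hj⟩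
  have hsd : ∀ f : Cl m →ₗ[ℝ] ℝ, DifferentiableAt ℝ (fun y => f (s y)) u := by
    intro f
    have := (σ.trans_smooth j.1 i.1 f).contMDiffAt
      (((σ.isOpen_U _).inter (σ.isOpen_U _)).mem_nhds ⟨hj.1, hi.1⟩)
    exact differentiableAt_comp_symm hu (this.mdifferentiableAt (by simp))
  -- the derivative of the section in the new frame
  have hloc : fderiv ℝ (fun y => ψ.loc j ((extChartAt (𝓡 (2 * m)) x₀).symm y)) u v
      = tensorAction Δ (clDeriv s u v) T (ψ.loc i x)
        + tensorAction Δ (s u) T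
          (fderiv ℝ (fun y => ψ.loc i ((extChartAt (𝓡 (2 * m)) x₀).symm y)) u v) := by
    have h1 : (fun y => ψ.loc j ((extChartAt (𝓡 (2 * m)) x₀).symm y))
        =ᶠ[𝓝 u] fun y => tensorActionLin Δ T (s y)
          (ψ.loc i ((extChartAt (𝓡 (2 * m)) x₀).symm y)) := by
      -- Flatness enters here: the transition function of `E` is constant near the point, so only
      -- the spin factor is differentiated.
      have h2 := (contMDiffAt_symm hu).continuousAt.eventually
        (E.trans_locConst j.2 i.2 x ⟨hj.2, hi.2⟩)
      filter_upwards [hev, h2] with y hy hy2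
      rw [loc_change ψ hy.2.1 hy.2.2]
      unfold changeOp
      rw [hy2]
      rfl
    have h3 := hasFDerivAt_linear hsd (tensorActionLin Δ T)
    have h4 := differentiableAt_comp_symm hu (loc_mdifferentiableAt hψ hi)
    rw [h1.fderiv_eq, fderiv_clm_apply h3.1 h4]
    simp only [add_apply, ContinuousLinearMap.comp_apply, ContinuousLinearMap.flip_apply, h3.2]
    rw [add_comm]
    rfl
  -- the connection in the new frame
  have hconn : Δ.c (s u * spinElement m (fun p q => leviCivitaCoeff σ i.1 x k p q))
      = Δ.c (spinElement m (fun p q => ∑ r, frameMatrix σ j.1 i.1 r k x *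
          leviCivitaCoeff σ j.1 x r p q) * s u + clDeriv s u v) := by
    refine spin_connection_change Δ (trans_star_mul_self σ hj.1 hi.1)
      (trans_mul_star_self σ hj.1 hi.1) (A := fun l p => frameMatrix σ j.1 i.1 l p x)
      (dA := fun l p => fderiv ℝ (fun y => frameMatrix σ j.1 i.1 l p
        ((extChartAt (𝓡 (2 * m)) x₀).symm y)) u v) ?_ ?_ ?_ ?_ ?_ ?_
    · intro p q
      rw [← Finset.sum_neg_distrib]
      refine Finset.sum_congr rfl fun r _ => ?_
      rw [leviCivitaCoeff_antisymm, mul_neg]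
    · exact fun p q => leviCivitaCoeff_antisymm _ _ _ _ _
    · exact fun p => σ.trans_frame j.1 i.1 x ⟨hj.1, hi.1⟩ p
    · refine fun p => clDeriv_mul_gen hsd
        (A := fun l p y => frameMatrix σ j.1 i.1 l p ((extChartAt (𝓡 (2 * m)) x₀).symm y))
        (fun l k => differentiableAt_comp_symm hu
          ((frameMatrix_contMDiffAt σ j.1 i.1 hj.1 hi.1 l k).mdifferentiableAt (by simp)))
        (fun p => ?_) p v
      filter_upwards [hev] with y hy
      exact σ.trans_frame j.1 i.1 _ ⟨hy.2.2.1, hy.2.1.1⟩ p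
    · exact fun p q => sum_leviCivitaCoeff_change j.1 i.1 hu hj.1 hi.1 k p q
    · refine spinTrace_star_mul_clDeriv Δ hsd ?_ (trans_mul_star_self σ hj.1 hi.1) v
      filter_upwards [hev] with y hy
      exact trans_star_mul_self σ hy.2.2.1 hy.2.1.1
  have hconn' : tensorAction Δ (s u * spinElement m (fun p q => leviCivitaCoeff σ i.1 x k p q)) T
      = tensorAction Δ (spinElement m (fun p q => ∑ r, frameMatrix σ j.1 i.1 r k x *
          leviCivitaCoeff σ j.1 x r p q) * s u + clDeriv s u v) T := by
    unfold tensorAction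
    rw [hconn]
  -- The connection element is linear in the direction of differentiation.
  have hspin : spinElement m (fun p q => ∑ r, frameMatrix σ j.1 i.1 r k x *
          leviCivitaCoeff σ j.1 x r p q)
      = ∑ r, frameMatrix σ j.1 i.1 r k x •
          spinElement m (fun p q => leviCivitaCoeff σ j.1 x r p q) := by
    have h1 : ∀ r, frameMatrix σ j.1 i.1 r k x •
          spinElement m (fun p q => leviCivitaCoeff σ j.1 x r p q)
        = (1 / 4 : ℝ) • ∑ p, ∑ q, (frameMatrix σ j.1 i.1 r k x * leviCivitaCoeff σ j.1 x r p q) •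
            (gen m p * gen m q) := by
      intro r
      rw [spinElement, smul_comm]
      simp only [Finset.smul_sum, smul_smul]
    rw [Finset.sum_congr rfl fun r _ => h1 r, ← Finset.smul_sum, spinElement]
    congr 1
    simp only [Finset.sum_smul]
    conv_rhs => rw [Finset.sum_comm]
    refine Finset.sum_congr rfl fun p _ => ?_
    conv_rhs => rw [Finset.sum_comm]
  have hcov : ∀ (i' : ι × κ) (r : Fin (2 * m)), ψ.covDeriv i' x r
      = mvfderiv (𝓡 (2 * m)) (ψ.loc i') x (σ.frame i'.1 r x)
        + cl Δ W (spinElement m (fun p q => leviCivitaCoeff σ i'.1 x r p q)) (ψ.loc i' x) :=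
    fun _ _ => rfl
  have hdi : mvfderiv (𝓡 (2 * m)) (ψ.loc i) x (σ.frame i.1 k x)
      = fderiv ℝ (fun y => ψ.loc i ((extChartAt (𝓡 (2 * m)) x₀).symm y)) u v :=
    mvfderiv_vectorField hu (loc_mdifferentiableAt hψ hi) _
  have hdj : mvfderiv (𝓡 (2 * m)) (ψ.loc j) x (σ.frame i.1 k x)
      = fderiv ℝ (fun y => ψ.loc j ((extChartAt (𝓡 (2 * m)) x₀).symm y)) u v :=
    mvfderiv_vectorField hu (loc_mdifferentiableAt hψ hj) _
  have hop : changeOp Δ σ E j i x = tensorAction Δ (s u) T := rfl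
  have hcl : ∀ a z, tensorAction Δ (s u) T (cl Δ W a z) = tensorAction Δ (s u * a) T z := by
    intro a z
    rw [cl, ← tensorAction_mul, LinearMap.comp_id]
  have hcl' : ∀ a z, cl Δ W a (tensorAction Δ (s u) T z) = tensorAction Δ (a * s u) T z := by
    intro a z
    rw [cl, ← tensorAction_mul, LinearMap.id_comp]
  have hmain : changeOp Δ σ E j i x (ψ.covDeriv i x k)
      = mvfderiv (𝓡 (2 * m)) (ψ.loc j) x (σ.frame i.1 k x)
        + cl Δ W (∑ r, frameMatrix σ j.1 i.1 r k x •
          spinElement m (fun p q => leviCivitaCoeff σ j.1 x r p q)) (ψ.loc j x) := by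
    rw [hcov, hdi, hdj, hloc, hop, map_add, hcl, hconn', tensorAction_add_left,
      LinearMap.add_apply, ← hcl', hspin, loc_change ψ hi hj, hop]
    abel
  rw [hmain, frame_eq_sum σ j.1 i.1 hj.1 k, map_sum, cl_sum, LinearMap.sum_apply,
    ← Finset.sum_add_distrib]
  refine Finset.sum_congr rfl fun q _ => ?_
  rw [hcov, map_smul, cl_smul, smul_add, Complex.coe_smul, LinearMap.smul_apply, Complex.coe_smul,
    Complex.coe_smul]

/-- The Dirac operator in the local frames with index `i`. -/
def diracLoc (ψ : SpinorField Δ σ E) (i : ι × κ) (x : X) : Fibre S W :=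
  ∑ k, cl Δ W (gen m k) (ψ.covDeriv i x k)

/-- Clifford multiplication and covariant derivative each bring one factor of the transition matrix,
and orthogonality contracts the two to the identity. -/
theorem diracLoc_change {ψ : SpinorField Δ σ E} (hψ : ψ.IsSmooth) {i j : ι × κ} {x : X}
    (hi : x ∈ domain σ E i) (hj : x ∈ domain σ E j) :
    changeOp Δ σ E j i x (diracLoc ψ i x) = diracLoc ψ j x := by
  unfold diracLoc
  simp only [map_sum, changeOp_cl_gen hi hj, covDeriv_change hψ hi hj, map_smul]
  have h : ∀ l, cl Δ W (gen m l) (ψ.covDeriv j x l) = ∑ q, ∑ k,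
      ((frameMatrix σ j.1 i.1 l k x * frameMatrix σ j.1 i.1 q k x : ℝ) : ℂ) •
        cl Δ W (gen m l) (ψ.covDeriv j x q) := by
    intro l
    simp only [← Finset.sum_smul, ← Complex.ofReal_sum,
      frameMatrix_orthogonal' σ j.1 i.1 hj.1 hi.1]
    simp
  rw [Finset.sum_comm]
  refine Finset.sum_congr rfl fun l _ => ?_
  rw [h l, Finset.sum_comm]
  refine Finset.sum_congr rfl fun k _ => ?_
  rw [Finset.smul_sum]
  refine Finset.sum_congr rfl fun q _ => ?_
  rw [smul_smul, Complex.ofReal_mul]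

theorem dirac_val (ψ : SpinorField Δ σ E) (x : X) :
    (dirac ψ).val x = diracLoc ψ ((twistedSpinorBundle Δ σ E).indexAt x) x := rfl

/-- The Dirac operator does not depend on the local frames. -/
theorem dirac_loc {ψ : SpinorField Δ σ E} (hψ : ψ.IsSmooth) {i : ι × κ} {x : X}
    (hi : x ∈ domain σ E i) : (dirac ψ).loc i x = diracLoc ψ i x :=
  diracLoc_change hψ ((twistedSpinorBundle Δ σ E).mem_baseSet_at x) hi

end Bundle

/-! ### Clifford multiplication by forms, the grading, and local sections -/

section Bundle

variable {m : ℕ} {X : Type*} [TopologicalSpace X] [ChartedSpace (Model m) X]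
  [IsManifold (𝓡 (2 * m)) ∞ X] {g : Metric m X}
  {S : Type*} [NormedAddCommGroup S] [InnerProductSpace ℂ S] [FiniteDimensional ℂ S]
  {W : Type*} [NormedAddCommGroup W] [InnerProductSpace ℂ W] [FiniteDimensional ℂ W]
  {ι κ : Type*} {Δ : SpinorModule m S} {σ : SpinStructure g ι} {E : FlatHermitianBundle X W κ}

/-- The coefficients of a differential form in the local frame with index `a`. -/
def formCoeff (σ : SpinStructure g ι) (H : ∀ j, DifferentialForm m X ℂ j) (a : ι) (x : X) (j : ℕ)
    (f : Fin j → Fin (2 * m)) : ℂ :=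
  (H j).toFun x (fun p => σ.frame a (f p) x)

/-- Clifford multiplication by a differential form in the local frame with index `a`. -/
def formLoc (Δ : SpinorModule m S) (W : Type*) [NormedAddCommGroup W] [InnerProductSpace ℂ W]
    (σ : SpinStructure g ι) (H : ∀ j, DifferentialForm m X ℂ j) (a : ι) (x : X) :
    Module.End ℂ (Fibre S W) :=
  ∑ j ∈ Finset.range (2 * m + 1), cliffordSum Δ W (formCoeff σ H a x j)

theorem cliffordMul_eq {j : ℕ} (x : X) (α : TangentSpace (𝓡 (2 * m)) x [⋀^Fin j]→L[ℝ] ℂ) :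
    cliffordMul Δ σ E x α = cliffordSum Δ W (fun f =>
      α (fun p => σ.frame ((twistedSpinorBundle Δ σ E).indexAt x).1 (f p) x)) := rfl

theorem twistedDirac_val (H : ∀ j, DifferentialForm m X ℂ j) (ψ : SpinorField Δ σ E) (x : X) :
    (twistedDirac H ψ).val x = (dirac ψ).val x
      + formLoc Δ W σ H ((twistedSpinorBundle Δ σ E).indexAt x).1 x (ψ.val x) := by
  rw [formLoc, LinearMap.sum_apply]
  rfl

theorem changeOp_formLoc (H : ∀ j, DifferentialForm m X ℂ j) {i j : ι × κ} {x : X}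
    (hi : x ∈ domain σ E i) (hj : x ∈ domain σ E j) (v : Fibre S W) :
    changeOp Δ σ E j i x (formLoc Δ W σ H i.1 x v)
      = formLoc Δ W σ H j.1 x (changeOp Δ σ E j i x v) := by
  unfold formLoc
  rw [LinearMap.sum_apply, map_sum, LinearMap.sum_apply]
  refine Finset.sum_congr rfl fun k _ => ?_
  refine cliffordSum_conj Δ ((H k).toFun x) (fun l => σ.frame j.1 l x) (fun l => σ.frame i.1 l x)
    (fun l p => frameMatrix σ j.1 i.1 l p x) (fun l => ?_) _
    (fun p => σ.trans_frame j.1 i.1 x ⟨hj.1, hi.1⟩ p) _ v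
  rw [frame_eq_sum σ i.1 j.1 hi.1 l]
  simp only [frameMatrix_symm σ j.1 i.1]

theorem formCoeff_contMDiffOn (σ : SpinStructure g ι) (H : ∀ j, DifferentialForm m X ℂ j) (a : ι)
    (j : ℕ) (f : Fin j → Fin (2 * m)) :
    ContMDiffOn (𝓡 (2 * m)) 𝓘(ℝ, ℂ) ∞ (fun x => formCoeff σ H a x j f) (σ.U a) :=
  (H j).smooth (σ.U a) (σ.isOpen_U a) _ fun p => σ.frame_smooth a (f p)

theorem formLoc_continuousOn (H : ∀ j, DifferentialForm m X ℂ j) (a : ι) {U : Set X}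
    (hU : U ⊆ σ.U a) {w : X → Fibre S W} (hw : ContinuousOn w U) :
    ContinuousOn (fun x => formLoc Δ W σ H a x (w x)) U := by
  simp only [formLoc, cliffordSum, LinearMap.sum_apply, LinearMap.smul_apply]
  refine continuousOn_finsetSum _ fun j _ => continuousOn_finsetSum _ fun f _ => ?_
  exact ((formCoeff_contMDiffOn σ H a j f).continuousOn.mono hU).smul
    ((LinearMap.continuous_of_finiteDimensional _).comp_continuousOn hw)

/-! The grading. -/

/-- The volume element `e_1 ⋯ e_{2m}`. -/
def volElement (m : ℕ) : Cl m := (List.ofFn (gen m)).prod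

theorem volElement_eq (m : ℕ) :
    volElement m = ((List.finRange (2 * m)).map (gen m)).prod := by
  rw [volElement, List.ofFn_eq_map]

theorem gen_mul_volElement (m : ℕ) (k : Fin (2 * m)) :
    gen m k * volElement m = -(volElement m * gen m k) := by
  rw [volElement_eq, (gen_isCliffordFamily m).mul_prod, List.length_finRange,
    List.count_eq_one_of_mem (List.nodup_finRange _) (List.mem_finRange k),
    (Even.add_one (even_two_mul m)).neg_one_pow, neg_one_mul]

/-- In even dimension each generator anticommutes with the volume element; extend multiplicatively.
-/
theorem mul_volElement {m : ℕ} (a : Cl m) :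
    a * volElement m = volElement m * CliffordAlgebra.involute a := by
  induction a using CliffordAlgebra.induction with
  | algebraMap r => rw [AlgHom.commutes, Algebra.commutes]
  | ι v =>
    rw [CliffordAlgebra.involute_ι, ι_eq_sum_gen, Finset.sum_mul, mul_neg, Finset.mul_sum,
      ← Finset.sum_neg_distrib]
    refine Finset.sum_congr rfl fun k _ => ?_
    rw [smul_mul_assoc, mul_smul_comm, gen_mul_volElement, smul_neg]
  | mul a b ha hb => rw [map_mul, mul_assoc, hb, ← mul_assoc, ha, mul_assoc]
  | add a b ha hb => rw [add_mul, ha, hb, map_add, mul_add]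

/-- The action of the grading on the fibre. -/
def gradingOp (Δ : SpinorModule m S) (W : Type*) [NormedAddCommGroup W] [InnerProductSpace ℂ W] :
    Module.End ℂ (Fibre S W) :=
  Complex.I ^ m • cl Δ W (volElement m)

theorem grading_val (ψ : SpinorField Δ σ E) (x : X) :
    (grading ψ).val x = gradingOp Δ W (ψ.val x) := rfl

/-- Elements of the spin group are fixed by the grading involution of the Clifford algebra, so they
commute with the volume element and γ is well defined globally. -/
theorem changeOp_gradingOp {i j : ι × κ} {x : X} (hi : x ∈ domain σ E i)
    (hj : x ∈ domain σ E j) (v : Fibre S W) :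
    changeOp Δ σ E j i x (gradingOp Δ W v) = gradingOp Δ W (changeOp Δ σ E j i x v) := by
  unfold changeOp gradingOp cl
  rw [LinearMap.smul_apply, LinearMap.smul_apply, map_smul, ← tensorAction_mul, ← tensorAction_mul,
    LinearMap.comp_id, LinearMap.id_comp, mul_volElement,
    spinGroup.involute_eq (σ.trans_mem j.1 i.1 x ⟨hj.1, hi.1⟩)]

theorem grading_loc (ψ : SpinorField Δ σ E) {i : ι × κ} {x : X} (hi : x ∈ domain σ E i) :
    (grading ψ).loc i x = gradingOp Δ W (ψ.loc i x) :=
  changeOp_gradingOp ((twistedSpinorBundle Δ σ E).mem_baseSet_at x) hi _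

theorem gradingOp_cl_gen (Δ : SpinorModule m S) (k : Fin (2 * m)) :
    cl Δ W (gen m k) * gradingOp Δ W = -(gradingOp Δ W * cl Δ W (gen m k)) := by
  rw [gradingOp, mul_smul_comm, smul_mul_assoc, ← cl_mul, ← cl_mul, gen_mul_volElement, cl_neg,
    smul_neg]

theorem gradingOp_cl_list (Δ : SpinorModule m S) (l : List (Fin (2 * m))) :
    cl Δ W (l.map (gen m)).prod * gradingOp Δ W
      = (-1 : ℂ) ^ l.length • (gradingOp Δ W * cl Δ W (l.map (gen m)).prod) := by
  induction l with
  | nil => simp [cl_one]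
  | cons a l ih =>
    rw [List.map_cons, List.prod_cons, cl_mul, mul_assoc, ih, mul_smul_comm, ← mul_assoc,
      gradingOp_cl_gen, List.length_cons, pow_succ, mul_neg_one, neg_smul, neg_mul, smul_neg,
      mul_assoc]

theorem gradingOp_cliffordSum (Δ : SpinorModule m S) {j : ℕ} (β : (Fin j → Fin (2 * m)) → ℂ) :
    cliffordSum Δ W β * gradingOp Δ W
      = (-1 : ℂ) ^ j • (gradingOp Δ W * cliffordSum Δ W β) := by
  simp only [cliffordSum, Finset.sum_mul, Finset.mul_sum, Finset.smul_sum, smul_mul_assoc,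
    mul_smul_comm]
  refine Finset.sum_congr rfl fun f _ => ?_
  rw [ofFn_gen, gradingOp_cl_list, List.length_ofFn, smul_comm]

/-- The reversed volume element is an inverse of the volume element, the sign being `(-1) ^ (2 * m)
= 1`. -/
theorem gradingOp_injective (Δ : SpinorModule m S) : Function.Injective (gradingOp Δ W) := by
  have h := (gen_isCliffordFamily m).reverse_prod_mul_prod (List.finRange (2 * m))
  rw [← volElement_eq, List.length_finRange, (even_two_mul m).neg_one_pow] at h
  have h2 := congrArg (cl Δ W) h
  rw [cl_mul, cl_one] at h2
  intro v w hvw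
  have h3 : cl Δ W (volElement m) v = cl Δ W (volElement m) w :=
    smul_right_injective _ (pow_ne_zero m Complex.I_ne_zero) hvw
  have h4 := fun v => congrArg (fun A : Module.End ℂ (Fibre S W) => A v) h2
  simp only [Module.End.mul_apply, Module.End.one_apply] at h4
  rw [← h4 v, ← h4 w, h3]

theorem mvfderiv_linear {F F' : Type*} [NormedAddCommGroup F] [NormedSpace ℝ F]
    [NormedAddCommGroup F'] [NormedSpace ℝ F'] (L : F →L[ℝ] F') {f : X → F} {x : X}
    (hf : MDifferentiableAt (𝓡 (2 * m)) 𝓘(ℝ, F) f x) (v : TangentSpace (𝓡 (2 * m)) x) :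
    mvfderiv (𝓡 (2 * m)) (fun y => L (f y)) x v = L (mvfderiv (𝓡 (2 * m)) f x v) := by
  have h := mfderiv_comp_apply (I := 𝓡 (2 * m)) (I' := 𝓘(ℝ, F)) (I'' := 𝓘(ℝ, F')) x
    (L.differentiableAt.mdifferentiableAt (x := f x)) hf v
  rw [mfderiv_eq_fderiv, ContinuousLinearMap.fderiv] at h
  exact h

/-- A complex linear operator on the fibre as a continuous real linear operator. -/
def realOp (A : Module.End ℂ (Fibre S W)) : Fibre S W →L[ℝ] Fibre S W :=
  (LinearMap.toContinuousLinearMap A).restrictScalars ℝ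

theorem realOp_apply (A : Module.End ℂ (Fibre S W)) (v : Fibre S W) : realOp A v = A v := rfl

/-- In a local frame γ is a constant matrix and commutes with the connection, so the only sign comes
from the outer Clifford multiplication. -/
theorem diracLoc_grading {ψ : SpinorField Δ σ E} (hψ : ψ.IsSmooth) {i : ι × κ} {x : X}
    (hi : x ∈ domain σ E i) : diracLoc (grading ψ) i x = -gradingOp Δ W (diracLoc ψ i x) := by
  have hev : (grading ψ).loc i =ᶠ[𝓝 x] fun y => realOp (gradingOp Δ W) (ψ.loc i y) := by
    filter_upwards [(isOpen_domain σ E i).eventually_mem hi] with y hy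
    exact grading_loc ψ hy
  have hcov : ∀ k, (grading ψ).covDeriv i x k = gradingOp Δ W (ψ.covDeriv i x k) := by
    intro k
    have h1 : mvfderiv (𝓡 (2 * m)) ((grading ψ).loc i) x (σ.frame i.1 k x)
        = gradingOp Δ W (mvfderiv (𝓡 (2 * m)) (ψ.loc i) x (σ.frame i.1 k x)) := by
      have h2 : mvfderiv (𝓡 (2 * m)) ((grading ψ).loc i) x
          = mvfderiv (𝓡 (2 * m)) (fun y => realOp (gradingOp Δ W) (ψ.loc i y)) x := by
        have h3 := hev.mfderiv_eq (I := 𝓡 (2 * m)) (I' := 𝓘(ℝ, Fibre S W))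
        exact h3
      rw [h2, mvfderiv_linear _ (loc_mdifferentiableAt hψ hi), realOp_apply]
    -- The connection is quadratic in the generators, so two signs cancel.
    have h2 : ∀ θ, cl Δ W (spinElement m θ) * gradingOp Δ W
        = gradingOp Δ W * cl Δ W (spinElement m θ) := by
      intro θ
      unfold spinElement
      simp only [cl_smul, cl_sum, cl_mul, smul_mul_assoc, mul_smul_comm, Finset.sum_mul,
        Finset.mul_sum]
      congr 1
      refine Finset.sum_congr rfl fun k _ => Finset.sum_congr rfl fun l _ => ?_
      rw [mul_assoc, gradingOp_cl_gen, mul_neg, ← mul_assoc, gradingOp_cl_gen, neg_mul, neg_neg,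
        mul_assoc]
    have h3 := fun θ v => congrArg (fun A : Module.End ℂ (Fibre S W) => A v) (h2 θ)
    simp only [Module.End.mul_apply] at h3
    change mvfderiv (𝓡 (2 * m)) ((grading ψ).loc i) x (σ.frame i.1 k x)
        + cl Δ W (spinElement m (fun p q => leviCivitaCoeff σ i.1 x k p q)) ((grading ψ).loc i x)
      = gradingOp Δ W (mvfderiv (𝓡 (2 * m)) (ψ.loc i) x (σ.frame i.1 k x)
        + cl Δ W (spinElement m (fun p q => leviCivitaCoeff σ i.1 x k p q)) (ψ.loc i x))
    rw [h1, grading_loc ψ hi, h3, map_add]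
  have h4 := fun k v => congrArg (fun A : Module.End ℂ (Fibre S W) => A v)
    (gradingOp_cl_gen (W := W) Δ k)
  simp only [Module.End.mul_apply, LinearMap.neg_apply] at h4
  unfold diracLoc
  rw [map_sum, ← Finset.sum_neg_distrib]
  refine Finset.sum_congr rfl fun k _ => ?_
  rw [hcov, h4]

/-! Sections supported in the domain of a local frame. -/

/-- The section which is `f • s` in the local frames with index `i`, for a function `f` which is
supported in their domain. -/
def localSection (Δ : SpinorModule m S) (σ : SpinStructure g ι) (E : FlatHermitianBundle X W κ)
    (i : ι × κ) (f : X → ℝ) (s : Fibre S W) : SpinorField Δ σ E := fun x =>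
  f x • (changeOp Δ σ E ((twistedSpinorBundle Δ σ E).indexAt x) i x s : Fibre S W)

theorem localSection_val (i : ι × κ) (f : X → ℝ) (s : Fibre S W) (x : X) :
    (localSection Δ σ E i f s).val x
      = f x • changeOp Δ σ E ((twistedSpinorBundle Δ σ E).indexAt x) i x s := rfl

theorem localSection_loc (i : ι × κ) (f : X → ℝ) (s : Fibre S W) {x : X}
    (hi : x ∈ domain σ E i) : (localSection Δ σ E i f s).loc i x = f x • s := by
  change changeOp Δ σ E i ((twistedSpinorBundle Δ σ E).indexAt x) x
    (f x • changeOp Δ σ E ((twistedSpinorBundle Δ σ E).indexAt x) i x s) = f x • s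
  rw [← Complex.coe_smul, map_smul,
    changeOp_changeOp hi ((twistedSpinorBundle Δ σ E).mem_baseSet_at x), Complex.coe_smul]

theorem smul_isSmooth_of_tsupport {ψ : SpinorField Δ σ E} {f : X → ℝ} {U : Set X} (hU : IsOpen U)
    (hf : ContMDiff (𝓡 (2 * m)) 𝓘(ℝ, ℝ) ∞ f) (hfU : tsupport f ⊆ U)
    (hψ : ContMDiffOn (𝓡 (2 * m)) ((𝓡 (2 * m)).prod 𝓘(ℝ, Fibre S W)) ∞
      (fun x => (⟨x, ψ x⟩ : TotalSpace (Fibre S W) (twistedSpinorBundle Δ σ E).Fiber)) U) :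
    SpinorField.IsSmooth (f • ψ : SpinorField Δ σ E) :=
  ContMDiffOn.smul_section_of_tsupport hf.contMDiffOn hU hfU hψ

theorem localSection_isSmooth (i : ι × κ) {f : X → ℝ} (hf : ContMDiff (𝓡 (2 * m)) 𝓘(ℝ, ℝ) ∞ f)
    (hfi : tsupport f ⊆ domain σ E i) (s : Fibre S W) :
    (localSection Δ σ E i f s).IsSmooth := by
  -- The section with constant function 1 is smooth over the domain, and `f` is supported there; so
  -- the product extends smoothly by zero.
  have h1 : localSection Δ σ E i f s = (f • localSection Δ σ E i (fun _ => 1) s :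
      SpinorField Δ σ E) := by
    funext x
    exact (congrArg (fun v : Fibre S W => f x • v) (one_smul ℝ
      (changeOp Δ σ E ((twistedSpinorBundle Δ σ E).indexAt x) i x s))).symm
  rw [h1]
  refine smul_isSmooth_of_tsupport (isOpen_domain σ E i) hf hfi ?_
  refine (((twistedSpinorBundle Δ σ E).localTriv i).contMDiffOn_section_baseSet_iff).2 ?_
  refine (contMDiffOn_const (c := s)).congr fun x hx => ?_
  exact (localSection_loc i (fun _ => 1) s hx).trans (one_smul _ _)

theorem isCompactlySupported_of_subset [T2Space X] {ψ : SpinorField Δ σ E} {K : Set X}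
    (hK : IsCompact K) (h : ∀ x, x ∉ K → ψ x = 0) : ψ.IsCompactlySupported := by
  refine hK.of_isClosed_subset isClosed_closure (closure_minimal ?_ hK.isClosed)
  intro x hx
  by_contra hcon
  exact hx (h x hcon)

theorem localSection_isCompactlySupported [T2Space X] (i : ι × κ) {f : X → ℝ}
    (hf : HasCompactSupport f) (s : Fibre S W) :
    (localSection Δ σ E i f s).IsCompactlySupported := by
  refine isCompactlySupported_of_subset hf fun x hx => ?_
  have h : (f x • changeOp Δ σ E ((twistedSpinorBundle Δ σ E).indexAt x) i x s : Fibre S W) = 0 := by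
    rw [image_eq_zero_of_notMem_tsupport hx, zero_smul]
  exact h

theorem exists_bump [T2Space X] {U : Set X} (hU : IsOpen U) {x : X} (hx : x ∈ U) :
    ∃ f : X → ℝ, ContMDiff (𝓡 (2 * m)) 𝓘(ℝ, ℝ) ∞ f ∧ HasCompactSupport f ∧ tsupport f ⊆ U ∧
      f x = 1 := by
  obtain ⟨f, hf⟩ := ((SmoothBumpFunction.nhds_basis_tsupport (I := 𝓡 (2 * m)) x).mem_iff).1
    (hU.mem_nhds hx)
  exact ⟨f, f.contMDiff, f.hasCompactSupport, hf.2, f.eq_one⟩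

end Bundle

/-! ### Odd forms and the adjoint of Clifford multiplication -/

section Bundle

variable {m : ℕ} {X : Type*} [TopologicalSpace X] [ChartedSpace (Model m) X]
  [IsManifold (𝓡 (2 * m)) ∞ X] {g : Metric m X}
  {S : Type*} [NormedAddCommGroup S] [InnerProductSpace ℂ S] [FiniteDimensional ℂ S]
  {W : Type*} [NormedAddCommGroup W] [InnerProductSpace ℂ W] [FiniteDimensional ℂ W]
  {ι κ : Type*} {Δ : SpinorModule m S} {σ : SpinStructure g ι} {E : FlatHermitianBundle X W κ}

theorem form_eq_zero_of_coeff {j : ℕ} {K : Type*} [NormedAddCommGroup K] [NormedSpace ℝ K]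
    (σ : SpinStructure g ι) {a : ι} {x : X} (hx : x ∈ σ.U a)
    (α : TangentSpace (𝓡 (2 * m)) x [⋀^Fin j]→L[ℝ] K)
    (h : ∀ f : Fin j → Fin (2 * m), StrictMono f → α (fun p => σ.frame a (f p) x) = 0) :
    α = 0 := by
  refine alternating_eq_zero_of_strictMono (frameBasis σ a hx) α fun f hf => ?_
  simp only [frameBasis_apply]
  exact h f hf

theorem inner_cliffordMul_ofReal {j : ℕ} (x : X) (α : TangentSpace (𝓡 (2 * m)) x [⋀^Fin j]→L[ℝ] ℝ)
    (s t : Fibre S W) :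
    inner ℂ (cliffordMul Δ σ E x (Complex.ofRealCLM.compContinuousAlternatingMap α) s) t
      = (-1) ^ ((j + 1).choose 2) *
        inner ℂ s (cliffordMul Δ σ E x (Complex.ofRealCLM.compContinuousAlternatingMap α) t) := by
  rw [cliffordMul_eq, inner_cliffordSum, ← inner_smul_right, ← LinearMap.smul_apply,
    ← cliffordSum_smul]
  congr 4
  funext f
  exact congrArg _ (Complex.conj_ofReal _)

theorem inner_cliffordMul_ofReal_neg {j : ℕ} (hj : ¬(j % 4 = 0 ∨ j % 4 = 3)) (x : X)
    (α : TangentSpace (𝓡 (2 * m)) x [⋀^Fin j]→L[ℝ] ℝ) (s t : Fibre S W) :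
    inner ℂ (cliffordMul Δ σ E x (Complex.ofRealCLM.compContinuousAlternatingMap α) s) t
      = -inner ℂ s (cliffordMul Δ σ E x (Complex.ofRealCLM.compContinuousAlternatingMap α) t) := by
  rw [inner_cliffordMul_ofReal, (Nat.not_even_iff_odd.1 ((even_choose_two_iff j).not.2 hj)).neg_one_pow,
    neg_one_mul]

/-- In the other degrees the operator is skew, so being self-adjoint as well would make it zero, and
injectivity would force the form to vanish. -/
theorem inner_cliffordMul_ofReal_iff [Nontrivial W] {j : ℕ} (x : X)
    (α : TangentSpace (𝓡 (2 * m)) x [⋀^Fin j]→L[ℝ] ℝ) (hα : α ≠ 0) :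
    (∀ s t : Fibre S W,
      inner ℂ (cliffordMul Δ σ E x (Complex.ofRealCLM.compContinuousAlternatingMap α) s) t
        = inner ℂ s (cliffordMul Δ σ E x (Complex.ofRealCLM.compContinuousAlternatingMap α) t)) ↔
      j % 4 = 0 ∨ j % 4 = 3 := by
  constructor
  · intro h
    by_contra hj
    refine hα (form_eq_zero_of_coeff σ ((twistedSpinorBundle Δ σ E).mem_baseSet_at x).1 α
      fun f hf => ?_)
    have h0 : cliffordMul Δ σ E x (Complex.ofRealCLM.compContinuousAlternatingMap α) = 0 := by
      refine LinearMap.ext fun t => ext_inner_left ℂ fun s => ?_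
      have h1 := inner_cliffordMul_ofReal_neg hj x α s t (Δ := Δ) (σ := σ) (E := E)
      rw [h s t, self_eq_neg] at h1
      rw [h1, LinearMap.zero_apply, inner_zero_right]
    rw [cliffordMul_eq] at h0
    -- The injectivity lemma takes coefficients in every degree, so those of `α` are extended by
    -- zero outside degree `j`.
    have h2 := coeff_eq_zero_of_sum_cliffordSum_eq_zero Δ {j} (W := W) (fun k (f : Fin k → Fin (2 * m)) =>
      if hk : j = k then ((α (fun p => σ.frame ((twistedSpinorBundle Δ σ E).indexAt x).1
        (f (Fin.cast hk p)) x) : ℝ) : ℂ) else 0) (by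
        rw [Finset.sum_singleton]; simpa using h0) (Finset.mem_singleton_self j) hf
    simpa using h2
  · intro hj s t
    rw [inner_cliffordMul_ofReal, ((even_choose_two_iff j).2 hj).neg_one_pow, one_mul]

/-! Odd forms. -/

/-- There is no increasing map from `j` indices. `twistedDirac` sums only up to degree `2 * m`, so
larger degrees need this separate reason. -/
theorem form_eq_zero_of_lt {j : ℕ} {K : Type*} [NormedAddCommGroup K] [NormedSpace ℝ K]
    (hj : 2 * m < j) {x : X} (α : TangentSpace (𝓡 (2 * m)) x [⋀^Fin j]→L[ℝ] K) : α = 0 := by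
  refine alternating_eq_zero_of_strictMono
    (Module.finBasisOfFinrankEq ℝ _ (finrank_tangentSpace x)) α fun f hf => ?_
  have := Fintype.card_le_of_injective f hf.injective
  simp only [Fintype.card_fin] at this
  omega

/-- The Dirac part drops out of the anticommutator and odd degrees cancel, leaving a pointwise
operator. -/
theorem twistedDirac_grading_val {H : ∀ j, DifferentialForm m X ℂ j} {ψ : SpinorField Δ σ E}
    (hψ : ψ.IsSmooth) (x : X) :
    (twistedDirac H (grading ψ)).val x + gradingOp Δ W ((twistedDirac H ψ).val x)
      = 2 • ∑ j ∈ (Finset.range (2 * m + 1)).filter Even, gradingOp Δ W (cliffordSum Δ W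
        (formCoeff σ H ((twistedSpinorBundle Δ σ E).indexAt x).1 x j) (ψ.val x)) := by
  rw [twistedDirac_val, twistedDirac_val, dirac_val,
    diracLoc_grading hψ ((twistedSpinorBundle Δ σ E).mem_baseSet_at x), ← dirac_val, map_add,
    grading_val, formLoc, LinearMap.sum_apply, LinearMap.sum_apply, map_sum]
  rw [Finset.sum_filter, Finset.smul_sum, neg_add_eq_sub]
  have h : ∀ j, cliffordSum Δ W (formCoeff σ H ((twistedSpinorBundle Δ σ E).indexAt x).1 x j)
      (gradingOp Δ W (ψ.val x)) = (-1 : ℂ) ^ j • gradingOp Δ W (cliffordSum Δ W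
        (formCoeff σ H ((twistedSpinorBundle Δ σ E).indexAt x).1 x j) (ψ.val x)) := by
    intro j
    exact congrArg (fun A : Module.End ℂ (Fibre S W) => A (ψ.val x)) (gradingOp_cliffordSum Δ _)
  simp only [h]
  rw [← add_assoc, sub_add_cancel, ← Finset.sum_add_distrib]
  refine Finset.sum_congr rfl fun j _ => ?_
  split_ifs with hj
  · rw [hj.neg_one_pow, one_smul, two_smul]
  · rw [(Nat.not_even_iff_odd.1 hj).neg_one_pow, neg_one_smul, neg_add_cancel, smul_zero]

theorem exists_smooth_val_eq [T2Space X] (x : X) (s : Fibre S W) :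
    ∃ ψ : SpinorField Δ σ E, ψ.IsSmooth ∧ ψ.val x = s := by
  have hi : x ∈ domain σ E _ := (twistedSpinorBundle Δ σ E).mem_baseSet_at x
  obtain ⟨f, hf, -, hfU, hfx⟩ := exists_bump (m := m) (isOpen_domain σ E _) hi
  refine ⟨localSection Δ σ E _ f s, localSection_isSmooth _ hf hfU s, ?_⟩
  rw [← loc_indexAt, localSection_loc _ _ _ hi, hfx, one_smul]

theorem anticommute_grading_iff [T2Space X] [Nontrivial W] (H : ∀ j, DifferentialForm m X ℂ j) :
    (∀ ψ : SpinorField Δ σ E, ψ.IsSmooth →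
      twistedDirac H (grading ψ) = -grading (twistedDirac H ψ)) ↔
      ∀ j, Even j → ∀ x, (H j).toFun x = 0 := by
  constructor
  · intro h j hj x
    rcases lt_or_ge (2 * m) j with hjm | hjm
    · exact form_eq_zero_of_lt hjm _
    refine form_eq_zero_of_coeff σ ((twistedSpinorBundle Δ σ E).mem_baseSet_at x).1 _
      fun f hf => ?_
    refine coeff_eq_zero_of_sum_cliffordSum_eq_zero Δ (W := W)
      ((Finset.range (2 * m + 1)).filter Even)
      (formCoeff σ H ((twistedSpinorBundle Δ σ E).indexAt x).1 x) ?_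
      (Finset.mem_filter.2 ⟨Finset.mem_range.2 (by omega), hj⟩) hf
    refine LinearMap.ext fun s => gradingOp_injective (W := W) Δ ?_
    -- Any vector of the fibre is the value of a smooth section, so an identity on sections becomes
    -- one of operators at `x`.
    obtain ⟨ψ, hψ, rfl⟩ := exists_smooth_val_eq (Δ := Δ) (σ := σ) (E := E) x s
    have h1 := twistedDirac_grading_val (H := H) hψ x
    have h2 : (twistedDirac H (grading ψ)).val x = -gradingOp Δ W ((twistedDirac H ψ).val x) :=
      congrFun (h ψ hψ) x
    rw [h2, neg_add_cancel] at h1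
    rw [LinearMap.sum_apply, LinearMap.zero_apply, map_zero, map_sum]
    rw [two_nsmul, ← two_smul ℂ, eq_comm, smul_eq_zero] at h1
    exact h1.resolve_left two_ne_zero
  · intro h ψ hψ
    funext x
    have h1 := twistedDirac_grading_val (H := H) hψ x
    rw [Finset.sum_eq_zero, smul_zero] at h1
    · exact eq_neg_of_add_eq_zero_left h1
    · intro j hj
      have h2 : formCoeff σ H ((twistedSpinorBundle Δ σ E).indexAt x).1 x j = 0 := by
        funext f
        rw [formCoeff, h j (Finset.mem_filter.1 hj).2 x]
        rfl
      rw [h2, cliffordSum_zero, LinearMap.zero_apply, map_zero]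

end Bundle

/-! ### The divergence of a vector field in terms of an orthonormal frame -/

section Divergence

variable {n : ℕ} {G : EuclideanSpace ℝ (Fin n) →ₗ[ℝ] EuclideanSpace ℝ (Fin n) →ₗ[ℝ] ℝ}

/-- The determinant as a continuous multilinear form on Euclidean space. -/
def detForm (n : ℕ) :
    ContinuousMultilinearMap ℝ (fun _ : Fin n => EuclideanSpace ℝ (Fin n)) ℝ where
  toMultilinearMap := (EuclideanSpace.basisFun (Fin n) ℝ).toBasis.det.toMultilinearMap
  cont := by
    change Continuous fun v : Fin n → EuclideanSpace ℝ (Fin n) =>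
      ((EuclideanSpace.basisFun (Fin n) ℝ).toBasis.toMatrix v).det
    refine Continuous.matrix_det (continuous_pi fun i => continuous_pi fun k => ?_)
    change Continuous fun v : Fin n → EuclideanSpace ℝ (Fin n) => v k i
    fun_prop

theorem detForm_eq (v : Fin n → EuclideanSpace ℝ (Fin n)) :
    detForm n v = (EuclideanSpace.basisFun (Fin n) ℝ).toBasis.det v := rfl

theorem linearIndependent_of_orthonormal {e : Fin n → EuclideanSpace ℝ (Fin n)}
    (hG : ∀ k l, G (e k) (e l) = if k = l then 1 else 0) : LinearIndependent ℝ e := by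
  rw [Fintype.linearIndependent_iff]
  intro c hc k
  have h := congrArg (fun v => G v (e k)) hc
  simpa [map_sum, hG] using h

/-- The basis which is given by a family of vectors that is orthonormal for a bilinear form. -/
def orthonormalFamilyBasis {e : Fin n → EuclideanSpace ℝ (Fin n)}
    (hG : ∀ k l, G (e k) (e l) = if k = l then 1 else 0) :
    Module.Basis (Fin n) ℝ (EuclideanSpace ℝ (Fin n)) :=
  basisOfLinearIndependentOfCardEqFinrank' e (linearIndependent_of_orthonormal hG) (by simp)

theorem orthonormalFamilyBasis_apply {e : Fin n → EuclideanSpace ℝ (Fin n)}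
    (hG : ∀ k l, G (e k) (e l) = if k = l then 1 else 0) (k : Fin n) :
    orthonormalFamilyBasis hG k = e k := by
  simp [orthonormalFamilyBasis]

theorem orthonormalFamilyBasis_repr {e : Fin n → EuclideanSpace ℝ (Fin n)}
    (hG : ∀ k l, G (e k) (e l) = if k = l then 1 else 0) (v : EuclideanSpace ℝ (Fin n))
    (k : Fin n) : (orthonormalFamilyBasis hG).repr v k = G v (e k) := by
  conv_rhs => rw [← (orthonormalFamilyBasis hG).sum_repr v]
  simp [orthonormalFamilyBasis_apply, hG]

theorem eq_sum_orthonormal {e : Fin n → EuclideanSpace ℝ (Fin n)}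
    (hG : ∀ k l, G (e k) (e l) = if k = l then 1 else 0) (v : EuclideanSpace ℝ (Fin n)) :
    v = ∑ j, G v (e j) • e j := by
  conv_lhs => rw [← (orthonormalFamilyBasis hG).sum_repr v]
  simp only [orthonormalFamilyBasis_repr, orthonormalFamilyBasis_apply]

theorem detForm_ne_zero {e : Fin n → EuclideanSpace ℝ (Fin n)}
    (hG : ∀ k l, G (e k) (e l) = if k = l then 1 else 0) : detForm n e ≠ 0 := by
  have h := (EuclideanSpace.basisFun (Fin n) ℝ).toBasis.isUnit_det (orthonormalFamilyBasis hG)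
  have h2 : ⇑(orthonormalFamilyBasis hG) = e :=
    funext (orthonormalFamilyBasis_apply hG)
  rw [h2] at h
  exact h.ne_zero

/-- Only the component along the replaced basis vector survives; this is the ingredient of Jacobi's
formula for the derivative of the determinant. -/
theorem detForm_update {e : Fin n → EuclideanSpace ℝ (Fin n)}
    (hG : ∀ k l, G (e k) (e l) = if k = l then 1 else 0) (k : Fin n)
    (v : EuclideanSpace ℝ (Fin n)) :
    detForm n (Function.update e k v) = G v (e k) * detForm n e := by
  conv_lhs => rw [eq_sum_orthonormal hG v]
  rw [detForm_eq, AlternatingMap.map_update_sum, Finset.sum_eq_single k]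
  · rw [AlternatingMap.map_update_smul, Function.update_eq_self, smul_eq_mul, detForm_eq]
  · intro j _ hj
    rw [AlternatingMap.map_update_smul, AlternatingMap.map_update_self _ _ hj.symm, smul_zero]
  · simp

/-- The trace is computed once in the standard basis and once in the orthonormal one. -/
theorem sum_apply_single (A : EuclideanSpace ℝ (Fin n) →ₗ[ℝ] EuclideanSpace ℝ (Fin n))
    {e : Fin n → EuclideanSpace ℝ (Fin n)}
    (hG : ∀ k l, G (e k) (e l) = if k = l then 1 else 0) :
    ∑ i, A (EuclideanSpace.single i 1) i = ∑ k, G (A (e k)) (e k) := by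
  have h1 := LinearMap.trace_eq_matrix_trace ℝ (orthonormalFamilyBasis hG) A
  rw [LinearMap.trace_eq_matrix_trace ℝ (EuclideanSpace.basisFun (Fin n) ℝ).toBasis A] at h1
  simp only [Matrix.trace, Matrix.diag, LinearMap.toMatrix_apply, orthonormalFamilyBasis_repr,
    orthonormalFamilyBasis_apply] at h1
  simpa using h1

theorem sum_smul_apply_single {V : Type*} [AddCommGroup V] [Module ℝ V]
    (L : EuclideanSpace ℝ (Fin n) →ₗ[ℝ] V) (v : EuclideanSpace ℝ (Fin n)) :
    ∑ i, v i • L (EuclideanSpace.single i 1) = L v := by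
  have h := (EuclideanSpace.basisFun (Fin n) ℝ).toBasis.sum_repr v
  conv_rhs => rw [← h, map_sum]
  simp

variable {e : Fin n → EuclideanSpace ℝ (Fin n) → EuclideanSpace ℝ (Fin n)}
  {u : EuclideanSpace ℝ (Fin n)} {ρ : EuclideanSpace ℝ (Fin n) → ℝ}

/-- The logarithmic derivative of the determinant of the frame is a trace by `detForm_update`;
taking the reciprocal changes its sign. -/
theorem hasFDerivAt_density (hG : ∀ k l, G (e k u) (e l u) = if k = l then 1 else 0)
    (he : ∀ k, DifferentiableAt ℝ (e k) u)
    (hρ : ρ =ᶠ[𝓝 u] fun y => |detForm n fun k => e k y|⁻¹) :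
    DifferentiableAt ℝ ρ u ∧ ∀ v, fderiv ℝ ρ u v
      = -(ρ u * ∑ k, G (fderiv ℝ (e k) u v) (e k u)) := by
  have hne := detForm_ne_zero hG
  have hd := HasFDerivAt.multilinear_comp (detForm n) fun k => (he k).hasFDerivAt
  have hdv : ∀ v, fderiv ℝ (fun y => detForm n fun k => e k y) u v
      = (∑ k, G (fderiv ℝ (e k) u v) (e k u)) * detForm n fun k => e k u := by
    intro v
    rw [hd.fderiv, sum_apply, Finset.sum_mul]
    exact Finset.sum_congr rfl fun k _ => detForm_update hG k _
  -- The determinant keeps its sign near `u`, so the absolute value can be replaced by a constant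
  -- factor.
  obtain ⟨s, hsρ⟩ : ∃ s : ℝ, ρ =ᶠ[𝓝 u] fun y => s * (detForm n fun k => e k y)⁻¹ := by
    rcases lt_or_gt_of_ne hne with h | h
    · refine ⟨-1, ?_⟩
      filter_upwards [hρ, hd.continuousAt.eventually_lt continuousAt_const h] with y hy hy2
      rw [hy, abs_of_neg hy2, inv_neg, neg_one_mul]
    · refine ⟨1, ?_⟩
      filter_upwards [hρ, continuousAt_const.eventually_lt hd.continuousAt h] with y hy hy2
      rw [hy, abs_of_pos hy2, one_mul]
  have h2 : HasFDerivAt (fun y => s * (detForm n fun k => e k y)⁻¹) _ u :=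
    (((hasDerivAt_inv hne).comp_hasFDerivAt u hd.differentiableAt.hasFDerivAt).const_mul s)
  have h3 := h2.congr_of_eventuallyEq hsρ
  refine ⟨h3.differentiableAt, fun v => ?_⟩
  rw [h3.fderiv, hsρ.eq_of_nhds]
  simp only [smul_apply, hdv, smul_eq_mul]
  field_simp

/-- The divergence of the vector field `∑ f_l e_l`. -/
theorem sum_fderiv_density_smul {V : Type*} [NormedAddCommGroup V] [NormedSpace ℝ V]
    {f : Fin n → EuclideanSpace ℝ (Fin n) → V}
    (hG : ∀ k l, G (e k u) (e l u) = if k = l then 1 else 0)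
    (he : ∀ k, DifferentiableAt ℝ (e k) u)
    (hρ : ρ =ᶠ[𝓝 u] fun y => |detForm n fun k => e k y|⁻¹)
    (hf : ∀ k, DifferentiableAt ℝ (f k) u) :
    ∑ i, fderiv ℝ (fun y => ρ y • ∑ l, e l y i • f l y) u (EuclideanSpace.single i 1)
      = ρ u • ∑ l, (fderiv ℝ (f l) u (e l u)
          - (∑ j, G (VectorField.lieBracket ℝ (e l) (e j) u) (e j u)) • f l u) := by
  obtain ⟨hρd, hρv⟩ := hasFDerivAt_density hG he hρ
  have hei : ∀ l i v, fderiv ℝ (fun y => e l y i) u v = fderiv ℝ (e l) u v i := by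
    intro l i v
    have := ((EuclideanSpace.proj (𝕜 := ℝ) i).hasFDerivAt (x := e l u)).comp u (he l).hasFDerivAt
    exact congrArg (fun L => L v) this.fderiv
  have hed : ∀ l i, DifferentiableAt ℝ (fun y => e l y i) u := fun l i =>
    ((EuclideanSpace.proj (𝕜 := ℝ) i).differentiableAt (x := e l u)).comp u (he l)
  have h1 : ∀ i v, fderiv ℝ (fun y => ρ y • ∑ l, e l y i • f l y) u v
      = ∑ l, (ρ u • (e l u i • fderiv ℝ (f l) u v + fderiv ℝ (e l) u v i • f l u)
        + fderiv ℝ ρ u v • e l u i • f l u) := by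
    intro i v
    rw [fderiv_fun_smul hρd (DifferentiableAt.fun_sum fun l _ => (hed l i).fun_smul (hf l)),
      fderiv_fun_sum fun l _ => (hed l i).fun_smul (hf l)]
    simp only [add_apply, smul_apply, ContinuousLinearMap.smulRight_apply, sum_apply]
    rw [Finset.sum_add_distrib, Finset.smul_sum, Finset.smul_sum]
    congr 1
    refine Finset.sum_congr rfl fun l _ => ?_
    rw [fderiv_fun_smul (hed l i) (hf l)]
    simp only [add_apply, smul_apply, ContinuousLinearMap.smulRight_apply, hei]
  simp only [h1]
  rw [Finset.sum_comm, Finset.smul_sum]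
  refine Finset.sum_congr rfl fun l _ => ?_
  have h2 := sum_smul_apply_single (fderiv ℝ (f l) u : EuclideanSpace ℝ (Fin n) →ₗ[ℝ] V) (e l u)
  have h3 := sum_apply_single (fderiv ℝ (e l) u : _ →ₗ[ℝ] EuclideanSpace ℝ (Fin n)) hG
  have h4 := sum_smul_apply_single (fderiv ℝ ρ u : EuclideanSpace ℝ (Fin n) →ₗ[ℝ] ℝ) (e l u)
  simp only [ContinuousLinearMap.coe_coe] at h2 h3 h4
  have h5 : ∀ i, fderiv ℝ ρ u (EuclideanSpace.single i 1) • e l u i • f l u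
      = (e l u i • fderiv ℝ ρ u (EuclideanSpace.single i 1)) • f l u := by
    intro i
    rw [smul_smul, smul_eq_mul, mul_comm]
  simp only [h5]
  rw [Finset.sum_add_distrib, ← Finset.smul_sum, Finset.sum_add_distrib, h2, ← Finset.sum_smul, h3,
    ← Finset.sum_smul, h4, hρv]
  -- The trace of the derivative of `e l` and the logarithmic derivative of `ρ` along `e l` combine
  -- to minus the sum of the bracket terms.
  simp only [VectorField.lieBracket, map_sub, LinearMap.sub_apply, Finset.sum_sub_distrib]
  module

end Divergence

/-! ### The Riemannian volume in a chart -/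

section GramDeterminant

variable {n : ℕ} {G G' : EuclideanSpace ℝ (Fin n) →ₗ[ℝ] EuclideanSpace ℝ (Fin n) →ₗ[ℝ] ℝ}

/-- The Gram determinant of a bilinear form on Euclidean space. -/
def gramDet (G : EuclideanSpace ℝ (Fin n) →ₗ[ℝ] EuclideanSpace ℝ (Fin n) →ₗ[ℝ] ℝ) : ℝ :=
  (Matrix.of fun i j => G (EuclideanSpace.single i 1) (EuclideanSpace.single j 1)).det

theorem gramDet_eq (G : EuclideanSpace ℝ (Fin n) →ₗ[ℝ] EuclideanSpace ℝ (Fin n) →ₗ[ℝ] ℝ) :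
    gramDet G = (LinearMap.toMatrix₂ (EuclideanSpace.basisFun (Fin n) ℝ).toBasis
      (EuclideanSpace.basisFun (Fin n) ℝ).toBasis G).det := by
  unfold gramDet
  congr 1

theorem gramDet_comp (A : EuclideanSpace ℝ (Fin n) →ₗ[ℝ] EuclideanSpace ℝ (Fin n))
    (h : ∀ v w, G' v w = G (A v) (A w)) : gramDet G' = LinearMap.det A ^ 2 * gramDet G := by
  have h1 : G' = G.compl₁₂ A A := by
    ext v w
    exact h _ _
  rw [gramDet_eq, h1, LinearMap.toMatrix₂_compl₁₂ (EuclideanSpace.basisFun (Fin n) ℝ).toBasis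
    (EuclideanSpace.basisFun (Fin n) ℝ).toBasis, Matrix.det_mul, Matrix.det_mul,
    Matrix.det_transpose, LinearMap.det_toMatrix, ← gramDet_eq]
  ring

theorem sqrt_gramDet_comp (A : EuclideanSpace ℝ (Fin n) →ₗ[ℝ] EuclideanSpace ℝ (Fin n))
    (h : ∀ v w, G' v w = G (A v) (A w)) :
    Real.sqrt (gramDet G') = |LinearMap.det A| * Real.sqrt (gramDet G) := by
  rw [gramDet_comp A h, Real.sqrt_mul (sq_nonneg _), Real.sqrt_sq_eq_abs]

/-- The linear map sending the standard basis to `e` pulls `G` back to a form with Gram determinant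
1, so its own determinant is the missing factor. -/
theorem sqrt_gramDet {e : Fin n → EuclideanSpace ℝ (Fin n)}
    (hG : ∀ k l, G (e k) (e l) = if k = l then 1 else 0) :
    Real.sqrt (gramDet G) = |detForm n e|⁻¹ := by
  set b := (EuclideanSpace.basisFun (Fin n) ℝ).toBasis with hb
  let A := b.constr ℝ e
  have h := sqrt_gramDet_comp (G := G) (G' := G.compl₁₂ A A) A fun v w => rfl
  have h1 : gramDet (G.compl₁₂ A A) = 1 := by
    unfold gramDet
    have hA : ∀ i, A (EuclideanSpace.single i 1) = e i := by
      intro i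
      have : EuclideanSpace.single i (1 : ℝ) = b i := by simp [hb]
      rw [this, Module.Basis.constr_basis]
    rw [← Matrix.det_one (n := Fin n)]
    congr 1
    ext i j
    simp [hA, hG, Matrix.one_apply]
  have h2 : LinearMap.det A = detForm n e := by
    rw [detForm_eq, ← LinearMap.det_toMatrix b A, Module.Basis.det_apply]
    congr 1
    ext i j
    rw [LinearMap.toMatrix_apply, Module.Basis.constr_basis]
    rfl
  rw [h1, h2, Real.sqrt_one] at h
  exact eq_inv_of_mul_eq_one_right h.symm

end GramDeterminant

section Volume

variable {m : ℕ} {X : Type*} [TopologicalSpace X] [ChartedSpace (Model m) X]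
  [IsManifold (𝓡 (2 * m)) ∞ X] {g : Metric m X} {ι : Type*} (σ : SpinStructure g ι) {x₀ x₁ : X}
  {u : Model m}

theorem volumeDensity_eq_frame {a : ι} (hu : u ∈ (extChartAt (𝓡 (2 * m)) x₀).target)
    (ha : (extChartAt (𝓡 (2 * m)) x₀).symm u ∈ σ.U a) :
    volumeDensity g x₀ u = |detForm (2 * m) fun k => chartField x₀ (σ.frame a k) u|⁻¹ :=
  sqrt_gramDet (chartField_frame_orthonormal a hu ha)

theorem volumeDensity_pos (σ : SpinStructure g ι)
    (hu : u ∈ (extChartAt (𝓡 (2 * m)) x₀).target) :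
    0 < volumeDensity g x₀ u := by
  obtain ⟨a, ha⟩ := σ.cover ((extChartAt (𝓡 (2 * m)) x₀).symm u)
  rw [volumeDensity_eq_frame σ hu ha]
  exact inv_pos.2 (abs_pos.2 (detForm_ne_zero (chartField_frame_orthonormal a hu ha)))

theorem volumeDensity_eventuallyEq {a : ι} (hu : u ∈ (extChartAt (𝓡 (2 * m)) x₀).target)
    (ha : (extChartAt (𝓡 (2 * m)) x₀).symm u ∈ σ.U a) :
    volumeDensity g x₀ =ᶠ[𝓝 u]
      fun y => |detForm (2 * m) fun k => chartField x₀ (σ.frame a k) y|⁻¹ := by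
  filter_upwards [eventually_symm_mem (σ.isOpen_U a) hu ha] with y hy
  exact volumeDensity_eq_frame σ hy.1 hy.2

theorem volumeDensity_contDiffAt (σ : SpinStructure g ι)
    (hu : u ∈ (extChartAt (𝓡 (2 * m)) x₀).target) :
    ContDiffAt ℝ ∞ (volumeDensity g x₀) u := by
  obtain ⟨a, ha⟩ := σ.cover ((extChartAt (𝓡 (2 * m)) x₀).symm u)
  refine ContDiffAt.congr_of_eventuallyEq ?_ (volumeDensity_eventuallyEq σ hu ha)
  have hne := detForm_ne_zero (chartField_frame_orthonormal a hu ha)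
  refine ContDiffAt.inv ?_ (abs_ne_zero.2 hne)
  have h : ContDiffAt ℝ ∞ (fun y => detForm (2 * m) fun k => chartField x₀ (σ.frame a k) y) u :=
    (detForm (2 * m)).contDiff.contDiffAt.comp u
      (contDiffAt_pi.2 fun k => contDiffAt_chartField hu (frame_contMDiffAt σ a ha k))
  exact (contDiffAt_abs hne).comp u h

theorem volumeDensity_continuousOn (σ : SpinStructure g ι) :
    ContinuousOn (volumeDensity g x₀) (extChartAt (𝓡 (2 * m)) x₀).target :=
  fun _ hu => (volumeDensity_contDiffAt σ hu).continuousAt.continuousWithinAt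

/-- Transport along an equality of base points: vectors are kept in the model space so that
substitution is possible. -/
theorem inner_eq_of_eq {p q : X} (h : p = q) (v w : Model m) :
    g.inner p (show TangentSpace (𝓡 (2 * m)) p from v) (show TangentSpace (𝓡 (2 * m)) p from w)
      = g.inner q (show TangentSpace (𝓡 (2 * m)) q from v)
        (show TangentSpace (𝓡 (2 * m)) q from w) := by
  subst h
  rfl

/-- The change of coordinates between the charts around `x₀` and `x₁`. -/
def chartChange (x₀ x₁ : X) (u : Model m) : Model m :=
  extChartAt (𝓡 (2 * m)) x₁ ((extChartAt (𝓡 (2 * m)) x₀).symm u)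

theorem chartChange_mem (h : (extChartAt (𝓡 (2 * m)) x₀).symm u ∈
    (extChartAt (𝓡 (2 * m)) x₁).source) :
    chartChange x₀ x₁ u ∈ (extChartAt (𝓡 (2 * m)) x₁).target :=
  (extChartAt (𝓡 (2 * m)) x₁).map_source h

theorem symm_chartChange (h : (extChartAt (𝓡 (2 * m)) x₀).symm u ∈
    (extChartAt (𝓡 (2 * m)) x₁).source) :
    (extChartAt (𝓡 (2 * m)) x₁).symm (chartChange x₀ x₁ u)
      = (extChartAt (𝓡 (2 * m)) x₀).symm u :=
  (extChartAt (𝓡 (2 * m)) x₁).left_inv h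

theorem chartChange_differentiableAt (hu : u ∈ (extChartAt (𝓡 (2 * m)) x₀).target)
    (h : (extChartAt (𝓡 (2 * m)) x₀).symm u ∈ (extChartAt (𝓡 (2 * m)) x₁).source) :
    DifferentiableAt ℝ (chartChange (m := m) x₀ x₁) u := by
  have h1 : ContMDiffAt (𝓡 (2 * m)) 𝓘(ℝ, Model m) ∞ (extChartAt (𝓡 (2 * m)) x₁)
      ((extChartAt (𝓡 (2 * m)) x₀).symm u) :=
    contMDiffAt_extChartAt' (by rwa [extChartAt_source] at h)
  exact differentiableAt_comp_symm hu (h1.mdifferentiableAt (by simp))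

theorem chartDeriv_chartChange (hu : u ∈ (extChartAt (𝓡 (2 * m)) x₀).target)
    (h : (extChartAt (𝓡 (2 * m)) x₀).symm u ∈ (extChartAt (𝓡 (2 * m)) x₁).source) (v : Model m) :
    (chartDeriv x₀ u v : Model m)
      = chartDeriv x₁ (chartChange x₀ x₁ u) (fderiv ℝ (chartChange x₀ x₁) u v) := by
  have hev : (extChartAt (𝓡 (2 * m)) x₀).symm =ᶠ[𝓝 u]
      fun y => (extChartAt (𝓡 (2 * m)) x₁).symm (chartChange x₀ x₁ y) := by
    filter_upwards [eventually_symm_mem (isOpen_extChartAt_source (I := 𝓡 (2 * m)) x₁) hu h]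
      with y hy
    exact (symm_chartChange hy.2).symm
  have h1 := hev.mfderiv_eq (I := 𝓘(ℝ, Model m)) (I' := 𝓡 (2 * m))
  have h2 := mfderiv_comp_apply (I := 𝓘(ℝ, Model m)) (I' := 𝓘(ℝ, Model m)) (I'' := 𝓡 (2 * m)) u
    ((contMDiffAt_symm (chartChange_mem h)).mdifferentiableAt (by simp))
    (chartChange_differentiableAt hu h).mdifferentiableAt v
  rw [mfderiv_eq_fderiv] at h2
  exact (congrArg (fun L : Model m →L[ℝ] Model m => L v) h1).trans h2

/-- The two chart metrics are related by pullback along the coordinate change, so their Gram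
determinants differ by the squared Jacobian. This is the factor required by the change of variables
formula. -/
theorem volumeDensity_chartChange (hu : u ∈ (extChartAt (𝓡 (2 * m)) x₀).target)
    (h : (extChartAt (𝓡 (2 * m)) x₀).symm u ∈ (extChartAt (𝓡 (2 * m)) x₁).source) :
    volumeDensity g x₀ u = |(fderiv ℝ (chartChange x₀ x₁) u).det| *
      volumeDensity g x₁ (chartChange x₀ x₁ u) := by
  refine sqrt_gramDet_comp (G := chartMetric g x₁ (chartChange x₀ x₁ u)) (G' := chartMetric g x₀ u)
    (fderiv ℝ (chartChange x₀ x₁) u : Model m →ₗ[ℝ] Model m) fun v w => ?_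
  have h1 := inner_eq_of_eq (g := g) (symm_chartChange h).symm (chartDeriv x₀ u v)
    (chartDeriv x₀ u w)
  refine h1.trans ?_
  rw [chartMetric_apply]
  have hv := chartDeriv_chartChange hu h v
  have hw := chartDeriv_chartChange hu h w
  exact congrArg₂ (fun a b : Model m => g.inner _
    (show TangentSpace (𝓡 (2 * m)) ((extChartAt (𝓡 (2 * m)) x₁).symm (chartChange x₀ x₁ u)) from a)
    (show TangentSpace (𝓡 (2 * m)) ((extChartAt (𝓡 (2 * m)) x₁).symm (chartChange x₀ x₁ u)) from b))
    hv hw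

variable [MeasurableSpace X] [BorelSpace X]

theorem aemeasurable_symm (x₀ : X) :
    AEMeasurable (extChartAt (𝓡 (2 * m)) x₀).symm
      (volume.restrict (extChartAt (𝓡 (2 * m)) x₀).target) :=
  (continuousOn_extChartAt_symm x₀).aemeasurable (isOpen_target x₀).measurableSet

theorem measurableSet_target_inter_preimage (x₀ : X) {A : Set X} (hA : MeasurableSet A) :
    MeasurableSet ((extChartAt (𝓡 (2 * m)) x₀).symm ⁻¹' A ∩
      (extChartAt (𝓡 (2 * m)) x₀).target) := by
  have h := (continuousOn_iff_continuous_domRestrict.1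
    (continuousOn_extChartAt_symm (I := 𝓡 (2 * m)) x₀)).measurable hA
  have h2 := (isOpen_target x₀).measurableSet.subtype_image h
  convert h2 using 1
  rw [Set.domRestrict_eq, Set.preimage_comp, Subtype.image_preimage_coe, Set.inter_comm]

theorem chartVolume_apply (g : Metric m X) (x₀ : X) {A : Set X} (hA : MeasurableSet A) :
    chartVolume g x₀ A = ∫⁻ u in (extChartAt (𝓡 (2 * m)) x₀).symm ⁻¹' A ∩
      (extChartAt (𝓡 (2 * m)) x₀).target, ENNReal.ofReal (volumeDensity g x₀ u) := by
  rw [chartVolume, Measure.map_apply_of_aemeasurable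
    ((aemeasurable_symm x₀).mono_ac (withDensity_absolutelyContinuous _ _)) hA,
    withDensity_apply', Measure.restrict_restrict' (isOpen_target x₀).measurableSet]

/-- The chart measures agree on overlaps. -/
theorem chartVolume_overlap (g : Metric m X) (x₀ x₁ : X) {A : Set X} (hA : MeasurableSet A)
    (h₀ : A ⊆ (extChartAt (𝓡 (2 * m)) x₀).source) (h₁ : A ⊆ (extChartAt (𝓡 (2 * m)) x₁).source) :
    chartVolume g x₀ A = chartVolume g x₁ A := by
  rw [chartVolume_apply g x₀ hA, chartVolume_apply g x₁ hA]
  set O := (extChartAt (𝓡 (2 * m)) x₀).symm ⁻¹' A ∩ (extChartAt (𝓡 (2 * m)) x₀).target with hO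
  have himage : (extChartAt (𝓡 (2 * m)) x₁).symm ⁻¹' A ∩ (extChartAt (𝓡 (2 * m)) x₁).target
      = chartChange x₀ x₁ '' O := by
    ext v
    constructor
    · rintro ⟨hv, hv'⟩
      refine ⟨extChartAt (𝓡 (2 * m)) x₀ ((extChartAt (𝓡 (2 * m)) x₁).symm v), ⟨?_, ?_⟩, ?_⟩
      · rw [Set.mem_preimage, (extChartAt (𝓡 (2 * m)) x₀).left_inv (h₀ hv)]
        exact hv
      · exact (extChartAt (𝓡 (2 * m)) x₀).map_source (h₀ hv)
      · rw [chartChange, (extChartAt (𝓡 (2 * m)) x₀).left_inv (h₀ hv),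
          (extChartAt (𝓡 (2 * m)) x₁).right_inv hv']
    · rintro ⟨u, ⟨hu, hu'⟩, rfl⟩
      refine ⟨?_, chartChange_mem (h₁ hu)⟩
      rw [Set.mem_preimage, symm_chartChange (h₁ hu)]
      exact hu
  have hinj : Set.InjOn (chartChange (m := m) x₀ x₁) O := by
    intro u hu v hv huv
    have h := congrArg (extChartAt (𝓡 (2 * m)) x₁).symm huv
    rw [symm_chartChange (h₁ hu.1), symm_chartChange (h₁ hv.1)] at h
    exact (extChartAt (𝓡 (2 * m)) x₀).symm.injOn hu.2 hv.2 h
  have hOm : MeasurableSet O := measurableSet_target_inter_preimage x₀ hA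
  rw [himage, lintegral_image_eq_lintegral_abs_det_fderiv_mul volume hOm
    (fun u hu => (chartChange_differentiableAt hu.2 (h₁ hu.1)).hasFDerivAt.hasFDerivWithinAt) hinj]
  refine setLIntegral_congr_fun hOm fun u hu => ?_
  rw [volumeDensity_chartChange hu.2 (h₁ hu.1), ENNReal.ofReal_mul (abs_nonneg _)]

theorem chartVolume_restrict_source (g : Metric m X) (x₀ : X) :
    (chartVolume g x₀).restrict (extChartAt (𝓡 (2 * m)) x₀).source = chartVolume g x₀ := by
  ext A hA
  have hs := (isOpen_extChartAt_source (I := 𝓡 (2 * m)) x₀).measurableSet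
  rw [Measure.restrict_apply hA, chartVolume_apply g x₀ hA, chartVolume_apply g x₀ (hA.inter hs)]
  congr 2
  ext u
  constructor
  · exact fun hu => ⟨hu.1.1, hu.2⟩
  · exact fun hu => ⟨⟨hu.1, (extChartAt (𝓡 (2 * m)) x₀).map_target hu.2⟩, hu.2⟩

theorem chartVolume_restrict_overlap (g : Metric m X) (x₀ x₁ : X) :
    (chartVolume g x₁).restrict (extChartAt (𝓡 (2 * m)) x₀).source
      = (chartVolume g x₀).restrict (extChartAt (𝓡 (2 * m)) x₁).source := by
  have hs₀ := (isOpen_extChartAt_source (I := 𝓡 (2 * m)) x₀).measurableSet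
  have hs₁ := (isOpen_extChartAt_source (I := 𝓡 (2 * m)) x₁).measurableSet
  rw [← chartVolume_restrict_source g x₁, ← chartVolume_restrict_source g x₀,
    Measure.restrict_restrict hs₀, Measure.restrict_restrict hs₁, Set.inter_comm]
  ext A hA
  rw [Measure.restrict_apply hA, Measure.restrict_apply hA]
  exact (chartVolume_overlap g x₀ x₁ (hA.inter (hs₁.inter hs₀)) (fun x hx => hx.2.2)
    fun x hx => hx.2.1).symm

/-- The Riemannian volume restricts to the chart measures. -/
theorem riemannianVolume_restrict_source (g : Metric m X) (x₀ : X) :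
    (riemannianVolume g).restrict (extChartAt (𝓡 (2 * m)) x₀).source = chartVolume g x₀ := by
  set s := (extChartAt (𝓡 (2 * m)) x₀).source with hs
  have hsm : MeasurableSet s := (isOpen_extChartAt_source (I := 𝓡 (2 * m)) x₀).measurableSet
  refine le_antisymm ?_ ?_
  · have h : riemannianVolume g ≤ chartVolume g x₀ + (riemannianVolume g).restrict sᶜ := by
      refine iSup_le fun x => ?_
      rw [← Measure.restrict_add_restrict_compl (μ := chartVolume g x) hsm]
      refine add_le_add ?_ (Measure.restrict_mono le_rfl (le_iSup (chartVolume g) x))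
      rw [chartVolume_restrict_overlap]
      exact Measure.restrict_le_self
    refine (Measure.restrict_mono le_rfl h).trans ?_
    rw [Measure.restrict_add, Measure.restrict_restrict hsm, Set.inter_compl_self,
      Measure.restrict_empty, add_zero]
    exact Measure.restrict_le_self
  · conv_lhs => rw [← chartVolume_restrict_source g x₀]
    exact Measure.restrict_mono le_rfl (le_iSup (chartVolume g) x₀)

variable {V : Type*} [NormedAddCommGroup V] [NormedSpace ℝ V]

theorem integral_riemannianVolume [SecondCountableTopology V] (σ : SpinStructure g ι)
    {h : X → V} (hc : Continuous h)
    (h0 : ∀ x, x ∉ (extChartAt (𝓡 (2 * m)) x₀).source → h x = 0) :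
    ∫ x, h x ∂(riemannianVolume g) = ∫ u in (extChartAt (𝓡 (2 * m)) x₀).target,
      volumeDensity g x₀ u • h ((extChartAt (𝓡 (2 * m)) x₀).symm u) := by
  have hm := (volumeDensity_continuousOn σ (x₀ := x₀)).aemeasurable (μ := volume)
    (isOpen_target x₀).measurableSet
  rw [← setIntegral_eq_integral_of_forall_compl_eq_zero h0, riemannianVolume_restrict_source,
    chartVolume, integral_map ((aemeasurable_symm x₀).mono_ac (withDensity_absolutelyContinuous _ _))
      hc.aestronglyMeasurable, integral_withDensity_eq_integral_toReal_smul₀ hm.ennreal_ofReal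
      (by simp)]
  refine setIntegral_congr_fun (isOpen_target x₀).measurableSet fun u hu => ?_
  rw [ENNReal.toReal_ofReal (volumeDensity_pos σ hu).le]

theorem integrable_riemannianVolume [SecondCountableTopology V] [T2Space X]
    (σ : SpinStructure g ι) {h : X → V}
    (hc : Continuous h) {K : Set X} (hK : IsCompact K)
    (hKs : K ⊆ (extChartAt (𝓡 (2 * m)) x₀).source) (h0 : ∀ x, x ∉ K → h x = 0) :
    Integrable h (riemannianVolume g) := by
  have hm := (volumeDensity_continuousOn σ (x₀ := x₀)).aemeasurable (μ := volume)
    (isOpen_target x₀).measurableSet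
  have hsupp : Function.support h ⊆ (extChartAt (𝓡 (2 * m)) x₀).source := fun x hx =>
    hKs (by_contra fun hn => hx (h0 x hn))
  rw [← integrableOn_iff_integrable_of_support_subset hsupp, IntegrableOn,
    riemannianVolume_restrict_source, chartVolume, integrable_map_measure hc.aestronglyMeasurable
      ((aemeasurable_symm x₀).mono_ac (withDensity_absolutelyContinuous _ _)),
    integrable_withDensity_iff_integrable_smul₀' hm.ennreal_ofReal (by simp)]
  have hK' : IsCompact (extChartAt (𝓡 (2 * m)) x₀ '' K) :=
    hK.image_of_continuousOn ((continuousOn_extChartAt x₀).mono hKs)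
  have hK't : extChartAt (𝓡 (2 * m)) x₀ '' K ⊆ (extChartAt (𝓡 (2 * m)) x₀).target := by
    rintro _ ⟨x, hx, rfl⟩
    exact (extChartAt (𝓡 (2 * m)) x₀).map_source (hKs hx)
  have hcont : ContinuousOn (fun u => (ENNReal.ofReal (volumeDensity g x₀ u)).toReal •
      (h ∘ (extChartAt (𝓡 (2 * m)) x₀).symm) u) (extChartAt (𝓡 (2 * m)) x₀).target := by
    have h1 := (volumeDensity_continuousOn σ (x₀ := x₀)).smul
      (hc.comp_continuousOn (continuousOn_extChartAt_symm (I := 𝓡 (2 * m)) x₀))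
    refine h1.congr fun u hu => ?_
    simp only [ENNReal.toReal_ofReal (volumeDensity_pos σ hu).le]
    rfl
  refine IntegrableOn.of_forall_sdiff_eq_zero ((hcont.mono hK't).integrableOn_compact hK')
    (isOpen_target x₀).measurableSet fun u hu => ?_
  have : (extChartAt (𝓡 (2 * m)) x₀).symm u ∉ K := fun hn =>
    hu.2 ⟨_, hn, (extChartAt (𝓡 (2 * m)) x₀).right_inv hu.1⟩
  rw [Function.comp_apply, h0 _ this, smul_zero]

end Volume

/-! ### The formal adjoint of the Dirac operator at a point -/

theorem star_spinElement {m : ℕ} {θ : Fin (2 * m) → Fin (2 * m) → ℝ}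
    (hθ : ∀ k l, θ k l = - θ l k) : star (spinElement m θ) = -spinElement m θ := by
  have h : ∑ k, ∑ l, θ k l • (gen m l * gen m k) = -∑ k, ∑ l, θ k l • (gen m k * gen m l) := by
    rw [Finset.sum_comm]
    simp only [← Finset.sum_neg_distrib]
    refine Finset.sum_congr rfl fun k _ => Finset.sum_congr rfl fun l _ => ?_
    rw [hθ l k, neg_smul]
  rw [spinElement, CliffordAlgebra.star_smul, ← smul_neg, ← h]
  simp only [star_sum, CliffordAlgebra.star_smul, star_mul, star_gen, neg_mul_neg]

section Bundle

variable {m : ℕ} {X : Type*} [TopologicalSpace X] [ChartedSpace (Model m) X]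
  [IsManifold (𝓡 (2 * m)) ∞ X] {g : Metric m X}
  {S : Type*} [NormedAddCommGroup S] [InnerProductSpace ℂ S] [FiniteDimensional ℂ S]
  {W : Type*} [NormedAddCommGroup W] [InnerProductSpace ℂ W] [FiniteDimensional ℂ W]
  {ι κ : Type*} {Δ : SpinorModule m S} {σ : SpinStructure g ι} {E : FlatHermitianBundle X W κ}

/-- Both the generators and the connection elements are skew-adjoint. Moving them to one side leaves
the commutator of connection and generator, a vector by `spinElement_commutator`, which produces the
traced coefficients `θ j j l`. -/
theorem inner_clifford_connection (Δ : SpinorModule m S)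
    {θ : Fin (2 * m) → Fin (2 * m) → Fin (2 * m) → ℝ} (hθ : ∀ j k l, θ j k l = -θ j l k)
    (a b : Fin (2 * m) → Fibre S W) (v w : Fibre S W) :
    inner ℂ (∑ k, cl Δ W (gen m k) (a k + cl Δ W (spinElement m (θ k)) v)) w
        - inner ℂ v (∑ k, cl Δ W (gen m k) (b k + cl Δ W (spinElement m (θ k)) w))
      = -∑ l, (inner ℂ v (cl Δ W (gen m l) (b l)) + inner ℂ (a l) (cl Δ W (gen m l) w)
          - (∑ j, θ j j l) • inner ℂ v (cl Δ W (gen m l) w)) := by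
  have h : ∀ k, inner ℂ (cl Δ W (gen m k) (a k + cl Δ W (spinElement m (θ k)) v)) w
        - inner ℂ v (cl Δ W (gen m k) (b k + cl Δ W (spinElement m (θ k)) w))
      = (∑ l, θ k k l • inner ℂ v (cl Δ W (gen m l) w))
        - (inner ℂ v (cl Δ W (gen m k) (b k)) + inner ℂ (a k) (cl Δ W (gen m k) w)) := by
    intro k
    have h1 : inner ℂ v (cl Δ W (spinElement m (θ k)) (cl Δ W (gen m k) w))
        - inner ℂ v (cl Δ W (gen m k) (cl Δ W (spinElement m (θ k)) w))
        = ∑ l, θ k k l • inner ℂ v (cl Δ W (gen m l) w) := by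
      have h2 := congrArg (fun z => cl Δ W z w) (spinElement_commutator (hθ k) k)
      simp only [sub_eq_add_neg, cl_add, cl_neg, cl_mul, cl_sum, cl_smul, LinearMap.add_apply,
        LinearMap.neg_apply, Module.End.mul_apply, LinearMap.sum_apply, LinearMap.smul_apply] at h2
      rw [← sub_eq_add_neg] at h2
      rw [← inner_sub_right, h2, inner_sum]
      refine Finset.sum_congr rfl fun l _ => ?_
      rw [inner_smul_right, Complex.real_smul]
    rw [inner_cl, star_gen, cl_neg, LinearMap.neg_apply, inner_neg_right, inner_add_left, inner_cl,
      star_spinElement (hθ k), cl_neg, LinearMap.neg_apply, inner_neg_right, map_add,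
      inner_add_right, ← h1]
    ring
  rw [sum_inner, inner_sum, ← Finset.sum_sub_distrib, Finset.sum_congr rfl fun k _ => h k,
    Finset.sum_sub_distrib, Finset.sum_sub_distrib, Finset.sum_comm]
  simp only [Finset.sum_smul]
  ring

/-- The function `⟨ψ, e_l φ⟩` in the local frames with index `i`. -/
def pairing (ψ φ : SpinorField Δ σ E) (i : ι × κ) (l : Fin (2 * m)) (x : X) : ℂ :=
  inner ℂ (ψ.loc i x) (cl Δ W (gen m l) (φ.loc i x))

/-- The failure of pointwise symmetry is rewritten as the expression that `sum_fderiv_density_smul`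
identifies with a divergence. -/
theorem inner_diracLoc_sub {ψ φ : SpinorField Δ σ E} (hψ : ψ.IsSmooth) (hφ : φ.IsSmooth)
    {i : ι × κ} {x₀ : X} {u : Model m} (hu : u ∈ (extChartAt (𝓡 (2 * m)) x₀).target)
    (hi : (extChartAt (𝓡 (2 * m)) x₀).symm u ∈ domain σ E i) :
    inner ℂ (diracLoc ψ i ((extChartAt (𝓡 (2 * m)) x₀).symm u))
          (φ.loc i ((extChartAt (𝓡 (2 * m)) x₀).symm u))
        - inner ℂ (ψ.loc i ((extChartAt (𝓡 (2 * m)) x₀).symm u))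
          (diracLoc φ i ((extChartAt (𝓡 (2 * m)) x₀).symm u))
      = -∑ l, (fderiv ℝ (fun y => pairing ψ φ i l ((extChartAt (𝓡 (2 * m)) x₀).symm y)) u
            (chartField x₀ (σ.frame i.1 l) u)
          - (∑ j, chartMetric g x₀ u (VectorField.lieBracket ℝ (chartField x₀ (σ.frame i.1 l))
              (chartField x₀ (σ.frame i.1 j)) u) (chartField x₀ (σ.frame i.1 j) u)) •
            pairing ψ φ i l ((extChartAt (𝓡 (2 * m)) x₀).symm u)) := by
  set x := (extChartAt (𝓡 (2 * m)) x₀).symm u with hx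
  have h1 := inner_clifford_connection Δ (W := W) 
    (fun j k l => leviCivitaCoeff_antisymm (σ := σ) i.1 x j k l)
    (fun k => mvfderiv (𝓡 (2 * m)) (ψ.loc i) x (σ.frame i.1 k x))
    (fun k => mvfderiv (𝓡 (2 * m)) (φ.loc i) x (σ.frame i.1 k x)) (ψ.loc i x) (φ.loc i x)
  refine h1.trans ?_
  congr 1
  refine Finset.sum_congr rfl fun l _ => ?_
  have hψd := differentiableAt_comp_symm hu (loc_mdifferentiableAt hψ hi)
  have hφd := differentiableAt_comp_symm hu (loc_mdifferentiableAt hφ hi)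
  have h2 : fderiv ℝ (fun y => pairing ψ φ i l ((extChartAt (𝓡 (2 * m)) x₀).symm y)) u
        (chartField x₀ (σ.frame i.1 l) u)
      = inner ℂ (ψ.loc i x) (cl Δ W (gen m l) (mvfderiv (𝓡 (2 * m)) (φ.loc i) x (σ.frame i.1 l x)))
        + inner ℂ (mvfderiv (𝓡 (2 * m)) (ψ.loc i) x (σ.frame i.1 l x))
          (cl Δ W (gen m l) (φ.loc i x)) := by
    have h3 := (realOp (cl Δ W (gen m l))).hasFDerivAt.comp u hφd.hasFDerivAt
    have h4 := fderiv_inner_apply ℂ hψd h3.differentiableAt (chartField x₀ (σ.frame i.1 l) u)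
    rw [h3.fderiv] at h4
    rw [hx, mvfderiv_vectorField hu (loc_mdifferentiableAt hφ hi),
      mvfderiv_vectorField hu (loc_mdifferentiableAt hψ hi)]
    exact h4
  rw [h2]
  congr 2
  -- With the first two indices equal one bracket vanishes and the other two agree up to sign, so
  -- the Koszul formula reduces to a single bracket.
  refine Finset.sum_congr rfl fun j _ => ?_
  rw [hx, leviCivitaCoeff_eq_koszul i.1 hu hi.1, koszul]
  simp only [VectorField.lieBracket, map_sub, LinearMap.sub_apply]
  ring

/-! Continuous sections. -/

/-- Continuous sections of `S ⊗ E`. -/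
def SpinorField.IsCont (ψ : SpinorField Δ σ E) : Prop :=
  ∀ i, ContinuousOn (ψ.loc i) (domain σ E i)

theorem SpinorField.IsSmooth.isCont {ψ : SpinorField Δ σ E} (hψ : ψ.IsSmooth) : ψ.IsCont :=
  fun i => ((isSmooth_iff ψ).1 hψ i).continuousOn

theorem inner_loc (ψ φ : SpinorField Δ σ E) {i : ι × κ} {x : X} (hi : x ∈ domain σ E i) :
    inner ℂ (ψ.loc i x) (φ.loc i x) = inner ℂ (ψ.val x) (φ.val x) :=
  inner_changeOp ((twistedSpinorBundle Δ σ E).mem_baseSet_at x) hi _ _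

theorem SpinorField.IsCont.inner {ψ φ : SpinorField Δ σ E} (hψ : ψ.IsCont) (hφ : φ.IsCont) :
    Continuous fun x => inner ℂ (ψ.val x) (φ.val x) := by
  refine continuous_iff_continuousAt.2 fun x => ?_
  have hi : x ∈ domain σ E ((twistedSpinorBundle Δ σ E).indexAt x) :=
    (twistedSpinorBundle Δ σ E).mem_baseSet_at x
  have h := ((hψ _).inner (𝕜 := ℂ) (hφ _)).continuousAt ((isOpen_domain σ E _).mem_nhds hi)
  refine h.congr ?_
  filter_upwards [(isOpen_domain σ E _).mem_nhds hi] with y hy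
  exact inner_loc ψ φ hy

theorem continuousAt_leviCivitaCoeff {a : ι} {x : X} (hx : x ∈ σ.U a) (j k l : Fin (2 * m)) :
    ContinuousAt (fun x => leviCivitaCoeff σ a x j k l) x := by
  have hM : IsManifold (𝓡 (2 * m)) (minSmoothness ℝ 2) X := by
    rw [minSmoothness_of_isRCLikeNormedField]
    exact IsManifold.of_le (n := ∞) ENat.LEInfty.out
  have hM' : IsManifold (𝓡 (2 * m)) (((⊤ : ℕ∞) : ℕ∞ω) + 1) X :=
    inferInstanceAs (IsManifold (𝓡 (2 * m)) ∞ X)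
  have h : ∀ p q r, ContinuousAt (fun x => g.inner x
      (VectorField.mlieBracket (𝓡 (2 * m)) (σ.frame a p) (σ.frame a q) x) (σ.frame a r x)) x := by
    intro p q r
    have h1 : ContMDiffAt (𝓡 (2 * m)) (𝓡 (2 * m)).tangent ((0 : ℕ∞) : ℕ∞ω) _ x :=
      (frame_contMDiffAt σ a hx p).mlieBracket_vectorField (n := ⊤) (frame_contMDiffAt σ a hx q)
        (by rw [minSmoothness_of_isRCLikeNormedField]; exact mod_cast le_top)
    exact (contMDiffAt_inner g (by simp) h1
      ((frame_contMDiffAt σ a hx r).of_le (by simp))).continuousAt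
  exact (((h j k l).sub (h k l j)).add (h l j k)).div_const 2

theorem continuousAt_mvfderiv_frame {F : Type*} [NormedAddCommGroup F] [NormedSpace ℝ F]
    {a : ι} {x : X} (hx : x ∈ σ.U a) {f : X → F} {U : Set X} (hU : IsOpen U) (hxU : x ∈ U)
    (hf : ∀ y ∈ U, ContMDiffAt (𝓡 (2 * m)) 𝓘(ℝ, F) ∞ f y) (k : Fin (2 * m)) :
    ContinuousAt (fun y => mvfderiv (𝓡 (2 * m)) f y (σ.frame a k y)) x := by
  have hu := mem_extChartAt_target (I := 𝓡 (2 * m)) x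
  have hxu := extChartAt_to_inv (I := 𝓡 (2 * m)) x
  have h1 : ContinuousAt (fun u => fderiv ℝ (fun y => f ((extChartAt (𝓡 (2 * m)) x).symm y)) u
      (chartField x (σ.frame a k) u)) (extChartAt (𝓡 (2 * m)) x x) := by
    refine ContinuousAt.clm_apply ?_ ?_
    · exact (contDiffAt_comp_symm hu (hf _ (by rwa [hxu]))).continuousAt_fderiv (by simp)
    · exact (contDiffAt_chartField hu (frame_contMDiffAt σ a (by rwa [hxu]) k)).continuousAt
  refine (h1.comp (continuousAt_extChartAt x)).congr ?_
  filter_upwards [(isOpen_extChartAt_source (I := 𝓡 (2 * m)) x).mem_nhds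
    (mem_extChartAt_source x), hU.mem_nhds hxU] with y hy hyU
  have hyy := (extChartAt (𝓡 (2 * m)) x).left_inv hy
  have h2 := mvfderiv_vectorField ((extChartAt (𝓡 (2 * m)) x).map_source hy)
    ((hf _ (by rwa [hyy])).mdifferentiableAt (by simp)) (σ.frame a k)
  rw [Function.comp_apply, ← h2, hyy]

/-- The frame in `dirac` varies with the point without any continuity, so the operator is first
rewritten in one fixed frame near `x`. Continuity suffices for the integrals that follow. -/
theorem SpinorField.IsSmooth.isCont_dirac {ψ : SpinorField Δ σ E} (hψ : ψ.IsSmooth) :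
    (dirac ψ).IsCont := by
  intro i x hi
  have hloc : ContinuousAt (ψ.loc i) x := (loc_contMDiffAt hψ hi).continuousAt
  have h : ContinuousAt (diracLoc ψ i) x := by
    unfold diracLoc SpinorField.covDeriv
    simp only [cl_smul, cl_sum, LinearMap.smul_apply, LinearMap.sum_apply]
    refine tendsto_finsetSum _ fun k _ => ?_
    refine (LinearMap.continuous_of_finiteDimensional (cl Δ W (gen m k))).continuousAt.tendsto.comp ?_
    refine Filter.Tendsto.add ?_ (Filter.Tendsto.const_smul ?_ _)
    · exact continuousAt_mvfderiv_frame hi.1 (isOpen_domain σ E i) hi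
        (fun y hy => loc_contMDiffAt hψ hy) k
    · refine tendsto_finsetSum _ fun p _ => tendsto_finsetSum _ fun q _ => ?_
      refine Filter.Tendsto.smul ?_ ?_
      · exact (Complex.continuous_ofReal.continuousAt).comp (continuousAt_leviCivitaCoeff hi.1 k p q)
      · exact (LinearMap.continuous_of_finiteDimensional _).continuousAt.tendsto.comp hloc
  refine (h.congr ?_).continuousWithinAt
  filter_upwards [(isOpen_domain σ E i).mem_nhds hi] with y hy
  exact (dirac_loc hψ hy).symm

end Bundle

/-! ### The formal adjoint of the Dirac operator -/

/-- Integration by parts against the constant function 1. -/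
theorem integral_fderiv_eq_zero {n : ℕ} {V : Type*} [NormedAddCommGroup V] [NormedSpace ℝ V]
    {f : EuclideanSpace ℝ (Fin n) → V} (hf : ContDiff ℝ 1 f) (hc : HasCompactSupport f)
    (v : EuclideanSpace ℝ (Fin n)) : ∫ u, fderiv ℝ f u v = 0 := by
  have hd : Differentiable ℝ f := hf.differentiable (by simp)
  have hint : Integrable (fun u => fderiv ℝ f u v) :=
    (hf.continuous_fderiv_apply (by simp)).comp (continuous_id.prodMk continuous_const)
      |>.integrable_of_hasCompactSupport (hc.fderiv_apply ℝ v)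
  have h := integral_smul_fderiv_eq_neg_fderiv_smul_of_integrable (𝕜 := ℝ) (μ := volume)
    (f := fun _ : EuclideanSpace ℝ (Fin n) => (1 : ℝ)) (g := f) (v := v) (by simp)
    (by simpa using hint) (by simpa using hf.continuous.integrable_of_hasCompactSupport hc)
    (fun _ _ => differentiableAt_const _) (fun x _ => hd x)
  simpa using h

section Bundle

variable {m : ℕ} {X : Type*} [TopologicalSpace X] [ChartedSpace (Model m) X]
  [IsManifold (𝓡 (2 * m)) ∞ X] {g : Metric m X}
  {S : Type*} [NormedAddCommGroup S] [InnerProductSpace ℂ S] [FiniteDimensional ℂ S]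
  {W : Type*} [NormedAddCommGroup W] [InnerProductSpace ℂ W] [FiniteDimensional ℂ W]
  {ι κ : Type*} {Δ : SpinorModule m S} {σ : SpinStructure g ι} {E : FlatHermitianBundle X W κ}

theorem loc_eq_zero {ψ : SpinorField Δ σ E} {x : X} (h : ψ.val x = 0) (i : ι × κ) :
    ψ.loc i x = 0 := by
  unfold SpinorField.loc
  rw [h, map_zero]

/-- Locality of the differential operator; vanishing at the point alone would not suffice. -/
theorem dirac_val_eq_zero {ψ : SpinorField Δ σ E} {x : X} (h : ∀ᶠ y in 𝓝 x, ψ.val y = 0) :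
    (dirac ψ).val x = 0 := by
  rw [dirac_val, diracLoc]
  refine Finset.sum_eq_zero fun k _ => ?_
  have h1 : ψ.loc ((twistedSpinorBundle Δ σ E).indexAt x) =ᶠ[𝓝 x] fun _ => 0 :=
    h.mono fun y hy => loc_eq_zero hy _
  have h2 : mvfderiv (𝓡 (2 * m)) (ψ.loc ((twistedSpinorBundle Δ σ E).indexAt x)) x = 0 := by
    have h3 := h1.mfderiv_eq (I := 𝓡 (2 * m)) (I' := 𝓘(ℝ, Fibre S W))
    rw [mfderiv_const] at h3
    exact h3
  rw [SpinorField.covDeriv, h2, h1.eq_of_nhds, map_zero, add_zero]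
  exact map_zero _

variable [T2Space X] [MeasurableSpace X] [BorelSpace X]

/-- Integration by parts for a section which is supported in a chart and a local frame. -/
theorem integral_inner_dirac_sub {ψ φ : SpinorField Δ σ E} (hψ : ψ.IsSmooth) (hφ : φ.IsSmooth)
    {i : ι × κ} {x₀ : X} {K : Set X} (hK : IsCompact K)
    (hKs : K ⊆ (extChartAt (𝓡 (2 * m)) x₀).source) (hKi : K ⊆ domain σ E i)
    (h0 : ∀ x, x ∉ K → ψ.val x = 0) :
    ∫ x, (inner ℂ ((dirac ψ).val x) (φ.val x) - inner ℂ (ψ.val x) ((dirac φ).val x))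
      ∂(riemannianVolume g) = 0 := by
  set h : X → ℂ := fun x =>
    inner ℂ ((dirac ψ).val x) (φ.val x) - inner ℂ (ψ.val x) ((dirac φ).val x) with hh
  have hcont : Continuous h := (hψ.isCont_dirac.inner hφ.isCont).sub (hψ.isCont.inner hφ.isCont_dirac)
  have hh0 : ∀ x, x ∉ K → h x = 0 := by
    intro x hx
    have h1 : ∀ᶠ y in 𝓝 x, ψ.val y = 0 := by
      filter_upwards [hK.isClosed.isOpen_compl.mem_nhds hx] with y hy
      exact h0 y hy
    simp only [hh, dirac_val_eq_zero h1, h0 x hx, inner_zero_left, sub_zero]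
  rw [integral_riemannianVolume σ (x₀ := x₀) hcont fun x hx => hh0 x fun hn => hx (hKs hn)]
  set T := (extChartAt (𝓡 (2 * m)) x₀).target with hT
  set ρ := volumeDensity g x₀ with hρ
  set e := fun l => chartField x₀ (σ.frame i.1 l) with he
  set p := fun l y => pairing ψ φ i l ((extChartAt (𝓡 (2 * m)) x₀).symm y) with hp
  -- `F q` is the `q`-th coordinate of the density times the vector field with frame components `p
  -- l`, extended by zero to the whole model space.
  set F : Fin (2 * m) → Model m → ℂ := fun q => T.indicator
    (fun y => ρ y • ∑ l, e l y q • p l y) with hF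
  set K' := extChartAt (𝓡 (2 * m)) x₀ '' K with hK'
  have hK'c : IsCompact K' := hK.image_of_continuousOn ((continuousOn_extChartAt x₀).mono hKs)
  have hK'T : ∀ u ∈ K', u ∈ T ∧ (extChartAt (𝓡 (2 * m)) x₀).symm u ∈ K := by
    rintro _ ⟨x, hx, rfl⟩
    refine ⟨(extChartAt (𝓡 (2 * m)) x₀).map_source (hKs hx), ?_⟩
    rwa [(extChartAt (𝓡 (2 * m)) x₀).left_inv (hKs hx)]
  have hTK' : ∀ u ∈ T, u ∉ K' → (extChartAt (𝓡 (2 * m)) x₀).symm u ∉ K := fun u hu hn hx =>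
    hn ⟨_, hx, (extChartAt (𝓡 (2 * m)) x₀).right_inv hu⟩
  have hF0 : ∀ q u, u ∉ K' → F q u = 0 := by
    intro q u hu
    by_cases huT : u ∈ T
    · have h1 : ∀ l, p l u = 0 := by
        intro l
        simp only [hp, pairing, loc_eq_zero (h0 _ (hTK' u huT hu)) i, inner_zero_left]
      simp only [hF, Set.indicator_of_mem huT, h1, smul_zero, Finset.sum_const_zero]
    · exact Set.indicator_of_notMem huT _
  have hFev : ∀ q u, u ∈ T → F q =ᶠ[𝓝 u] fun y => ρ y • ∑ l, e l y q • p l y := by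
    intro q u hu
    filter_upwards [(isOpen_target x₀).mem_nhds hu] with y hy
    exact Set.indicator_of_mem hy _
  have hed : ∀ u ∈ T, (extChartAt (𝓡 (2 * m)) x₀).symm u ∈ domain σ E i → ∀ l,
      ContDiffAt ℝ ∞ (e l) u := fun u hu hi l =>
    contDiffAt_chartField hu (frame_contMDiffAt σ i.1 hi.1 l)
  have hpd : ∀ u ∈ T, (extChartAt (𝓡 (2 * m)) x₀).symm u ∈ domain σ E i → ∀ l,
      ContDiffAt ℝ ∞ (p l) u := by
    intro u hu hi l
    have h1 := contDiffAt_comp_symm hu (loc_contMDiffAt hψ hi)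
    have h2 := contDiffAt_comp_symm hu (loc_contMDiffAt hφ hi)
    exact h1.inner ℂ ((realOp (cl Δ W (gen m l))).contDiff.contDiffAt.comp u h2)
  have hFsmooth : ∀ q, ContDiff ℝ 1 (F q) := by
    intro q
    refine contDiff_iff_contDiffAt.2 fun u => ?_
    -- On `K'` all ingredients are smooth; off `K'` the function vanishes nearby because `K'` is
    -- closed.
    by_cases hu : u ∈ K'
    · obtain ⟨huT, hx⟩ := hK'T u hu
      refine ContDiffAt.congr_of_eventuallyEq ?_ (hFev q u huT)
      refine ContDiffAt.of_le (n := ∞) ?_ (by simp)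
      refine (volumeDensity_contDiffAt σ huT).smul (ContDiffAt.sum fun l _ => ?_)
      have h1 : ContDiffAt ℝ ∞ (fun y => e l y q) u :=
        (EuclideanSpace.proj (𝕜 := ℝ) q).contDiff.contDiffAt.comp u (hed u huT (hKi hx) l)
      exact h1.smul (hpd u huT (hKi hx) l)
    · refine (contDiffAt_const (c := (0 : ℂ))).congr_of_eventuallyEq ?_
      filter_upwards [hK'c.isClosed.isOpen_compl.mem_nhds hu] with y hy
      exact hF0 q y hy
  have hFc : ∀ q, HasCompactSupport (F q) := fun q => HasCompactSupport.intro hK'c (hF0 q)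
  have hF'0 : ∀ q u, u ∉ K' → fderiv ℝ (F q) u = 0 := by
    intro q u hu
    have : F q =ᶠ[𝓝 u] fun _ => 0 := by
      filter_upwards [hK'c.isClosed.isOpen_compl.mem_nhds hu] with y hy
      exact hF0 q y hy
    rw [this.fderiv_eq]
    simp
  -- The integrand is minus a Euclidean divergence, by the pointwise adjoint formula and the
  -- divergence formula in the frame.
  have hmain : ∀ u ∈ T, ρ u • h ((extChartAt (𝓡 (2 * m)) x₀).symm u)
      = -∑ q, fderiv ℝ (F q) u (EuclideanSpace.single q 1) := by
    intro u huT
    by_cases hu : u ∈ K'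
    · have hi := hKi (hK'T u hu).2
      have h1 := sum_fderiv_density_smul (ρ := ρ) (f := p)
        (chartField_frame_orthonormal i.1 huT hi.1)
        (fun l => (hed u huT hi l).differentiableAt (by simp))
        (volumeDensity_eventuallyEq σ huT hi.1)
        (fun l => (hpd u huT hi l).differentiableAt (by simp))
      have h2 := inner_diracLoc_sub hψ hφ huT hi
      rw [← dirac_loc hψ hi, ← dirac_loc hφ hi, inner_loc _ _ hi, inner_loc _ _ hi] at h2
      simp only [(hFev _ u huT).fderiv_eq]
      rw [h1, ← smul_neg]
      exact congrArg _ h2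
    · rw [hh0 _ (hTK' u huT hu), smul_zero]
      simp [hF'0 _ u hu]
  rw [setIntegral_congr_fun (isOpen_target x₀).measurableSet hmain,
    setIntegral_eq_integral_of_forall_compl_eq_zero (by
      intro u hu
      have : u ∉ K' := fun hn => hu (hK'T u hn).1
      simp [hF'0 _ u this]), integral_neg, integral_finsetSum]
  · simp [integral_fderiv_eq_zero (hFsmooth _) (hFc _)]
  · intro q _
    exact ((hFsmooth q).continuous_fderiv_apply (by simp)).comp
      (continuous_id.prodMk continuous_const)
      |>.integrable_of_hasCompactSupport ((hFc q).fderiv_apply ℝ _)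

end Bundle

/-! ### The Dirac operator is formally self-adjoint -/

section Bundle

variable {m : ℕ} {X : Type*} [TopologicalSpace X] [ChartedSpace (Model m) X]
  [IsManifold (𝓡 (2 * m)) ∞ X] {g : Metric m X}
  {S : Type*} [NormedAddCommGroup S] [InnerProductSpace ℂ S] [FiniteDimensional ℂ S]
  {W : Type*} [NormedAddCommGroup W] [InnerProductSpace ℂ W] [FiniteDimensional ℂ W]
  {ι κ : Type*} {Δ : SpinorModule m S} {σ : SpinStructure g ι} {E : FlatHermitianBundle X W κ}

theorem loc_add (ψ φ : SpinorField Δ σ E) (i : ι × κ) (x : X) :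
    (ψ + φ).loc i x = ψ.loc i x + φ.loc i x :=
  map_add ((twistedSpinorBundle Δ σ E).coordChange ((twistedSpinorBundle Δ σ E).indexAt x) i x)
    (ψ.val x) (φ.val x)

theorem val_add (ψ φ : SpinorField Δ σ E) (x : X) : (ψ + φ).val x = ψ.val x + φ.val x := rfl

theorem dirac_add_val {ψ φ : SpinorField Δ σ E} (hψ : ψ.IsSmooth) (hφ : φ.IsSmooth) (x : X) :
    (dirac (ψ + φ)).val x = (dirac ψ).val x + (dirac φ).val x := by
  have hi : x ∈ domain σ E ((twistedSpinorBundle Δ σ E).indexAt x) :=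
    (twistedSpinorBundle Δ σ E).mem_baseSet_at x
  simp only [dirac_val, diracLoc]
  rw [← Finset.sum_add_distrib]
  refine Finset.sum_congr rfl fun k _ => ?_
  rw [← map_add]
  congr 1
  have h1 := mfderiv_add (loc_mdifferentiableAt hψ hi) (loc_mdifferentiableAt hφ hi)
  have h2 : mvfderiv (𝓡 (2 * m)) ((ψ + φ).loc ((twistedSpinorBundle Δ σ E).indexAt x)) x
      = mvfderiv (𝓡 (2 * m)) (ψ.loc ((twistedSpinorBundle Δ σ E).indexAt x)) x
        + mvfderiv (𝓡 (2 * m)) (φ.loc ((twistedSpinorBundle Δ σ E).indexAt x)) x := by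
    have h3 : (ψ + φ).loc ((twistedSpinorBundle Δ σ E).indexAt x)
        = ψ.loc ((twistedSpinorBundle Δ σ E).indexAt x)
          + φ.loc ((twistedSpinorBundle Δ σ E).indexAt x) := funext fun y => loc_add ψ φ _ y
    rw [h3]
    exact h1
  simp only [SpinorField.covDeriv, h2, loc_add, add_apply, map_add]
  abel

theorem add_isSmooth {ψ φ : SpinorField Δ σ E} (hψ : ψ.IsSmooth) (hφ : φ.IsSmooth) :
    (ψ + φ).IsSmooth :=
  ContMDiff.add_section hψ hφ

theorem zero_isSmooth : (0 : SpinorField Δ σ E).IsSmooth := by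
  rw [isSmooth_iff]
  intro i
  exact (contMDiffOn_const (c := (0 : Fibre S W))).congr fun x _ =>
    loc_eq_zero (ψ := (0 : SpinorField Δ σ E)) rfl i

theorem smul_isSmooth {f : X → ℝ} (hf : ContMDiff (𝓡 (2 * m)) 𝓘(ℝ, ℝ) ∞ f)
    {ψ : SpinorField Δ σ E} (hψ : ψ.IsSmooth) : SpinorField.IsSmooth (f • ψ : SpinorField Δ σ E) :=
  ContMDiff.smul_section hf hψ

theorem smul_val (f : X → ℝ) (ψ : SpinorField Δ σ E) (x : X) :
    SpinorField.val (f • ψ : SpinorField Δ σ E) x = f x • ψ.val x := rfl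

theorem val_eq_zero_of_notMem {ψ : SpinorField Δ σ E} {x : X} {K : Set X}
    (hK : closure {y : X | ψ y ≠ 0} = K) (hx : x ∉ K) : ψ.val x = 0 := by
  rw [← hK] at hx
  by_contra h
  exact hx (subset_closure h)

variable [T2Space X] [MeasurableSpace X] [BorelSpace X]

/-- A bump function around a point is integrable in a chart, so the set where it exceeds 1/2 is a
neighbourhood of finite measure. -/
theorem isFiniteMeasureOnCompacts_riemannianVolume (σ : SpinStructure g ι) :
    IsFiniteMeasureOnCompacts (riemannianVolume g) := by
  have : IsLocallyFiniteMeasure (riemannianVolume g) := by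
    refine ⟨fun x => ?_⟩
    obtain ⟨f, hf, hc, hs, hx⟩ := exists_bump (m := m)
      (isOpen_extChartAt_source (I := 𝓡 (2 * m)) x) (mem_extChartAt_source x)
    have h := integrable_riemannianVolume σ hf.continuous hc hs
      fun y hy => image_eq_zero_of_notMem_tsupport hy
    refine ⟨{y | 1 / 2 < ‖f y‖}, ?_, h.measure_norm_gt_lt_top (by norm_num)⟩
    refine (isOpen_lt continuous_const hf.continuous.norm).mem_nhds ?_
    simp only [Set.mem_ofPred_eq, hx]
    norm_num
  infer_instance

theorem integrable_inner (σ : SpinStructure g ι) {E : FlatHermitianBundle X W κ}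
    {ψ φ : SpinorField Δ σ E} (hψ : ψ.IsCont) (hφ : φ.IsCont)
    {K : Set X} (hK : IsCompact K) (h0 : ∀ x, x ∉ K → ψ.val x = 0 ∨ φ.val x = 0) :
    Integrable (fun x => inner ℂ (ψ.val x) (φ.val x)) (riemannianVolume g) := by
  have := isFiniteMeasureOnCompacts_riemannianVolume σ
  refine (hψ.inner hφ).integrable_of_hasCompactSupport (HasCompactSupport.intro hK fun x hx => ?_)
  rcases h0 x hx with h | h
  · rw [h, inner_zero_left]
  · rw [h, inner_zero_right]

theorem integrable_inner_dirac {ψ φ : SpinorField Δ σ E} (hψ : ψ.IsSmooth) (hφ : φ.IsSmooth)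
    {K : Set X} (hK : IsCompact K) (h0 : ∀ x, x ∉ K → ψ.val x = 0) :
    Integrable (fun x => inner ℂ ((dirac ψ).val x) (φ.val x)) (riemannianVolume g) ∧
      Integrable (fun x => inner ℂ (ψ.val x) ((dirac φ).val x)) (riemannianVolume g) := by
  refine ⟨integrable_inner σ hψ.isCont_dirac hφ.isCont hK fun x hx => Or.inl ?_,
    integrable_inner σ hψ.isCont hφ.isCont_dirac hK fun x hx => Or.inl (h0 x hx)⟩
  refine dirac_val_eq_zero ?_
  filter_upwards [hK.isClosed.isOpen_compl.mem_nhds hx] with y hy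
  exact h0 y hy

/-- Smoothness and the common support set travel with the integral identity through the induction,
because they supply the integrability needed to add integrals. -/
theorem integral_inner_dirac_sub_sum {φ : SpinorField Δ σ E} (hφ : φ.IsSmooth) {K : Set X}
    (hK : IsCompact K) {τ : Type*} (s : Finset τ) (ψ : τ → SpinorField Δ σ E)
    (hψ : ∀ t, (ψ t).IsSmooth) (h0 : ∀ t x, x ∉ K → (ψ t).val x = 0)
    (h : ∀ t, ∫ x, (inner ℂ ((dirac (ψ t)).val x) (φ.val x)
      - inner ℂ ((ψ t).val x) ((dirac φ).val x)) ∂(riemannianVolume g) = 0) :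
    (∑ t ∈ s, ψ t).IsSmooth ∧ (∀ x, x ∉ K → (∑ t ∈ s, ψ t).val x = 0) ∧
      ∫ x, (inner ℂ ((dirac (∑ t ∈ s, ψ t)).val x) (φ.val x)
        - inner ℂ ((∑ t ∈ s, ψ t).val x) ((dirac φ).val x)) ∂(riemannianVolume g) = 0 := by
  classical
  induction s using Finset.induction_on with
  | empty =>
    refine ⟨zero_isSmooth, fun x _ => rfl, ?_⟩
    have h1 : ∀ x, (dirac (0 : SpinorField Δ σ E)).val x = 0 := fun x =>
      dirac_val_eq_zero (Filter.Eventually.of_forall fun _ => rfl)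
    have h2 : ∀ x, (0 : SpinorField Δ σ E).val x = 0 := fun x => rfl
    simp only [Finset.sum_empty, h1, h2, inner_zero_left, sub_zero, integral_zero]
  | insert t s ht ih =>
    obtain ⟨ih1, ih2, ih3⟩ := ih
    rw [Finset.sum_insert ht]
    refine ⟨add_isSmooth (hψ t) ih1, fun x hx => ?_, ?_⟩
    · rw [val_add, h0 t x hx, ih2 x hx, add_zero]
    · have h1 := integrable_inner_dirac (hψ t) hφ hK (h0 t)
      have h2 := integrable_inner_dirac ih1 hφ hK ih2
      have h3 := integral_add (h1.1.sub h1.2) (h2.1.sub h2.2)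
      simp only [Pi.sub_apply] at h3
      rw [h t, ih3, add_zero] at h3
      rw [← h3]
      refine integral_congr_ae (Filter.Eventually.of_forall fun x => ?_)
      simp only [dirac_add_val (hψ t) ih1, val_add, inner_add_left]
      ring

/-- A partition of unity cuts `ψ` into pieces lying in one chart and one local frame. Only `ψ` is
cut, so compact support of `φ` is not needed. -/
theorem integral_inner_dirac_eq [SigmaCompactSpace X] {ψ φ : SpinorField Δ σ E} (hψ : ψ.IsSmooth)
    (hφ : φ.IsSmooth) (hc : ψ.IsCompactlySupported) :
    ∫ x, inner ℂ ((dirac ψ).val x) (φ.val x) ∂(riemannianVolume g)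
      = ∫ x, inner ℂ (ψ.val x) ((dirac φ).val x) ∂(riemannianVolume g) := by
  set K := closure {x | ψ x ≠ 0} with hK
  have h0 : ∀ x, x ∉ K → ψ.val x = 0 := fun x hx => val_eq_zero_of_notMem hK.symm hx
  obtain ⟨f, hf⟩ := SmoothPartitionOfUnity.exists_isSubordinate (𝓡 (2 * m)) (s := Set.univ)
    isClosed_univ (fun x : X => (extChartAt (𝓡 (2 * m)) x).source ∩
      domain σ E ((twistedSpinorBundle Δ σ E).indexAt x))
    (fun x => (isOpen_extChartAt_source x).inter (isOpen_domain σ E _))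
    (fun x _ => Set.mem_iUnion.2 ⟨x, mem_extChartAt_source x,
      (twistedSpinorBundle Δ σ E).mem_baseSet_at x⟩)
  -- Local finiteness leaves finitely many cutoff functions that meet the compact support of `ψ`.
  have hfin := f.locallyFinite.finite_nonempty_inter_compact hc
  have hsum : ψ = ∑ t ∈ hfin.toFinset, (⇑(f t) • ψ : SpinorField Δ σ E) := by
    have hval : ∀ s : Finset X, ∀ x, (∑ t ∈ s, (⇑(f t) • ψ : SpinorField Δ σ E)).val x
        = (∑ t ∈ s, f t x) • ψ.val x := by
      classical
      intro s x
      induction s using Finset.induction_on with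
      | empty => exact (zero_smul ℝ (ψ.val x)).symm
      | insert t s ht ih => rw [Finset.sum_insert ht, val_add, ih, Finset.sum_insert ht, add_smul,
          smul_val]
    funext x
    refine Eq.trans ?_ (hval _ x).symm
    by_cases hx : x ∈ K
    · have h1 := f.sum_eq_one (Set.mem_univ x)
      rw [finsum_eq_sum_of_support_subset (s := hfin.toFinset)] at h1
      · rw [h1]
        exact (one_smul ℝ (ψ.val x)).symm
      · intro t ht
        exact (Set.Finite.mem_toFinset hfin).2 ⟨x, ht, hx⟩
    · rw [h0 x hx, smul_zero]
      exact h0 x hx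
  have hmain := (integral_inner_dirac_sub_sum hφ hc hfin.toFinset
    (fun t => (⇑(f t) • ψ : SpinorField Δ σ E)) (fun t => smul_isSmooth (f t).contMDiff hψ)
    (fun t x hx => by rw [smul_val, h0 x hx, smul_zero]) (fun t => ?_)).2.2
  · rw [← hsum] at hmain
    have h1 := integrable_inner_dirac hψ hφ hc h0
    rwa [integral_sub h1.1 h1.2, sub_eq_zero] at hmain
  · refine integral_inner_dirac_sub (smul_isSmooth (f t).contMDiff hψ) hφ
      (K := tsupport (f t) ∩ K) (hc.inter_left (isClosed_tsupport _))
      (fun x hx => (hf t hx.1).1) (fun x hx => (hf t hx.1).2) fun x hx => ?_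
    rw [smul_val]
    by_cases hxK : x ∈ K
    · rw [image_eq_zero_of_notMem_tsupport fun hn => hx ⟨hn, hxK⟩, zero_smul]
    · rw [h0 x hxK, smul_zero]

end Bundle

/-! ### Self-adjointness of the twisted Dirac operator -/

section Volume

variable {m : ℕ} {X : Type*} [TopologicalSpace X] [ChartedSpace (Model m) X]
  [IsManifold (𝓡 (2 * m)) ∞ X] {g : Metric m X} {ι : Type*} [MeasurableSpace X] [BorelSpace X]

/-- In a chart the density is strictly positive on a nonempty open set of positive Lebesgue measure.
-/
theorem isOpenPosMeasure_riemannianVolume (σ : SpinStructure g ι) :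
    (riemannianVolume g).IsOpenPosMeasure := by
  refine ⟨fun U hU ⟨x, hx⟩ h0 => ?_⟩
  have h1 : chartVolume g x U = 0 := by
    rw [← riemannianVolume_restrict_source]
    exact le_antisymm ((Measure.restrict_le_self _).trans h0.le) bot_le
  rw [chartVolume_apply g x hU.measurableSet] at h1
  set O := (extChartAt (𝓡 (2 * m)) x).symm ⁻¹' U ∩ (extChartAt (𝓡 (2 * m)) x).target with hO
  have hOo : IsOpen O := by
    rw [hO, Set.inter_comm]
    exact (continuousOn_extChartAt_symm x).isOpen_inter_preimage (isOpen_target x) hU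
  have hOn : O.Nonempty := by
    refine ⟨extChartAt (𝓡 (2 * m)) x x, ?_, mem_extChartAt_target x⟩
    rw [Set.mem_preimage, extChartAt_to_inv]
    exact hx
  have hm : AEMeasurable (fun u => ENNReal.ofReal (volumeDensity g x u)) (volume.restrict O) :=
    (((volumeDensity_continuousOn σ).mono Set.inter_subset_right).aemeasurable
      hOo.measurableSet).ennreal_ofReal
  rw [lintegral_eq_zero_iff' hm, Filter.EventuallyEq, ae_restrict_iff' hOo.measurableSet] at h1
  refine (hOo.measure_pos volume hOn).ne' (measure_mono_null (fun u hu => ?_) (ae_iff.1 h1))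
  simp only [Set.mem_ofPred_eq, Classical.not_imp, Pi.zero_apply, ENNReal.ofReal_eq_zero, not_le]
  exact ⟨hu, volumeDensity_pos σ hu.2⟩

end Volume

/-- The form `L ∘ α`, for a differential form `α` and a continuous linear map `L`. -/
def DifferentialForm.map {m : ℕ} {X : Type*} [TopologicalSpace X] [ChartedSpace (Model m) X]
    [IsManifold (𝓡 (2 * m)) ∞ X] {K K' : Type*} [NormedAddCommGroup K] [NormedSpace ℝ K]
    [NormedAddCommGroup K'] [NormedSpace ℝ K'] (L : K →L[ℝ] K') {j : ℕ}
    (α : DifferentialForm m X K j) : DifferentialForm m X K' j where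
  toFun x := L.compContinuousAlternatingMap (α.toFun x)
  smooth U hU V hV := L.contMDiff.comp_contMDiffOn (α.smooth U hU V hV)

section Bundle

variable {m : ℕ} {X : Type*} [TopologicalSpace X] [ChartedSpace (Model m) X]
  [IsManifold (𝓡 (2 * m)) ∞ X] {g : Metric m X}
  {S : Type*} [NormedAddCommGroup S] [InnerProductSpace ℂ S] [FiniteDimensional ℂ S]
  {W : Type*} [NormedAddCommGroup W] [InnerProductSpace ℂ W] [FiniteDimensional ℂ W]
  {ι κ : Type*} {Δ : SpinorModule m S} {σ : SpinStructure g ι} {E : FlatHermitianBundle X W κ}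

/-- Clifford multiplication of a section by a differential form. -/
def formAction (H : ∀ j, DifferentialForm m X ℂ j) (ψ : SpinorField Δ σ E) : SpinorField Δ σ E :=
  fun x => (formLoc Δ W σ H ((twistedSpinorBundle Δ σ E).indexAt x).1 x (ψ.val x) : Fibre S W)

theorem formAction_val (H : ∀ j, DifferentialForm m X ℂ j) (ψ : SpinorField Δ σ E) (x : X) :
    (formAction H ψ).val x
      = formLoc Δ W σ H ((twistedSpinorBundle Δ σ E).indexAt x).1 x (ψ.val x) := rfl

theorem formAction_loc (H : ∀ j, DifferentialForm m X ℂ j) (ψ : SpinorField Δ σ E) {i : ι × κ}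
    {x : X} (hi : x ∈ domain σ E i) :
    (formAction H ψ).loc i x = formLoc Δ W σ H i.1 x (ψ.loc i x) :=
  changeOp_formLoc H ((twistedSpinorBundle Δ σ E).mem_baseSet_at x) hi _

theorem SpinorField.IsCont.formAction (H : ∀ j, DifferentialForm m X ℂ j) {ψ : SpinorField Δ σ E}
    (hψ : ψ.IsCont) : (formAction H ψ).IsCont := fun i =>
  (formLoc_continuousOn H i.1 Set.inter_subset_left (hψ i)).congr
    fun _ hx => formAction_loc H ψ hx

section Integration

variable [T2Space X] [SigmaCompactSpace X] [MeasurableSpace X] [BorelSpace X]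

theorem integrable_inner_formAction (H : ∀ j, DifferentialForm m X ℂ j) {ψ φ : SpinorField Δ σ E}
    (hψ : ψ.IsSmooth) (hφ : φ.IsSmooth) {K : Set X} (hK : IsCompact K)
    (h0 : ∀ x, x ∉ K → ψ.val x = 0) :
    Integrable (fun x => inner ℂ ((formAction H ψ).val x) (φ.val x)) (riemannianVolume g) ∧
      Integrable (fun x => inner ℂ (ψ.val x) ((formAction H φ).val x)) (riemannianVolume g) := by
  refine ⟨integrable_inner σ (hψ.isCont.formAction H) hφ.isCont hK fun x hx => Or.inl ?_,
    integrable_inner σ hψ.isCont (hφ.isCont.formAction H) hK fun x hx => Or.inl (h0 x hx)⟩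
  rw [formAction_val, h0 x hx, map_zero]

/-- The Dirac contributions agree on both sides, leaving only the zero-order part. -/
theorem l2Inner_twistedDirac_eq_iff (H : ∀ j, DifferentialForm m X ℂ j) {ψ φ : SpinorField Δ σ E}
    (hψ : ψ.IsSmooth) (hφ : φ.IsSmooth) (hc : ψ.IsCompactlySupported) :
    l2Inner (twistedDirac H ψ) φ = l2Inner ψ (twistedDirac H φ) ↔
      ∫ x, (inner ℂ ((formAction H ψ).val x) (φ.val x)
        - inner ℂ (ψ.val x) ((formAction H φ).val x)) ∂(riemannianVolume g) = 0 := by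
  have h0 : ∀ x, x ∉ closure {y : X | ψ y ≠ 0} → ψ.val x = 0 :=
    fun x hx => val_eq_zero_of_notMem rfl hx
  have h1 := integrable_inner_dirac hψ hφ hc h0
  have h2 := integrable_inner_formAction H hψ hφ hc h0
  have e1 : l2Inner (twistedDirac H ψ) φ
      = ∫ x, inner ℂ ((dirac ψ).val x) (φ.val x) ∂(riemannianVolume g)
        + ∫ x, inner ℂ ((formAction H ψ).val x) (φ.val x) ∂(riemannianVolume g) := by
    rw [← integral_add h1.1 h2.1]
    simp only [l2Inner, twistedDirac_val, inner_add_left, formAction_val]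
  have e2 : l2Inner ψ (twistedDirac H φ)
      = ∫ x, inner ℂ (ψ.val x) ((dirac φ).val x) ∂(riemannianVolume g)
        + ∫ x, inner ℂ (ψ.val x) ((formAction H φ).val x) ∂(riemannianVolume g) := by
    rw [← integral_add h1.2 h2.2]
    simp only [l2Inner, twistedDirac_val, inner_add_right, formAction_val]
  rw [e1, e2, integral_inner_dirac_eq hψ hφ hc, add_right_inj, integral_sub h2.1 h2.2, sub_eq_zero]

/-- If the twisted Dirac operator is self-adjoint, then so is Clifford multiplication by the form
at each point. -/
theorem inner_formLoc_of_isFormallySelfAdjoint {H : ∀ j, DifferentialForm m X ℂ j}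
    (h : IsFormallySelfAdjoint (twistedDirac (Δ := Δ) (σ := σ) (E := E) H)) {i : ι × κ} {x : X}
    (hi : x ∈ domain σ E i) (s t : Fibre S W) :
    inner ℂ (formLoc Δ W σ H i.1 x s) t = inner ℂ s (formLoc Δ W σ H i.1 x t) := by
  set b : Fibre S W → X → ℂ := fun t y =>
    inner ℂ (formLoc Δ W σ H i.1 y s) t - inner ℂ s (formLoc Δ W σ H i.1 y t) with hb
  by_contra hne
  have hbx : b t x ≠ 0 := sub_ne_zero.2 hne
  -- Rescaling `t` by the conjugate of the defect makes the defect at `x` a positive real number, so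
  -- positivity of the integral can be used.
  set t' : Fibre S W := (starRingEnd ℂ (b t x)) • t with ht'
  have hbt : 0 < (b t' x).re := by
    have h1 : b t' x = starRingEnd ℂ (b t x) * b t x := by
      simp only [hb, ht', map_smul, inner_smul_right, mul_sub]
    rw [h1, mul_comm, Complex.mul_conj, Complex.ofReal_re]
    exact Complex.normSq_pos.2 hbx
  have hcont : ContinuousOn (fun y => (b t' y).re) (domain σ E i) := by
    refine Complex.continuous_re.comp_continuousOn (ContinuousOn.sub ?_ ?_)
    · exact (formLoc_continuousOn H i.1 Set.inter_subset_left continuousOn_const).inner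
        continuousOn_const
    · exact continuousOn_const.inner
        (formLoc_continuousOn H i.1 Set.inter_subset_left continuousOn_const)
  -- The bump function is placed where the defect still has positive real part, so the integrand
  -- keeps one sign.
  have hUo : IsOpen (domain σ E i ∩ (fun y => (b t' y).re) ⁻¹' Set.Ioi 0) :=
    hcont.isOpen_inter_preimage (isOpen_domain σ E i) isOpen_Ioi
  obtain ⟨χ, hχ, hχc, hχU, hχx⟩ := exists_bump (m := m) hUo ⟨hi, hbt⟩
  have hχi : tsupport χ ⊆ domain σ E i := fun y hy => (hχU hy).1
  set ψ := localSection Δ σ E i χ s with hψ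
  set φ := localSection Δ σ E i χ t' with hφ
  have hψs : ψ.IsSmooth := localSection_isSmooth i hχ hχi s
  have hφs : φ.IsSmooth := localSection_isSmooth i hχ hχi t'
  have hψc : ψ.IsCompactlySupported := localSection_isCompactlySupported i hχc s
  have hφc : φ.IsCompactlySupported := localSection_isCompactlySupported i hχc t'
  have h1 := (l2Inner_twistedDirac_eq_iff H hψs hφs hψc).1 (h ψ φ hψs hφs hψc hφc)
  set F : X → ℂ := fun y => inner ℂ ((formAction H ψ).val y) (φ.val y)
    - inner ℂ (ψ.val y) ((formAction H φ).val y) with hF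
  have hFin : ∀ y ∈ domain σ E i, F y = (χ y * χ y : ℝ) * b t' y := by
    intro y hy
    simp only [hF]
    rw [← inner_loc _ _ hy, ← inner_loc _ _ hy, formAction_loc H ψ hy, formAction_loc H φ hy, hψ,
      hφ, localSection_loc i χ s hy, localSection_loc i χ t' hy]
    simp only [hb, ← Complex.coe_smul, map_smul, inner_smul_left, inner_smul_right,
      Complex.conj_ofReal]
    push_cast
    ring
  have hFout : ∀ y, χ y = 0 → F y = 0 := by
    intro y hy
    have h2 : ψ.val y = 0 := by rw [hψ, localSection_val, hy, zero_smul]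
    have h3 : φ.val y = 0 := by rw [hφ, localSection_val, hy, zero_smul]
    simp only [hF, h2, h3, inner_zero_left, inner_zero_right, sub_zero]
  have hFc : Continuous F := ((hψs.isCont.formAction H).inner hφs.isCont).sub
    (hψs.isCont.inner (hφs.isCont.formAction H))
  have hFs : HasCompactSupport F :=
    HasCompactSupport.intro hχc fun y hy => hFout y (image_eq_zero_of_notMem_tsupport hy)
  have := isFiniteMeasureOnCompacts_riemannianVolume σ
  have := isOpenPosMeasure_riemannianVolume σ
  -- The integrand equals the squared cutoff times the defect; its real part is continuous,
  -- nonnegative and nonzero at `x`, so it cannot integrate to zero.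
  have hpos : 0 < ∫ y, (F y).re ∂(riemannianVolume g) := by
    refine Continuous.integral_pos_of_hasCompactSupport_nonneg_nonzero (x := x)
      (Complex.continuous_re.comp hFc) (hFs.comp_left Complex.zero_re) (fun y => ?_) ?_
    · by_cases hy : y ∈ tsupport χ
      · change 0 ≤ (F y).re
        rw [hFin y (hχi hy), Complex.re_ofReal_mul]
        exact mul_nonneg (mul_self_nonneg _) (le_of_lt (hχU hy).2)
      · change 0 ≤ (F y).re
        rw [hFout y (image_eq_zero_of_notMem_tsupport hy), Complex.zero_re]
    · rw [hFin x hi, Complex.re_ofReal_mul, hχx, mul_one, one_mul]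
      exact hbt.ne'
  have h2 := integral_re (𝕜 := ℂ) (hFc.integrable_of_hasCompactSupport (μ := riemannianVolume g) hFs)
  rw [h1] at h2
  simp only [RCLike.re_to_complex, Complex.zero_re] at h2
  exact hpos.ne' h2

theorem isFormallySelfAdjoint_of_inner_formLoc {H : ∀ j, DifferentialForm m X ℂ j}
    (h : ∀ (a : ι) (x : X), x ∈ σ.U a → ∀ s t : Fibre S W,
      inner ℂ (formLoc Δ W σ H a x s) t = inner ℂ s (formLoc Δ W σ H a x t)) :
    IsFormallySelfAdjoint (twistedDirac (Δ := Δ) (σ := σ) (E := E) H) := by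
  intro ψ φ hψ hφ hψc _
  rw [l2Inner_twistedDirac_eq_iff H hψ hφ hψc]
  simp only [formAction_val]
  have h1 : ∀ x, inner ℂ (formLoc Δ W σ H ((twistedSpinorBundle Δ σ E).indexAt x).1 x (ψ.val x))
      (φ.val x) = inner ℂ (ψ.val x)
        (formLoc Δ W σ H ((twistedSpinorBundle Δ σ E).indexAt x).1 x (φ.val x)) :=
    fun x => h _ x ((twistedSpinorBundle Δ σ E).mem_baseSet_at x).1 _ _
  simp only [h1, sub_self, integral_zero]

end Integration

theorem inner_formLoc (H : ∀ j, DifferentialForm m X ℂ j) (a : ι) (x : X) (s t : Fibre S W) :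
    inner ℂ (formLoc Δ W σ H a x s) t
      = inner ℂ s ((∑ j ∈ Finset.range (2 * m + 1), cliffordSum Δ W (fun f =>
          (-1) ^ ((j + 1).choose 2) * starRingEnd ℂ (formCoeff σ H a x j f))) t) := by
  rw [formLoc, LinearMap.sum_apply, LinearMap.sum_apply, sum_inner, inner_sum]
  exact Finset.sum_congr rfl fun j _ => inner_cliffordSum Δ _ s t

/-- Self-adjointness equates the operator with its adjoint, and injectivity of Clifford
multiplication compares their coefficients degree by degree. -/
theorem formCoeff_eq_of_inner_formLoc [Nontrivial W] {H : ∀ j, DifferentialForm m X ℂ j} {a : ι}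
    {x : X} (h : ∀ s t : Fibre S W,
      inner ℂ (formLoc Δ W σ H a x s) t = inner ℂ s (formLoc Δ W σ H a x t)) {j : ℕ}
    (hj : j ≤ 2 * m) {f : Fin j → Fin (2 * m)} (hf : StrictMono f) :
    formCoeff σ H a x j f
      = (-1) ^ ((j + 1).choose 2) * starRingEnd ℂ (formCoeff σ H a x j f) := by
  rw [← sub_eq_zero]
  refine coeff_eq_zero_of_sum_cliffordSum_eq_zero Δ (W := W) (Finset.range (2 * m + 1))
    (fun j => formCoeff σ H a x j - fun f =>
      (-1) ^ ((j + 1).choose 2) * starRingEnd ℂ (formCoeff σ H a x j f)) ?_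
    (Finset.mem_range.2 (by omega)) hf
  simp only [cliffordSum_sub]
  rw [Finset.sum_sub_distrib, sub_eq_zero]
  refine LinearMap.ext fun t => ext_inner_left ℂ fun s => ?_
  rw [← inner_formLoc, h]
  rfl

theorem inner_formLoc_of_formCoeff_eq {H : ∀ j, DifferentialForm m X ℂ j} {a : ι} {x : X}
    (h : ∀ j f, formCoeff σ H a x j f
      = (-1) ^ ((j + 1).choose 2) * starRingEnd ℂ (formCoeff σ H a x j f)) (s t : Fibre S W) :
    inner ℂ (formLoc Δ W σ H a x s) t = inner ℂ s (formLoc Δ W σ H a x t) := by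
  rw [inner_formLoc]
  simp only [← h]
  rfl

theorem isFormallySelfAdjoint_iff [T2Space X] [SigmaCompactSpace X] [MeasurableSpace X]
    [BorelSpace X] [Nontrivial W] (H : ∀ j, DifferentialForm m X ℂ j)
    (hH : ∀ x, (H 0).toFun x = 0) :
    IsFormallySelfAdjoint (twistedDirac (Δ := Δ) (σ := σ) (E := E) H) ↔
      ∃ A B : ∀ j, DifferentialForm m X ℝ j, ∀ k ≥ 1, ∀ x,
        (∀ v, (H (4 * k)).toFun x v = ((A (4 * k)).toFun x v : ℂ)) ∧
        (∀ v, (H (4 * k - 2)).toFun x v = Complex.I * ((B (4 * k - 2)).toFun x v : ℂ)) ∧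
        (∀ v, (H (4 * k - 1)).toFun x v = ((A (4 * k - 1)).toFun x v : ℂ)) ∧
        (∀ v, (H (4 * k - 3)).toFun x v = Complex.I * ((B (4 * k - 3)).toFun x v : ℂ)) := by
  constructor
  · intro h
    have hcoeff : ∀ j x, ∃ a, x ∈ σ.U a ∧ ∀ f : Fin j → Fin (2 * m), StrictMono f →
        formCoeff σ H a x j f
          = (-1) ^ ((j + 1).choose 2) * starRingEnd ℂ (formCoeff σ H a x j f) := by
      intro j x
      have hi : x ∈ domain σ E ((twistedSpinorBundle Δ σ E).indexAt x) :=
        (twistedSpinorBundle Δ σ E).mem_baseSet_at x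
      refine ⟨_, hi.1, fun f hf => ?_⟩
      -- An increasing map exists only in degrees up to `2 * m`, so larger degrees need no separate
      -- treatment here.
      have hj : j ≤ 2 * m := by
        simpa using Fintype.card_le_of_injective f hf.injective
      exact formCoeff_eq_of_inner_formLoc (inner_formLoc_of_isFormallySelfAdjoint h hi) hj hf
    have him : ∀ j, j % 4 = 0 ∨ j % 4 = 3 → ∀ x v, (H j).toFun x v
        = (((H j).map Complex.reCLM).toFun x v : ℂ) := by
      intro j hj x v
      obtain ⟨a, ha, hf⟩ := hcoeff j x
      -- The sign is `+1`, so the coefficients in one frame are real; the imaginary part is then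
      -- zero as an alternating form.
      have h0 : Complex.imCLM.compContinuousAlternatingMap ((H j).toFun x) = 0 := by
        refine form_eq_zero_of_coeff σ ha _ fun f hmono => ?_
        have h1 := hf f hmono
        rw [((even_choose_two_iff j).2 hj).neg_one_pow, one_mul] at h1
        exact Complex.conj_eq_iff_im.1 h1.symm
      have h1 : ((H j).toFun x v).im = 0 := congrArg (fun α => α v) h0
      refine Complex.ext rfl ?_
      rw [h1, Complex.ofReal_im]
    have hre : ∀ j, ¬(j % 4 = 0 ∨ j % 4 = 3) → ∀ x v, (H j).toFun x v
        = Complex.I * (((H j).map Complex.imCLM).toFun x v : ℂ) := by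
      intro j hj x v
      obtain ⟨a, ha, hf⟩ := hcoeff j x
      have h0 : Complex.reCLM.compContinuousAlternatingMap ((H j).toFun x) = 0 := by
        refine form_eq_zero_of_coeff σ ha _ fun f hmono => ?_
        have h1 := congrArg Complex.re (hf f hmono)
        rw [(Nat.not_even_iff_odd.1 ((even_choose_two_iff j).not.2 hj)).neg_one_pow, neg_one_mul,
          Complex.neg_re, Complex.conj_re] at h1
        exact self_eq_neg.1 h1
      have h1 : ((H j).toFun x v).re = 0 := congrArg (fun α => α v) h0
      refine Complex.ext ?_ ?_
      · rw [h1, Complex.I_mul_re, Complex.ofReal_im, neg_zero]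
      · rw [Complex.I_mul_im]
        rfl
    exact ⟨fun j => (H j).map Complex.reCLM, fun j => (H j).map Complex.imCLM, fun k hk x =>
      ⟨him _ (by omega) x, hre _ (by omega) x, him _ (by omega) x, hre _ (by omega) x⟩⟩
  · rintro ⟨A, B, hAB⟩
    refine isFormallySelfAdjoint_of_inner_formLoc fun a x _ =>
      inner_formLoc_of_formCoeff_eq fun j f => ?_
    have hreal : ∀ j, j % 4 = 0 ∨ j % 4 = 3 → ∀ v, starRingEnd ℂ ((H j).toFun x v)
        = (H j).toFun x v := by
      intro j hj v
      -- Degree 0 belongs to the residue class but not to the indices `4 * k` with `k ≥ 1`; there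
      -- the form is zero by `hH`.
      rcases Nat.eq_zero_or_pos j with rfl | hpos
      · rw [hH x]
        exact map_zero _
      rcases hj with hj | hj
      · obtain ⟨k, rfl⟩ : ∃ k, j = 4 * k := ⟨j / 4, by omega⟩
        rw [(hAB k (by omega) x).1, Complex.conj_ofReal]
      · obtain ⟨k, hk, rfl⟩ : ∃ k, 1 ≤ k ∧ j = 4 * k - 1 := ⟨j / 4 + 1, by omega, by omega⟩
        rw [(hAB k hk x).2.2.1, Complex.conj_ofReal]
    have himag : ∀ j, ¬(j % 4 = 0 ∨ j % 4 = 3) → ∀ v, starRingEnd ℂ ((H j).toFun x v)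
        = -(H j).toFun x v := by
      intro j hj v
      have hj' : j % 4 = 1 ∨ j % 4 = 2 := by omega
      rcases hj' with hj | hj
      · obtain ⟨k, hk, rfl⟩ : ∃ k, 1 ≤ k ∧ j = 4 * k - 3 := ⟨j / 4 + 1, by omega, by omega⟩
        rw [(hAB k hk x).2.2.2, map_mul, Complex.conj_ofReal, Complex.conj_I, neg_mul]
      · obtain ⟨k, hk, rfl⟩ : ∃ k, 1 ≤ k ∧ j = 4 * k - 2 := ⟨j / 4 + 1, by omega, by omega⟩
        rw [(hAB k hk x).2.1, map_mul, Complex.conj_ofReal, Complex.conj_I, neg_mul]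
    unfold formCoeff
    by_cases hj : j % 4 = 0 ∨ j % 4 = 3
    · rw [hreal j hj, ((even_choose_two_iff j).2 hj).neg_one_pow, one_mul]
    · rw [himag j hj, (Nat.not_even_iff_odd.1 ((even_choose_two_iff j).not.2 hj)).neg_one_pow,
        neg_one_mul, neg_neg]

end Bundle

end TwistedDirac

end

theorem mainTheorem7 (m : ℕ) {X : Type*} [TopologicalSpace X]
    [ChartedSpace (TwistedDirac.Model m) X] [IsManifold (𝓡 (2 * m)) ∞ X]
    [T2Space X] [SigmaCompactSpace X] [MeasurableSpace X] [BorelSpace X]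
    (g : TwistedDirac.Metric m X)
    {S : Type*} [NormedAddCommGroup S] [InnerProductSpace ℂ S] [FiniteDimensional ℂ S]
    (Δ : TwistedDirac.SpinorModule m S)
    {ι : Type*} (σ : TwistedDirac.SpinStructure g ι)
    {W : Type*} [NormedAddCommGroup W] [InnerProductSpace ℂ W] [FiniteDimensional ℂ W]
    [Nontrivial W] {κ : Type*} (E : TwistedDirac.FlatHermitianBundle X W κ)
    (H : ∀ j, TwistedDirac.DifferentialForm m X ℂ j) (hH : ∀ x, (H 0).toFun x = 0) :
    -- `D^E_H γ = - γ D^E_H` if and only if `H` is odd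
    ((∀ ψ : TwistedDirac.SpinorField Δ σ E, ψ.IsSmooth →
        TwistedDirac.twistedDirac H (TwistedDirac.grading ψ)
          = - TwistedDirac.grading (TwistedDirac.twistedDirac H ψ)) ↔
      ∀ j, Even j → ∀ x, (H j).toFun x = 0) ∧
    -- `D^E_H` is self-adjoint if and only if
    -- `H = ∑_{k ≥ 1} (A_{4k} + i B_{4k-2}) + (A_{4k-1} + i B_{4k-3})`
    (TwistedDirac.IsFormallySelfAdjoint
        (TwistedDirac.twistedDirac (Δ := Δ) (σ := σ) (E := E) H) ↔
      ∃ A B : ∀ j, TwistedDirac.DifferentialForm m X ℝ j, ∀ k ≥ 1, ∀ x,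
        (∀ v, (H (4 * k)).toFun x v = ((A (4 * k)).toFun x v : ℂ)) ∧
        (∀ v, (H (4 * k - 2)).toFun x v = Complex.I * ((B (4 * k - 2)).toFun x v : ℂ)) ∧
        (∀ v, (H (4 * k - 1)).toFun x v = ((A (4 * k - 1)).toFun x v : ℂ)) ∧
        (∀ v, (H (4 * k - 3)).toFun x v = Complex.I * ((B (4 * k - 3)).toFun x v : ℂ))) ∧
    -- Clifford multiplication by a nonzero real form of degree `j` is self-adjoint if and only if
    -- `j ≡ 0, 3 mod 4`, and it is skew-adjoint for all other `j`
    (∀ (j : ℕ) (x : X) (α : TangentSpace (𝓡 (2 * m)) x [⋀^Fin j]→L[ℝ] ℝ),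
      (α ≠ 0 →
        ((∀ s t : TwistedDirac.Fibre S W,
          inner ℂ (TwistedDirac.cliffordMul Δ σ E x
              (Complex.ofRealCLM.compContinuousAlternatingMap α) s) t
            = inner ℂ s (TwistedDirac.cliffordMul Δ σ E x
              (Complex.ofRealCLM.compContinuousAlternatingMap α) t)) ↔
          j % 4 = 0 ∨ j % 4 = 3)) ∧
      (¬ (j % 4 = 0 ∨ j % 4 = 3) →
        ∀ s t : TwistedDirac.Fibre S W,
          inner ℂ (TwistedDirac.cliffordMul Δ σ E x
              (Complex.ofRealCLM.compContinuousAlternatingMap α) s) t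
            = - inner ℂ s (TwistedDirac.cliffordMul Δ σ E x
              (Complex.ofRealCLM.compContinuousAlternatingMap α) t))) := by
  exact ⟨TwistedDirac.anticommute_grading_iff H, TwistedDirac.isFormallySelfAdjoint_iff H hH,
    fun _ x α => ⟨TwistedDirac.inner_cliffordMul_ofReal_iff x α,
      fun hj => TwistedDirac.inner_cliffordMul_ofReal_neg hj x α⟩⟩
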